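/- For a real number $r\ge 0$ let $D_r\subset\mathbb{R}^2$ be the closed disk of radius $r$ centered at the origin, let $\oplus$ denote the Minkowski sum, and for $A,B\subseteq\mathbb{R}^2$ and $\alpha\in[0,1]$ put $$S_\alpha(A,B)=(A\oplus D_\alpha)\cap(B\oplus D_{1-\alpha}).$$ Polygons are closed solid regions with at least three vertices, and no three consecutive vertices are collinear. A set $X\subset\mathbb{R}^2$ is said to consist of finitely many vertices (points), line segments and circular arcs if it is the disjoint union of these vertices and of the relative interiors of the segments and arcs, where the endpoints of all the segments and arcs are among the vertices. (Upper bound.) There is an absolute constant $C>0$ such that for every convex polygon $A$ with $n$ vertices, every simple polygon $B$ with $m$ vertices and every $\alpha\in[0,1]$, the boundary $\partial S_\alpha(A,B)$ consists of vertices, line segments and circular arcs whose total number is at most $C(n+m)$. (Tightness in the worst case.) There is an absolute constant $c>0$ such that for all integers $n,m\ge 3$ there are a convex polygon $A$ with $n$ vertices and a simple polygon $B$ with $m$ vertices, at Hausdorff distance $d_H(A,B)=1$, and an $\alpha\in[0,1]$, such that every representation of $\partial S_\alpha(A,B)$ as consisting of vertices, line segments and circular arcs uses at least $c(n+m)$ of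 them in total. -/

import Mathlib

open scoped Pointwise

namespace HausdorffMiddle

/-- The Euclidean plane. -/
abbrev Plane : Type := EuclideanSpace ℝ (Fin 2)

/-- `A` is a (closed, solid) convex polygon with `n ≥ 3` vertices: the convex hull of `n` points in
convex position. -/
def IsConvexPolygon (n : ℕ) (A : Set Plane) : Prop :=
  3 ≤ n ∧ ∃ p : Fin n → Plane, ConvexIndependent ℝ p ∧ A = convexHull ℝ (Set.range p)

/-- A closed polygonal chain is simple if three consecutive vertices are never collinear,
consecutive edges meet only in their common vertex, and any two other distinct edges are disjoint.
(The first condition forces at least three vertices.) -/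
structure IsSimpleChain {m : ℕ} [NeZero m] (P : Polygon Plane m) : Prop where
  nondegenerate : P.HasNondegenerateVertices ℝ
  adjacent : ∀ i : Fin m,
    P.edgeSet ℝ i ∩ P.edgeSet ℝ (finRotate m i) = {P (finRotate m i)}
  nonadjacent : ∀ i j : Fin m, i ≠ j → j ≠ finRotate m i → i ≠ finRotate m j →
    Disjoint (P.edgeSet ℝ i) (P.edgeSet ℝ j)

/-- The closed region enclosed by a closed polygonal chain: the chain itself together with
the bounded connected components of its complement. -/
def enclosedRegion {m : ℕ} (P : Polygon Plane m) : Set Plane :=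
  P.boundary ℝ ∪ {x | x ∉ P.boundary ℝ ∧
    Bornology.IsBounded (connectedComponentIn (P.boundary ℝ)ᶜ x)}

/-- `B` is a (closed, solid) simple polygon with `m` vertices. -/
def IsSimplePolygon (m : ℕ) (B : Set Plane) : Prop :=
  ∃ (_ : NeZero m) (P : Polygon Plane m), IsSimpleChain P ∧ B = enclosedRegion P

/-- `S_α(A, B) = (A ⊕ D_α) ∩ (B ⊕ D_{1-α})`, with `D_r` the closed disk of radius `r` centered at
the origin and `⊕` the Minkowski sum. -/
def middleSet (α : ℝ) (A B : Set Plane) : Set Plane :=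
  (A + Metric.closedBall (0 : Plane) α) ∩ (B + Metric.closedBall (0 : Plane) (1 - α))

/-- The point at angle `t` on the circle with center `c` and radius `r`. -/
noncomputable def circlePoint (c : Plane) (r t : ℝ) : Plane :=
  c + r • !₂[Real.cos t, Real.sin t]

/-- `e` is a nondegenerate line segment without its endpoints, and these endpoints lie in `V`. -/
def IsSegmentPiece (V : Finset Plane) (e : Set Plane) : Prop :=
  ∃ a ∈ V, ∃ b ∈ V, a ≠ b ∧ e = openSegment ℝ a b

/-- `e` is a nondegenerate circular arc (at most one full turn) without its endpoints, and these
endpoints lie in `V`. -/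
def IsArcPiece (V : Finset Plane) (e : Set Plane) : Prop :=
  ∃ (c : Plane) (r s t : ℝ), 0 < r ∧ s < t ∧ t ≤ s + 2 * Real.pi ∧
    circlePoint c r s ∈ V ∧ circlePoint c r t ∈ V ∧ e = circlePoint c r '' Set.Ioo s t

/-- The set `X` consists of the vertices in `V`, the (relatively open) line segments in `L` and the
(relatively open) circular arcs in `R`: these are pairwise disjoint, all segments and arcs end at
vertices, and together they make up `X`. -/
structure ConsistsOf (X : Set Plane) (V : Finset Plane) (L R : Finset (Set Plane)) : Prop where
  segments : ∀ e ∈ L, IsSegmentPiece V e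
  arcs : ∀ e ∈ R, IsArcPiece V e
  pieces_disjoint : ((L : Set (Set Plane)) ∪ (R : Set (Set Plane))).PairwiseDisjoint id
  vertices_disjoint : ∀ e ∈ (L : Set (Set Plane)) ∪ (R : Set (Set Plane)),
    Disjoint e (V : Set Plane)
  cover : X = (V : Set Plane) ∪ ⋃₀ (L : Set (Set Plane)) ∪ ⋃₀ (R : Set (Set Plane))

end HausdorffMiddle

open HausdorffMiddle

/-!
For the upper bound, write the middle set as `K ∩ L` with `K = A ⊕ D_α` and `L = B ⊕ D_{1-α}`. The
proof shows that the boundaries of both sets have an `Outline` of linear size, a set of segments and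
circles that trace them outside a finite set of exceptional points, and that outlines can be
intersected because `K` is convex.

*Intersection.* The boundary of `K ∩ L` consists of parts of both outlines, so it suffices to count
the points where the two boundaries meet without coinciding locally (`card_crossing_le`). A segment
of the outline of `L` contains at most two of them (`card_crossing_seg_le`). Along the points on
circles for which the outer normal of `K` has a positive product with a fixed direction, neither the
curves of `K` nor the circles of `L` alternate in the pattern `a b a b`: the chords of such points
would cross, while the points nearer to one centre than to another form a half-plane
(`card_crossing_circ_le`). Two alternation-free labellings of points on a line have linearly many
runs (`card_le_of_alternation_free`), and two different curves meet at most twice.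

*Outlines.* Both boundaries of polygons are covered by a `Network` of segments, and a thickened
boundary has distance `r` from it. Where the nearest point of the network is unique, the boundary of
the thickening is locally a circle or an offset segment; it remains to count the points with several
nearest points (`exists_outline_of_events`). Such a point between two edges is charged to one of
them injectively, namely to the edge whose end towards the intersection of both lines is farther
from this intersection (`card_edge_edge_le`). For a point between a vertex and something else,
consider the disc of radius `r` about it, which rests on the network at both places. Among such
discs that are close together and rest in similar directions, the places they rest on do not
alternate, as the edges do not cross; the number of places is bounded by the number of vertices
close by, since two long edges close to each other would cross (`card_class_le`). Each vertex is
close to boundedly many cells of a grid (`card_vertex_events_le`).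

Pieces are counted by their starting points: at most four curves of an outline leave a point, since
the boundary keeps its distance from the network (`card_germs_le`, `exists_consistsOf`).

For the lower bound, let `A` and `B` have their vertices on a parabola, except for one vertex of `A`
on the left that makes the Hausdorff distance one. The middle set is `A` for `α = 0` and `B` for
`α = 1`, and each edge between consecutive points of the parabola requires a segment of its own
(`exists_polygons_forall_le_card`).
-/

namespace HausdorffMiddle

open Set Filter Topology Metric

/-! ### Coordinates in the plane -/

/-- The inner product of the plane, in coordinates. -/
def dot (u v : Plane) : ℝ := u 0 * v 0 + u 1 * v 1

/-- The quarter turn, counterclockwise. -/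
noncomputable def rot (u : Plane) : Plane := !₂[-u 1, u 0]

@[simp] lemma rot_zero (u : Plane) : rot u 0 = -u 1 := rfl
@[simp] lemma rot_one (u : Plane) : rot u 1 = u 0 := rfl

lemma plane_ext {x y : Plane} (h0 : x 0 = y 0) (h1 : x 1 = y 1) : x = y := by
  ext i; fin_cases i <;> assumption

lemma dist_sq (x y : Plane) : dist x y ^ 2 = (x 0 - y 0) ^ 2 + (x 1 - y 1) ^ 2 := by
  rw [EuclideanSpace.dist_eq, Real.sq_sqrt (by positivity), Fin.sum_univ_two, Real.dist_eq,
    Real.dist_eq, sq_abs, sq_abs]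

lemma dist_le_iff' {r : ℝ} (hr : 0 ≤ r) {x y : Plane} :
    dist x y ≤ r ↔ (x 0 - y 0) ^ 2 + (x 1 - y 1) ^ 2 ≤ r ^ 2 := by
  rw [← dist_sq, pow_le_pow_iff_left₀ dist_nonneg hr two_ne_zero]

lemma lt_dist_iff {r : ℝ} (hr : 0 ≤ r) {x y : Plane} :
    r < dist x y ↔ r ^ 2 < (x 0 - y 0) ^ 2 + (x 1 - y 1) ^ 2 := by
  rw [← dist_sq, pow_lt_pow_iff_left₀ hr dist_nonneg two_ne_zero]

lemma dist_lt_iff' {r : ℝ} (hr : 0 ≤ r) {x y : Plane} :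
    dist x y < r ↔ (x 0 - y 0) ^ 2 + (x 1 - y 1) ^ 2 < r ^ 2 := by
  rw [← dist_sq, pow_lt_pow_iff_left₀ dist_nonneg hr two_ne_zero]

lemma dist_eq_iff {r : ℝ} (hr : 0 ≤ r) {x y : Plane} :
    dist x y = r ↔ (x 0 - y 0) ^ 2 + (x 1 - y 1) ^ 2 = r ^ 2 := by
  rw [← dist_sq, pow_left_inj₀ dist_nonneg hr two_ne_zero]

lemma dot_comm (u v : Plane) : dot u v = dot v u := by unfold dot; ring
lemma dot_add (u v w : Plane) : dot u (v + w) = dot u v + dot u w := by simp [dot]; ring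
lemma dot_sub (u v w : Plane) : dot u (v - w) = dot u v - dot u w := by simp [dot]; ring
lemma dot_smul (u v : Plane) (c : ℝ) : dot u (c • v) = c * dot u v := by simp [dot]; ring

lemma continuous_dot (u : Plane) : Continuous fun v : Plane => dot u v := by
  unfold dot; fun_prop

lemma norm_sq_eq (u : Plane) : ‖u‖ ^ 2 = u 0 ^ 2 + u 1 ^ 2 := by
  have := dist_sq u 0
  simpa using this

/-! ### Counting labelled points without alternation -/

/-- If no pattern `b a b a` occurs in the labelling `f`, then the label at `x` and the label at
`y > x` agree unless a label occurs for the first time in `(x, y]` or for the last time in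
`[x, y)`. -/
lemma label_eq_of_no_first_last {Λ : Type*} (T : Finset ℝ) (f : ℝ → Λ)
    (hf : ∀ x₁ ∈ T, ∀ x₂ ∈ T, ∀ x₃ ∈ T, ∀ x₄ ∈ T, x₁ < x₂ → x₂ < x₃ → x₃ < x₄ →
      f x₁ = f x₃ → f x₂ = f x₄ → f x₁ = f x₂)
    {x y : ℝ} (hx : x ∈ T) (hy : y ∈ T) (hxy : x < y)
    (h1 : ∀ z ∈ T, x < z → z ≤ y → ∃ w ∈ T, w < z ∧ f w = f z)
    (h2 : ∀ z ∈ T, x ≤ z → z < y → ∃ w ∈ T, z < w ∧ f w = f z) : f x = f y := by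
  classical
  by_contra hne
  -- the first point labelled as `y` precedes `x`, and the last one labelled as `x` follows `y`
  obtain ⟨j, hj, hjmin⟩ := (T.filter fun w => f w = f y).exists_min_image id ⟨y, by simp [hy]⟩
  obtain ⟨l, hl, hlmax⟩ := (T.filter fun w => f w = f x).exists_max_image id ⟨x, by simp [hx]⟩
  simp only [Finset.mem_filter, id, and_imp] at hj hjmin hl hlmax
  have hjx : j < x := by
    by_contra! hge
    have hjx' : x < j := lt_of_le_of_ne hge fun h => hne (by rw [← hj.2, h])
    obtain ⟨w, hw, hwz, hfw⟩ := h1 j hj.1 hjx' (hjmin y hy rfl)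
    exact absurd (hjmin w hw (hfw.trans hj.2)) (not_le.2 hwz)
  have hly : y < l := by
    by_contra! hge
    have hly' : l < y := lt_of_le_of_ne hge fun h => hne (by rw [← hl.2, h])
    obtain ⟨w, hw, hwz, hfw⟩ := h2 l hl.1 (hlmax x hx rfl) hly'
    exact absurd (hlmax w hw (hfw.trans hl.2)) (not_le.2 hwz)
  exact hne ((hf j hj.1 x hx y hy l hl.1 hjx hxy hly hj.2 hl.2.symm).symm.trans hj.2)

/-- Points on a line with two alternation-free labellings: there are at most twice as many runs of
constant label pairs as there are labels, because a label changes only after its last or before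
its first occurrence. -/
theorem card_le_of_alternation_free_real {Λ M : Type*} [DecidableEq Λ] [DecidableEq M]
    (T : Finset ℝ) (f : ℝ → Λ) (g : ℝ → M) (κ : ℕ)
    (hf : ∀ x₁ ∈ T, ∀ x₂ ∈ T, ∀ x₃ ∈ T, ∀ x₄ ∈ T, x₁ < x₂ → x₂ < x₃ → x₃ < x₄ →
      f x₁ = f x₃ → f x₂ = f x₄ → f x₁ = f x₂)
    (hg : ∀ x₁ ∈ T, ∀ x₂ ∈ T, ∀ x₃ ∈ T, ∀ x₄ ∈ T, x₁ < x₂ → x₂ < x₃ → x₃ < x₄ →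
      g x₁ = g x₃ → g x₂ = g x₄ → g x₁ = g x₂)
    (hκ : ∀ x ∈ T, (T.filter fun y => f y = f x ∧ g y = g x).card ≤ κ) :
    T.card ≤ κ * (2 * (T.image f).card + 2 * (T.image g).card) := by
  classical
  -- the first and the last occurrences of the labels of both kinds
  let Ff := T.filter fun z => ∀ w ∈ T, w < z → f w ≠ f z
  let Lf := T.filter fun z => ∀ w ∈ T, z < w → f w ≠ f z
  let Fg := T.filter fun z => ∀ w ∈ T, w < z → g w ≠ g z
  let Lg := T.filter fun z => ∀ w ∈ T, z < w → g w ≠ g z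
  have cFf : Ff.card ≤ (T.image f).card := by
    refine Finset.card_le_card_of_injOn f (fun z hz => Finset.mem_image_of_mem _
      (Finset.mem_filter.1 hz).1) fun a ha b hb hab => ?_
    rcases lt_trichotomy a b with h | h | h
    · exact absurd hab ((Finset.mem_filter.1 hb).2 a (Finset.mem_filter.1 ha).1 h)
    · exact h
    · exact absurd hab.symm ((Finset.mem_filter.1 ha).2 b (Finset.mem_filter.1 hb).1 h)
  have cLf : Lf.card ≤ (T.image f).card := by
    refine Finset.card_le_card_of_injOn f (fun z hz => Finset.mem_image_of_mem _
      (Finset.mem_filter.1 hz).1) fun a ha b hb hab => ?_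
    rcases lt_trichotomy a b with h | h | h
    · exact absurd hab.symm ((Finset.mem_filter.1 ha).2 b (Finset.mem_filter.1 hb).1 h)
    · exact h
    · exact absurd hab ((Finset.mem_filter.1 hb).2 a (Finset.mem_filter.1 ha).1 h)
  have cFg : Fg.card ≤ (T.image g).card := by
    refine Finset.card_le_card_of_injOn g (fun z hz => Finset.mem_image_of_mem _
      (Finset.mem_filter.1 hz).1) fun a ha b hb hab => ?_
    rcases lt_trichotomy a b with h | h | h
    · exact absurd hab ((Finset.mem_filter.1 hb).2 a (Finset.mem_filter.1 ha).1 h)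
    · exact h
    · exact absurd hab.symm ((Finset.mem_filter.1 ha).2 b (Finset.mem_filter.1 hb).1 h)
  have cLg : Lg.card ≤ (T.image g).card := by
    refine Finset.card_le_card_of_injOn g (fun z hz => Finset.mem_image_of_mem _
      (Finset.mem_filter.1 hz).1) fun a ha b hb hab => ?_
    rcases lt_trichotomy a b with h | h | h
    · exact absurd hab.symm ((Finset.mem_filter.1 ha).2 b (Finset.mem_filter.1 hb).1 h)
    · exact h
    · exact absurd hab ((Finset.mem_filter.1 hb).2 a (Finset.mem_filter.1 ha).1 h)
  -- `φ` counts the first and last occurrences passed so far, so labels do not change where it is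
  -- constant
  let φ : ℝ → ℕ := fun x => (Ff.filter (· ≤ x)).card + (Fg.filter (· ≤ x)).card +
    (Lf.filter (· < x)).card + (Lg.filter (· < x)).card
  have key : ∀ x ∈ T, ∀ y ∈ T, x < y → φ x = φ y → f x = f y ∧ g x = g y := by
    intro x hx y hy hxy hφ
    have le (S : Finset ℝ) : (S.filter (· ≤ x)) ⊆ (S.filter (· ≤ y)) :=
      fun z hz => by simp only [Finset.mem_filter] at hz ⊢; exact ⟨hz.1, hz.2.trans hxy.le⟩
    have lt (S : Finset ℝ) : (S.filter (· < x)) ⊆ (S.filter (· < y)) :=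
      fun z hz => by simp only [Finset.mem_filter] at hz ⊢; exact ⟨hz.1, hz.2.trans hxy⟩
    have a1 := Finset.card_le_card (le Ff)
    have a2 := Finset.card_le_card (le Fg)
    have a3 := Finset.card_le_card (lt Lf)
    have a4 := Finset.card_le_card (lt Lg)
    have e1 := Finset.eq_of_subset_of_card_le (le Ff) (by simp only [φ] at hφ; omega)
    have e2 := Finset.eq_of_subset_of_card_le (le Fg) (by simp only [φ] at hφ; omega)
    have e3 := Finset.eq_of_subset_of_card_le (lt Lf) (by simp only [φ] at hφ; omega)
    have e4 := Finset.eq_of_subset_of_card_le (lt Lg) (by simp only [φ] at hφ; omega)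
    constructor
    · refine label_eq_of_no_first_last T f hf hx hy hxy (fun z hz hxz hzy => ?_)
        fun z hz hxz hzy => ?_
      · by_contra! hno
        have : z ∈ Ff.filter (· ≤ x) := by
          rw [e1]; simp only [Finset.mem_filter, Ff]; exact ⟨⟨hz, hno⟩, hzy⟩
        exact absurd (Finset.mem_filter.1 this).2 (not_le.2 hxz)
      · by_contra! hno
        have : z ∈ Lf.filter (· < x) := by
          rw [e3]; simp only [Finset.mem_filter, Lf]; exact ⟨⟨hz, hno⟩, hzy⟩
        exact absurd (Finset.mem_filter.1 this).2 (not_lt.2 hxz)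
    · refine label_eq_of_no_first_last T g hg hx hy hxy (fun z hz hxz hzy => ?_)
        fun z hz hxz hzy => ?_
      · by_contra! hno
        have : z ∈ Fg.filter (· ≤ x) := by
          rw [e2]; simp only [Finset.mem_filter, Fg]; exact ⟨⟨hz, hno⟩, hzy⟩
        exact absurd (Finset.mem_filter.1 this).2 (not_le.2 hxz)
      · by_contra! hno
        have : z ∈ Lg.filter (· < x) := by
          rw [e4]; simp only [Finset.mem_filter, Lg]; exact ⟨⟨hz, hno⟩, hzy⟩
        exact absurd (Finset.mem_filter.1 this).2 (not_lt.2 hxz)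
  have fib : ∀ b ∈ T.image φ, (T.filter fun y => φ y = b).card ≤ κ := by
    intro b hb
    obtain ⟨x, hx, rfl⟩ := Finset.mem_image.1 hb
    refine (Finset.card_le_card fun y hy => ?_).trans (hκ x hx)
    simp only [Finset.mem_filter] at hy ⊢
    refine ⟨hy.1, ?_⟩
    rcases lt_trichotomy x y with h | h | h
    · have := key x hx y hy.1 h hy.2.symm; exact ⟨this.1.symm, this.2.symm⟩
    · subst h; exact ⟨rfl, rfl⟩
    · exact key y hy.1 x hx h hy.2
  have himg : (T.image φ).card ≤ 2 * (T.image f).card + 2 * (T.image g).card := by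
    -- the value zero is not taken, since the leftmost point is a first occurrence
    have hsub : T.image φ ⊆ Finset.Icc 1 (2 * (T.image f).card + 2 * (T.image g).card) := by
      intro b hb
      obtain ⟨x, hx, rfl⟩ := Finset.mem_image.1 hb
      have b1 := Finset.card_le_card (Finset.filter_subset (· ≤ x) Ff)
      have b2 := Finset.card_le_card (Finset.filter_subset (· ≤ x) Fg)
      have b3 := Finset.card_le_card (Finset.filter_subset (· < x) Lf)
      have b4 := Finset.card_le_card (Finset.filter_subset (· < x) Lg)
      obtain ⟨y, hy, hmin⟩ := T.exists_min_image id ⟨x, hx⟩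
      have : 0 < (Ff.filter (· ≤ x)).card := Finset.card_pos.2 ⟨y, by
        simp only [Finset.mem_filter, Ff]
        exact ⟨⟨hy, fun w hw hwy => absurd (hmin w hw) (not_le.2 hwy)⟩, hmin x hx⟩⟩
      simp only [Finset.mem_Icc, φ]
      omega
    simpa using Finset.card_le_card hsub
  calc T.card ≤ κ * (T.image φ).card :=
        Finset.card_le_mul_card_image T κ fib
    _ ≤ _ := Nat.mul_le_mul_left _ himg

/-- The version of `card_le_of_alternation_free_real` for points ordered by an injective real
key. -/
theorem card_le_of_alternation_free {Ω Λ M : Type*} [DecidableEq Λ] [DecidableEq M]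
    (T : Finset Ω) (key : Ω → ℝ) (hkey : Set.InjOn key T) (f : Ω → Λ) (g : Ω → M) (κ : ℕ)
    (hf : ∀ x₁ ∈ T, ∀ x₂ ∈ T, ∀ x₃ ∈ T, ∀ x₄ ∈ T, key x₁ < key x₂ → key x₂ < key x₃ →
      key x₃ < key x₄ → f x₁ = f x₃ → f x₂ = f x₄ → f x₁ = f x₂)
    (hg : ∀ x₁ ∈ T, ∀ x₂ ∈ T, ∀ x₃ ∈ T, ∀ x₄ ∈ T, key x₁ < key x₂ → key x₂ < key x₃ →
      key x₃ < key x₄ → g x₁ = g x₃ → g x₂ = g x₄ → g x₁ = g x₂)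
    (hκ : ∀ U ⊆ T, (∀ x ∈ U, ∀ y ∈ U, f x = f y ∧ g x = g y) → U.card ≤ κ) :
    T.card ≤ κ * (2 * (T.image f).card + 2 * (T.image g).card) := by
  classical
  rcases T.eq_empty_or_nonempty with rfl | ⟨o, ho⟩
  · simp
  have : Nonempty Ω := ⟨o⟩
  let inv := Function.invFunOn key (T : Set Ω)
  have hinv : ∀ x ∈ T, inv (key x) = x := fun x hx => hkey.leftInvOn_invFunOn hx
  have e1 : (T.image key).image (f ∘ inv) = T.image f := by
    rw [Finset.image_image]
    exact Finset.image_congr fun x hx => by simp [hinv x hx]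
  have e2 : (T.image key).image (g ∘ inv) = T.image g := by
    rw [Finset.image_image]
    exact Finset.image_congr fun x hx => by simp [hinv x hx]
  have := card_le_of_alternation_free_real (T.image key) (f ∘ inv) (g ∘ inv) κ ?_ ?_ ?_
  · rwa [e1, e2, Finset.card_image_of_injOn hkey] at this
  · simp only [Finset.forall_mem_image, Function.comp]
    intro x₁ h₁ x₂ h₂ x₃ h₃ x₄ h₄
    rw [hinv _ h₁, hinv _ h₂, hinv _ h₃, hinv _ h₄]
    exact hf x₁ h₁ x₂ h₂ x₃ h₃ x₄ h₄
  · simp only [Finset.forall_mem_image, Function.comp]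
    intro x₁ h₁ x₂ h₂ x₃ h₃ x₄ h₄
    rw [hinv _ h₁, hinv _ h₂, hinv _ h₃, hinv _ h₄]
    exact hg x₁ h₁ x₂ h₂ x₃ h₃ x₄ h₄
  · simp only [Finset.forall_mem_image, Function.comp]
    intro x hx
    rw [hinv x hx]
    refine le_trans ?_ (hκ (T.filter fun y => f y = f x ∧ g y = g x) (Finset.filter_subset _ _) ?_)
    · refine (Finset.card_le_card fun z hz => ?_).trans (Finset.card_image_le (f := key))
      obtain ⟨hz1, hz2⟩ := Finset.mem_filter.1 hz
      obtain ⟨y, hy, rfl⟩ := Finset.mem_image.1 hz1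
      rw [hinv y hy] at hz2
      exact Finset.mem_image_of_mem _ (Finset.mem_filter.2 ⟨hy, hz2⟩)
    · intro a ha b hb
      have ha := (Finset.mem_filter.1 ha).2
      have hb := (Finset.mem_filter.1 hb).2
      exact ⟨ha.1.trans hb.1.symm, ha.2.trans hb.2.symm⟩

/-- A line meets a circle in at most two points. -/
lemma card_le_two_of_line_of_circle (U : Finset Plane) (v w : Plane) (r c : ℝ) (hw : w ≠ 0)
    (hr : ∀ x ∈ U, dist x v = r) (hl : ∀ x ∈ U, dot w x = c) : U.card ≤ 2 := by
  by_contra! h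
  obtain ⟨a, b, d, ha, hb, hd, hab, had, hbd⟩ := Finset.two_lt_card_iff.1 h
  have hr0 : 0 ≤ r := (hr a ha) ▸ dist_nonneg
  have A := (dist_eq_iff hr0).1 (hr a ha)
  have B := (dist_eq_iff hr0).1 (hr b hb)
  have D := (dist_eq_iff hr0).1 (hr d hd)
  have LA := hl a ha
  have LB := hl b hb
  have LD := hl d hd
  unfold dot at LA LB LD
  have hw2 : 0 < w 0 ^ 2 + w 1 ^ 2 := by
    by_contra! hle
    apply hw
    have h0 : w 0 = 0 := by nlinarith [sq_nonneg (w 0), sq_nonneg (w 1)]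
    have h1 : w 1 = 0 := by nlinarith [sq_nonneg (w 0), sq_nonneg (w 1)]
    exact plane_ext h0 h1
  -- Position along the line.
  have par : ∀ x y : Plane, w 0 * x 0 + w 1 * x 1 = w 0 * y 0 + w 1 * y 1 →
      -w 1 * x 0 + w 0 * x 1 = -w 1 * y 0 + w 0 * y 1 → x = y := by
    intro x y h1 h2
    refine plane_ext ?_ ?_
    · have : (w 0 ^ 2 + w 1 ^ 2) * (x 0 - y 0) = 0 := by linear_combination w 0 * h1 - w 1 * h2
      have := (mul_eq_zero.1 this).resolve_left hw2.ne'
      linarith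
    · have : (w 0 ^ 2 + w 1 ^ 2) * (x 1 - y 1) = 0 := by linear_combination w 1 * h1 + w 0 * h2
      have := (mul_eq_zero.1 this).resolve_left hw2.ne'
      linarith
  have quad : ∀ x y : Plane, w 0 * x 0 + w 1 * x 1 = c → w 0 * y 0 + w 1 * y 1 = c →
      (x 0 - v 0) ^ 2 + (x 1 - v 1) ^ 2 = r ^ 2 → (y 0 - v 0) ^ 2 + (y 1 - v 1) ^ 2 = r ^ 2 →
      x ≠ y → (-w 1 * x 0 + w 0 * x 1) + (-w 1 * y 0 + w 0 * y 1) =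
        2 * (-w 1 * v 0 + w 0 * v 1) := by
    intro x y h1 h2 h3 h4 hne
    have hs : (-w 1 * x 0 + w 0 * x 1) - (-w 1 * y 0 + w 0 * y 1) ≠ 0 := fun h0 =>
      hne (par x y (h1.trans h2.symm) (by linarith))
    have e : ((-w 1 * x 0 + w 0 * x 1) - (-w 1 * y 0 + w 0 * y 1)) *
        ((-w 1 * x 0 + w 0 * x 1) + (-w 1 * y 0 + w 0 * y 1) -
          2 * (-w 1 * v 0 + w 0 * v 1)) = 0 := by
      linear_combination (w 0 ^ 2 + w 1 ^ 2) * (h3 - h4) -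
        (w 0 * x 0 + w 1 * x 1 + c - 2 * (w 0 * v 0 + w 1 * v 1)) * h1 +
        (w 0 * y 0 + w 1 * y 1 + c - 2 * (w 0 * v 0 + w 1 * v 1)) * h2
    have := (mul_eq_zero.1 e).resolve_left hs
    linarith
  have q1 := quad a b LA LB A B hab
  have q2 := quad a d LA LD A D had
  exact hbd (par b d (LB.trans LD.symm) (by linarith))

/-- Two distinct circles meet in at most two points. -/
lemma card_le_two_of_two_circles (U : Finset Plane) (v w : Plane) (r s : ℝ)
    (hne : v ≠ w ∨ r ≠ s)
    (hr : ∀ x ∈ U, dist x v = r) (hs : ∀ x ∈ U, dist x w = s) : U.card ≤ 2 := by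
  rcases U.eq_empty_or_nonempty with rfl | ⟨o, ho⟩
  · simp
  have hvw : v ≠ w := by
    rintro rfl
    exact hne.elim (fun h => h rfl) fun h => h ((hr o ho).symm.trans (hs o ho))
  refine card_le_two_of_line_of_circle U v (w - v) r
    ((r ^ 2 - s ^ 2 + (w 0 ^ 2 + w 1 ^ 2) - (v 0 ^ 2 + v 1 ^ 2)) / 2) (sub_ne_zero.2 hvw.symm) hr
    fun x hx => ?_
  have A := (dist_eq_iff ((hr x hx) ▸ dist_nonneg)).1 (hr x hx)
  have B := (dist_eq_iff ((hs x hx) ▸ dist_nonneg)).1 (hs x hx)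
  simp only [dot, PiLp.sub_apply]
  linear_combination (A - B) / 2

/-- A set all of whose finite subsets have at most `N` elements is finite with at most `N`
elements. -/
lemma exists_finset_of_card_le {α : Type*} (S : Set α) (N : ℕ)
    (h : ∀ T : Finset α, ↑T ⊆ S → T.card ≤ N) : ∃ T : Finset α, ↑T = S ∧ T.card ≤ N := by
  have hfin : S.Finite := by
    by_contra hinf
    obtain ⟨T, hT, hc⟩ := Set.Infinite.exists_subset_card_eq hinf (N + 1)
    have := h T hT
    omega
  exact ⟨hfin.toFinset, by simp, h _ (by simp)⟩

/-! ### Curves and the decomposition of a closed set into pieces of curves -/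

/-- The curves from which outlines are made: oriented line segments, and circles traversed
counterclockwise. -/
inductive Curve
  | seg (a b : Plane)
  | circ (c : Plane) (r : ℝ)

namespace Curve

instance : Inhabited Curve := ⟨seg 0 0⟩

/-- The parametrization of a curve by the unit interval. A circle starts and ends at its
easternmost point. -/
noncomputable def path : Curve → ℝ → Plane
  | seg a b, t => AffineMap.lineMap a b t
  | circ c r, t => circlePoint c r (2 * Real.pi * t)

/-- The curve as a set. -/
def carrier : Curve → Set Plane
  | seg a b => segment ℝ a b
  | circ c r => sphere c r

/-- Segments and circles are required not to shrink to a point. -/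
def Valid : Curve → Prop
  | seg a b => a ≠ b
  | circ _ r => 0 < r

lemma continuous_circlePoint (c : Plane) (r : ℝ) : Continuous (circlePoint c r) := by
  unfold circlePoint
  refine continuous_const.add (Continuous.const_smul ?_ r)
  refine (PiLp.continuous_toLp 2 _).comp (continuous_pi fun i => ?_)
  fin_cases i <;> simp <;> fun_prop

lemma continuous_path (c : Curve) : Continuous c.path := by
  cases c with
  | seg a b => exact AffineMap.lineMap_continuous
  | circ c r => exact (continuous_circlePoint c r).comp (by fun_prop)

lemma circlePoint_zero (c : Plane) (r t : ℝ) : circlePoint c r t 0 = c 0 + r * Real.cos t := by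
  simp [circlePoint]

lemma circlePoint_one (c : Plane) (r t : ℝ) : circlePoint c r t 1 = c 1 + r * Real.sin t := by
  simp [circlePoint]

lemma path_injOn {c : Curve} (hc : c.Valid) : InjOn c.path (Ico 0 1) := by
  cases c with
  | seg a b => exact (AffineMap.lineMap_injective ℝ hc).injOn
  | circ c r =>
    intro s hs t ht h
    have hr : (0 : ℝ) < r := hc
    have h0 := congrArg (fun x : Plane => x 0) h
    have h1 := congrArg (fun x : Plane => x 1) h
    simp only [path, circlePoint_zero, circlePoint_one] at h0 h1
    have hcos : Real.cos (2 * Real.pi * s) = Real.cos (2 * Real.pi * t) :=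
      mul_left_cancel₀ hr.ne' (by linarith)
    have hsin : Real.sin (2 * Real.pi * s) = Real.sin (2 * Real.pi * t) :=
      mul_left_cancel₀ hr.ne' (by linarith)
    have h1 : Real.cos (2 * Real.pi * (s - t)) = 1 := by
      rw [mul_sub, Real.cos_sub, hcos, hsin]
      nlinarith [Real.cos_sq_add_sin_sq (2 * Real.pi * t)]
    have hpi := Real.pi_pos
    obtain ⟨hs0, hs1⟩ := hs
    obtain ⟨ht0, ht1⟩ := ht
    have := (Real.cos_eq_one_iff_of_lt_of_lt (x := 2 * Real.pi * (s - t))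
      (by nlinarith) (by nlinarith)).1 h1
    have : s - t = 0 := by
      rcases mul_eq_zero.1 this with h | h
      · linarith
      · exact h
    linarith

lemma carrier_eq_image {c : Curve} (hc : c.Valid) : c.carrier = c.path '' Icc 0 1 := by
  cases c with
  | seg a b => exact segment_eq_image_lineMap ℝ a b
  | circ c r =>
    have hr : (0 : ℝ) < r := hc
    ext x
    simp only [carrier, mem_sphere, path]
    constructor
    · intro h
      rw [dist_eq_iff hr.le] at h
      have hu : ((x 0 - c 0) / r) ^ 2 + ((x 1 - c 1) / r) ^ 2 = 1 := by
        field_simp; linarith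
      let z : ℂ := ⟨(x 0 - c 0) / r, (x 1 - c 1) / r⟩
      have hz : ‖z‖ = 1 := by
        rw [← sq_eq_sq₀ (norm_nonneg _) zero_le_one, ← Complex.normSq_eq_norm_sq,
          Complex.normSq_apply]
        simp only [z]; nlinarith
      have hz0 : z ≠ 0 := by rw [← norm_ne_zero_iff, hz]; norm_num
      have hcos := Complex.cos_arg hz0
      have hsin := Complex.sin_arg z
      rw [hz, div_one] at hcos hsin
      have hpi := Real.pi_pos
      have main : ∀ θ : ℝ, 0 ≤ θ → θ ≤ 2 * Real.pi → Real.cos θ = z.re → Real.sin θ = z.im →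
          ∃ t ∈ Icc (0 : ℝ) 1, circlePoint c r (2 * Real.pi * t) = x := by
        intro θ h0 h1 hc hs
        refine ⟨θ / (2 * Real.pi), ⟨by positivity, by rw [div_le_one (by positivity)]; exact h1⟩,
          ?_⟩
        rw [mul_div_cancel₀ _ (by positivity)]
        refine plane_ext ?_ ?_
        · rw [circlePoint_zero, hc]; simp only [z]; field_simp; ring
        · rw [circlePoint_one, hs]; simp only [z]; field_simp; ring
      by_cases hneg : 0 ≤ z.arg
      · exact main z.arg hneg (by linarith [Complex.arg_le_pi z]) hcos hsin
      · refine main (z.arg + 2 * Real.pi) ?_ ?_ ?_ ?_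
        · linarith [Complex.neg_pi_lt_arg z]
        · linarith
        · rw [Real.cos_add_two_pi, hcos]
        · rw [Real.sin_add_two_pi, hsin]
    · rintro ⟨t, -, rfl⟩
      rw [dist_eq_iff hr.le]
      simp only [path, circlePoint_zero, circlePoint_one]
      nlinarith [Real.cos_sq_add_sin_sq (2 * Real.pi * t)]

lemma path_mem_carrier {c : Curve} (hc : c.Valid) {t : ℝ} (ht : t ∈ Icc (0 : ℝ) 1) :
    c.path t ∈ c.carrier := by
  rw [carrier_eq_image hc]; exact mem_image_of_mem _ ht

/-- `c` passes through `z`, and just after `z` it runs inside `Y`. -/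
def Germ (c : Curve) (Y : Set Plane) (z : Plane) : Prop :=
  ∃ s ∈ Ico (0 : ℝ) 1, c.path s = z ∧ ∃ ε > 0, ∀ t ∈ Ioo s (s + ε), c.path t ∈ Y

lemma Germ.mono {c : Curve} {Y Y' : Set Plane} {z : Plane} (h : c.Germ Y z) (hY : Y ⊆ Y') :
    c.Germ Y' z := by
  obtain ⟨s, hs, hz, ε, hε, h⟩ := h
  exact ⟨s, hs, hz, ε, hε, fun t ht => hY (h t ht)⟩

lemma isSegmentPiece {a b : Plane} (hab : a ≠ b) {V : Finset Plane} {s t : ℝ} (hst : s < t)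
    (hs : (seg a b).path s ∈ V) (ht : (seg a b).path t ∈ V) :
    IsSegmentPiece V ((seg a b).path '' Ioo s t) := by
  refine ⟨_, hs, _, ht, fun h => hst.ne (AffineMap.lineMap_injective ℝ hab h), ?_⟩
  rw [openSegment_eq_image_lineMap]
  have himg : Ioo s t = AffineMap.lineMap s t '' Ioo (0 : ℝ) 1 := by
    rw [← openSegment_eq_image_lineMap, openSegment_eq_Ioo hst]
  rw [himg, image_image]
  refine image_congr fun u _ => ?_
  simp only [path, AffineMap.lineMap_apply_module]
  module

lemma isArcPiece {c : Plane} {r : ℝ} (hr : 0 < r) {V : Finset Plane} {s t : ℝ} (hs0 : 0 ≤ s)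
    (hst : s < t) (ht1 : t ≤ 1) (hs : (circ c r).path s ∈ V) (ht : (circ c r).path t ∈ V) :
    IsArcPiece V ((circ c r).path '' Ioo s t) := by
  have hpi := Real.pi_pos
  refine ⟨c, r, 2 * Real.pi * s, 2 * Real.pi * t, hr, by nlinarith, by nlinarith, hs, ht, ?_⟩
  have : Ioo (2 * Real.pi * s) (2 * Real.pi * t) = (fun u => 2 * Real.pi * u) '' Ioo s t := by
    rw [image_mul_left_Ioo (by positivity)]
  rw [this, image_image]
  rfl

end Curve

open Curve

/-- A closed set `X` which, outside a finite set `Z`, is the disjoint union of relatively open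
subsets `Y i` of curves, consists of vertices, segments and arcs. Every piece is determined by its
starting point in `Z` and its curve, so a bound on the number of curves leaving a point along
their sets `Y i` bounds the number of pieces. -/
theorem exists_consistsOf {ι : Type*} (I : Finset ι) (c : ι → Curve) (Y : ι → Set Plane)
    (X : Set Plane) (Z : Finset Plane) (k : ℕ) (hX : IsClosed X) (hval : ∀ i ∈ I, (c i).Valid)
    (hZX : ↑Z ⊆ X) (hcov : ∀ x ∈ X, x ∉ Z → ∃ i ∈ I, x ∈ Y i)
    (hYX : ∀ i ∈ I, Y i ⊆ X) (hYZ : ∀ i ∈ I, ∀ x ∈ Y i, x ∉ Z)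
    (hYc : ∀ i ∈ I, Y i ⊆ (c i).carrier)
    (hdisj : ∀ i ∈ I, ∀ j ∈ I, ∀ x, x ∈ Y i → x ∈ Y j → i = j)
    (hopenC : ∀ i ∈ I, ∀ x ∈ Y i, ∀ᶠ y in 𝓝 x, y ∈ (c i).carrier → y ∈ Y i)
    (hopenX : ∀ i ∈ I, ∀ x ∈ Y i, ∀ᶠ y in 𝓝 x, y ∈ X → y ∈ Y i)
    (hend : ∀ i ∈ I, (c i).path 0 ∉ Y i ∧ (c i).path 1 ∉ Y i)
    (hgerm : ∀ z ∈ Z, ∀ J ⊆ I, (∀ i ∈ J, (c i).Germ (Y i) z) → J.card ≤ k) :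
    ∃ (V : Finset Plane) (L R : Finset (Set Plane)), ConsistsOf X V L R ∧
      V.card + L.card + R.card ≤ (1 + 2 * k) * Z.card := by
  classical
  -- the pieces: maximal stretches of the curves that avoid `Z`
  let IsPiece : ι → ℝ → ℝ → Prop := fun i s t => 0 ≤ s ∧ s < t ∧ t ≤ 1 ∧ (c i).path s ∈ Z ∧
    (c i).path t ∈ Z ∧ ∀ τ ∈ Ioo s t, (c i).path τ ∈ Y i
  have hcont : ∀ i, Continuous (c i).path := fun i => continuous_path _
  have hIco : ∀ i ∈ I, ∀ τ ∈ Icc (0 : ℝ) 1, (c i).path τ ∈ Y i → τ ∈ Ioo (0 : ℝ) 1 := by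
    intro i hi τ hτ hy
    refine ⟨lt_of_le_of_ne hτ.1 ?_, lt_of_le_of_ne hτ.2 ?_⟩
    · rintro rfl; exact (hend i hi).1 hy
    · rintro rfl; exact (hend i hi).2 hy
  have exPiece : ∀ i ∈ I, ∀ τ ∈ Ioo (0 : ℝ) 1, (c i).path τ ∈ Y i →
      ∃ s t, IsPiece i s t ∧ τ ∈ Ioo s t := by
    intro i hi τ hτ hy
    let U : Set ℝ := {u | u ∈ Ioo (0 : ℝ) 1 ∧ (c i).path u ∈ Y i}
    have hU : IsOpen U := by
      rw [isOpen_iff_mem_nhds]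
      rintro u ⟨hu, huy⟩
      filter_upwards [Ioo_mem_nhds hu.1 hu.2,
        (hcont i).continuousAt.eventually (hopenC i hi _ huy)] with w hw hw2
      exact ⟨hw, hw2 (path_mem_carrier (hval i hi) ⟨hw.1.le, hw.2.le⟩)⟩
    have h0U : (0 : ℝ) ∉ U := fun h => lt_irrefl _ h.1.1
    have h1U : (1 : ℝ) ∉ U := fun h => lt_irrefl _ h.1.2
    obtain ⟨s, ⟨hs1, hs2⟩, hsmax⟩ := ((isCompact_Icc (a := (0 : ℝ)) (b := τ)).inter_right
      hU.isClosed_compl).exists_isGreatest ⟨0, ⟨⟨le_rfl, hτ.1.le⟩, h0U⟩⟩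
    obtain ⟨t, ⟨ht1, ht2⟩, htmin⟩ := ((isCompact_Icc (a := τ) (b := (1 : ℝ))).inter_right
      hU.isClosed_compl).exists_isLeast ⟨1, ⟨⟨hτ.2.le, le_rfl⟩, h1U⟩⟩
    have hτU : τ ∈ U := ⟨hτ, hy⟩
    have hsτ : s < τ := lt_of_le_of_ne hs1.2 fun h => hs2 (h ▸ hτU)
    have hτt : τ < t := lt_of_le_of_ne ht1.1 fun h => ht2 (h ▸ hτU)
    have hin : ∀ u ∈ Ioo s t, (c i).path u ∈ Y i := by
      intro u hu
      by_contra hno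
      have huU : u ∉ U := fun h => hno h.2
      rcases le_total u τ with h | h
      · exact absurd (hsmax ⟨⟨hs1.1.trans hu.1.le, h⟩, huU⟩) (not_le.2 hu.1)
      · exact absurd (htmin ⟨⟨h, hu.2.le.trans ht1.2⟩, huU⟩) (not_le.2 hu.2)
    -- an endpoint outside `Z` would lie in some `Y j`, which must be `Y i` itself
    have hendZ : ∀ u ∈ Icc (0 : ℝ) 1, u ∉ U → u ∈ closure (Ioo s t) → (c i).path u ∈ Z := by
      intro u hu huU hcl
      by_contra hZ
      have hmem : (c i).path u ∈ closure (Y i) :=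
        closure_mono (image_subset_iff.2 hin) (image_closure_subset_closure_image (hcont i)
          (mem_image_of_mem _ hcl))
      have huX : (c i).path u ∈ X := hX.closure_subset_iff.2 (hYX i hi) hmem
      obtain ⟨j, hj, hjY⟩ := hcov _ huX hZ
      obtain ⟨w, hw1, hw2⟩ := ((hopenX j hj _ hjY).and_frequently
        (mem_closure_iff_frequently.1 hmem)).exists
      have hij : i = j := hdisj i hi j hj w hw2 (hw1 (hYX i hi hw2))
      subst hij
      exact huU ⟨hIco i hi u hu hjY, hjY⟩
    have hst : s < t := hsτ.trans hτt
    refine ⟨s, t, ⟨hs1.1, hst, ht1.2, ?_, ?_, hin⟩, hsτ, hτt⟩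
    · exact hendZ s ⟨hs1.1, hst.le.trans ht1.2⟩ hs2 (by
        rw [closure_Ioo hst.ne]; exact left_mem_Icc.2 hst.le)
    · exact hendZ t ⟨hs1.1.trans hst.le, ht1.2⟩ ht2 (by
        rw [closure_Ioo hst.ne]; exact right_mem_Icc.2 hst.le)
  -- overlapping pieces of one curve coincide, since their endpoints lie in `Z`
  have uniqPiece : ∀ i ∈ I, ∀ s t s' t' τ, IsPiece i s t → IsPiece i s' t' → τ ∈ Ioo s t →
      τ ∈ Ioo s' t' → s = s' ∧ t = t' := by
    intro i hi s t s' t' τ h h' hτ hτ'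
    obtain ⟨h1, h2, h3, h4, h5, h6⟩ := h
    obtain ⟨h1', h2', h3', h4', h5', h6'⟩ := h'
    constructor
    · rcases lt_trichotomy s s' with hlt | heq | hlt
      · exact absurd h4' (hYZ i hi _ (h6 s' ⟨hlt, hτ'.1.trans hτ.2⟩))
      · exact heq
      · exact absurd h4 (hYZ i hi _ (h6' s ⟨hlt, hτ.1.trans hτ'.2⟩))
    · rcases lt_trichotomy t t' with hlt | heq | hlt
      · exact absurd h5 (hYZ i hi _ (h6' t ⟨hτ'.1.trans hτ.2, hlt⟩))
      · exact heq
      · exact absurd h5' (hYZ i hi _ (h6 t' ⟨hτ.1.trans hτ'.2, hlt⟩))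
  -- the piece of a given curve that starts in a given point of `Z`
  let F : ι × Plane → Set Plane := fun q =>
    {x | ∃ s t, IsPiece q.1 s t ∧ (c q.1).path s = q.2 ∧ x ∈ (c q.1).path '' Ioo s t}
  have hF : ∀ i ∈ I, ∀ s t, IsPiece i s t →
      F (i, (c i).path s) = (c i).path '' Ioo s t := by
    intro i hi s t h
    ext x
    constructor
    · rintro ⟨s', t', h', hs', hx⟩
      have hss : s' = s := path_injOn (hval i hi) ⟨h'.1, h'.2.1.trans_le h'.2.2.1⟩
        ⟨h.1, h.2.1.trans_le h.2.2.1⟩ hs'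
      subst hss
      obtain ⟨τ, hτ1, hτ2⟩ := exists_between (lt_min h.2.1 h'.2.1)
      have := (uniqPiece i hi _ _ _ _ τ h h' ⟨hτ1, hτ2.trans_le (min_le_left _ _)⟩
        ⟨hτ1, hτ2.trans_le (min_le_right _ _)⟩).2
      rw [this]; exact hx
    · intro hx
      exact ⟨s, t, h, rfl, hx⟩
  -- every piece arises from a germ, and the germs are counted by `hgerm`
  let G : Finset (ι × Plane) := (I ×ˢ Z).filter fun q => (c q.1).Germ (Y q.1) q.2
  have hGcard : G.card ≤ k * Z.card := by
    refine Finset.card_le_mul_card_image_of_maps_to (f := Prod.snd) (fun q hq => ?_) k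
      fun z hz => ?_
    · exact (Finset.mem_product.1 (Finset.mem_filter.1 hq).1).2
    · rw [← Finset.card_image_of_injOn (f := Prod.fst)]
      · refine hgerm z hz _ (fun i hi => ?_) fun i hi => ?_
        · obtain ⟨q, hq, rfl⟩ := Finset.mem_image.1 hi
          simp only [G, Finset.mem_filter, Finset.mem_product] at hq
          exact hq.1.1.1
        · obtain ⟨q, hq, rfl⟩ := Finset.mem_image.1 hi
          simp only [G, Finset.mem_filter, Finset.mem_product] at hq
          rw [← hq.2]; exact hq.1.2
      · intro q hq q' hq' h
        have h1 := (Finset.mem_filter.1 hq).2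
        have h2 := (Finset.mem_filter.1 hq').2
        exact Prod.ext h (h1.trans h2.symm)
  have hGmem : ∀ i ∈ I, ∀ s t, IsPiece i s t → (i, (c i).path s) ∈ G := by
    intro i hi s t h
    refine Finset.mem_filter.2 ⟨Finset.mem_product.2 ⟨hi, h.2.2.2.1⟩, s,
      ⟨h.1, h.2.1.trans_le h.2.2.1⟩, rfl, t - s, sub_pos.2 h.2.1, fun τ hτ => ?_⟩
    exact h.2.2.2.2.2 τ (by simpa using hτ)
  let L : Finset (Set Plane) := (G.image F).filter fun e =>
    ∃ i ∈ I, ∃ s t, IsPiece i s t ∧ e = (c i).path '' Ioo s t ∧ ∃ a b, c i = seg a b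
  let R : Finset (Set Plane) := (G.image F).filter fun e =>
    ∃ i ∈ I, ∃ s t, IsPiece i s t ∧ e = (c i).path '' Ioo s t ∧ ∃ a r, c i = circ a r
  have hLR : ∀ e ∈ (L : Set (Set Plane)) ∪ (R : Set (Set Plane)),
      ∃ i ∈ I, ∃ s t, IsPiece i s t ∧ e = (c i).path '' Ioo s t := by
    rintro e (he | he)
    · obtain ⟨-, i, hi, s, t, h, he, -⟩ := Finset.mem_filter.1 he
      exact ⟨i, hi, s, t, h, he⟩
    · obtain ⟨-, i, hi, s, t, h, he, -⟩ := Finset.mem_filter.1 he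
      exact ⟨i, hi, s, t, h, he⟩
  have hmemLR : ∀ i ∈ I, ∀ s t, IsPiece i s t →
      (c i).path '' Ioo s t ∈ (L : Set (Set Plane)) ∪ (R : Set (Set Plane)) := by
    intro i hi s t h
    have h1 : (c i).path '' Ioo s t ∈ G.image F :=
      Finset.mem_image.2 ⟨_, hGmem i hi s t h, hF i hi s t h⟩
    cases hc : c i with
    | seg a b => exact Or.inl (Finset.mem_filter.2 ⟨hc ▸ h1, i, hi, s, t, h, by rw [hc], a, b, hc⟩)
    | circ a r =>
      exact Or.inr (Finset.mem_filter.2 ⟨hc ▸ h1, i, hi, s, t, h, by rw [hc], a, r, hc⟩)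
  have hsub : ∀ i ∈ I, ∀ s t, IsPiece i s t → (c i).path '' Ioo s t ⊆ Y i :=
    fun i hi s t h => image_subset_iff.2 h.2.2.2.2.2
  refine ⟨Z, L, R, ⟨?_, ?_, ?_, ?_, ?_⟩, ?_⟩
  · intro e he
    obtain ⟨-, i, hi, s, t, h, rfl, a, b, hc⟩ := Finset.mem_filter.1 he
    have hv := hval i hi
    obtain ⟨h1, h2, h3, h4, h5, h6⟩ := h
    rw [hc] at hv h4 h5 ⊢
    exact isSegmentPiece hv h2 h4 h5
  · intro e he
    obtain ⟨-, i, hi, s, t, h, rfl, a, b, hc⟩ := Finset.mem_filter.1 he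
    have hv := hval i hi
    obtain ⟨h1, h2, h3, h4, h5, h6⟩ := h
    rw [hc] at hv h4 h5 ⊢
    exact isArcPiece hv h1 h2 h3 h4 h5
  · intro e he e' he' hne
    obtain ⟨i, hi, s, t, h, rfl⟩ := hLR e he
    obtain ⟨j, hj, s', t', h', rfl⟩ := hLR e' he'
    rw [Function.onFun, disjoint_left]
    intro x hx hx'
    have hij : i = j := hdisj i hi j hj x (hsub i hi s t h hx) (hsub j hj s' t' h' hx')
    subst hij
    obtain ⟨τ, hτ, rfl⟩ := hx
    obtain ⟨τ', hτ', he⟩ := hx'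
    have : τ' = τ := path_injOn (hval i hi)
      ⟨h'.1.trans hτ'.1.le, hτ'.2.trans_le h'.2.2.1⟩ ⟨h.1.trans hτ.1.le, hτ.2.trans_le h.2.2.1⟩ he
    subst this
    obtain ⟨rfl, rfl⟩ := uniqPiece i hi s t s' t' _ h h' hτ hτ'
    exact hne rfl
  · intro e he
    obtain ⟨i, hi, s, t, h, rfl⟩ := hLR e he
    rw [disjoint_left]
    intro x hx hxZ
    exact hYZ i hi x (hsub i hi s t h hx) hxZ
  · ext x
    rw [union_assoc, ← sUnion_union]
    constructor
    · intro hx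
      by_cases hxZ : x ∈ Z
      · exact Or.inl hxZ
      · obtain ⟨i, hi, hxY⟩ := hcov x hx hxZ
        have hxc := hYc i hi hxY
        rw [carrier_eq_image (hval i hi)] at hxc
        obtain ⟨τ, hτ, rfl⟩ := hxc
        obtain ⟨s, t, h, hτ⟩ := exPiece i hi τ (hIco i hi τ hτ hxY) hxY
        exact Or.inr (mem_sUnion.2 ⟨_, hmemLR i hi s t h, mem_image_of_mem _ hτ⟩)
    · rintro (hx | hx)
      · exact hZX hx
      · obtain ⟨e, he, hxe⟩ := mem_sUnion.1 hx
        obtain ⟨i, hi, s, t, h, rfl⟩ := hLR e he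
        exact hYX i hi (hsub i hi s t h hxe)
  · have hL : L.card ≤ k * Z.card :=
      (Finset.card_filter_le _ _).trans (Finset.card_image_le.trans hGcard)
    have hR : R.card ≤ k * Z.card :=
      (Finset.card_filter_le _ _).trans (Finset.card_image_le.trans hGcard)
    nlinarith

/-! ### Crossing chords -/

lemma mem_segment_iff {a b z : Plane} :
    z ∈ segment ℝ a b ↔ ∃ t ∈ Icc (0 : ℝ) 1, a + t • (b - a) = z := by
  rw [segment_eq_image']; rfl

lemma mem_openSegment_iff {a b z : Plane} :
    z ∈ openSegment ℝ a b ↔ ∃ t ∈ Ioo (0 : ℝ) 1, a + t • (b - a) = z := by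
  rw [openSegment_eq_image']; rfl

/-- A point is determined by its coordinates in the frame `(rot δ, δ)`. -/
lemma eq_of_frame {δ x y : Plane} (hδ : δ ≠ 0) (h1 : dot (rot δ) x = dot (rot δ) y)
    (h2 : dot δ x = dot δ y) : x = y := by
  have hw2 : 0 < δ 0 ^ 2 + δ 1 ^ 2 := by
    rw [← norm_sq_eq]; positivity
  simp only [dot, rot_zero, rot_one] at h1 h2
  refine plane_ext ?_ ?_
  · have : (δ 0 ^ 2 + δ 1 ^ 2) * (x 0 - y 0) = 0 := by linear_combination δ 0 * h2 - δ 1 * h1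
    have := (mul_eq_zero.1 this).resolve_left hw2.ne'
    linarith
  · have : (δ 0 ^ 2 + δ 1 ^ 2) * (x 1 - y 1) = 0 := by linear_combination δ 1 * h2 + δ 0 * h1
    have := (mul_eq_zero.1 this).resolve_left hw2.ne'
    linarith

lemma exists_mem_segment_of_dot {w x y : Plane} {s : ℝ} (h1 : dot w x ≤ s) (h2 : s ≤ dot w y)
    (h : dot w x < dot w y) :
    ∃ z ∈ segment ℝ x y, dot w z = s := by
  refine ⟨x + ((s - dot w x) / (dot w y - dot w x)) • (y - x), ?_, ?_⟩
  · rw [mem_segment_iff]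
    refine ⟨_, ⟨div_nonneg (by linarith) (by linarith), ?_⟩, rfl⟩
    rw [div_le_one (by linarith)]; linarith
  · rw [dot_add, dot_smul, dot_sub, div_mul_cancel₀ _ (by linarith)]; ring

/-- Take four points ordered along `rot δ`. If the second point is on or above the chord of the
first and third, and the third is on or above the chord of the second and fourth (with `δ`
upwards), then these chords cross. -/
lemma segments_cross {δ x₁ x₂ x₃ x₄ : Plane} (hδ : δ ≠ 0)
    (h12 : dot (rot δ) x₁ ≤ dot (rot δ) x₂) (h23 : dot (rot δ) x₂ ≤ dot (rot δ) x₃)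
    (h34 : dot (rot δ) x₃ ≤ dot (rot δ) x₄) (h13 : dot (rot δ) x₁ < dot (rot δ) x₃)
    (h24 : dot (rot δ) x₂ < dot (rot δ) x₄)
    (ha : ∀ z ∈ segment ℝ x₁ x₃, dot (rot δ) z = dot (rot δ) x₂ → dot δ z ≤ dot δ x₂)
    (hb : ∀ z ∈ segment ℝ x₂ x₄, dot (rot δ) z = dot (rot δ) x₃ → dot δ z ≤ dot δ x₃) :
    ∃ z, z ∈ segment ℝ x₁ x₃ ∧ z ∈ segment ℝ x₂ x₄ := by
  set t := dot (rot δ) with ht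
  -- the point with abscissa `s` on the chord from `x` to `y`; the height difference of the chords
  -- changes sign between the second and the third point
  let c (x y : Plane) (s : ℝ) : Plane := x + ((s - t x) / (t y - t x)) • (y - x)
  have hc : ∀ x y s, t x < t y → t x ≤ s → s ≤ t y → c x y s ∈ segment ℝ x y ∧ t (c x y s) = s := by
    intro x y s h h1 h2
    constructor
    · rw [mem_segment_iff]
      refine ⟨_, ⟨div_nonneg (by linarith) (by linarith), ?_⟩, rfl⟩
      rw [div_le_one (by linarith)]; linarith
    · simp only [c, ht]
      rw [dot_add, dot_smul, dot_sub, div_mul_cancel₀ _ (by linarith)]; ring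
  have hcont : ContinuousOn (fun s => dot δ (c x₁ x₃ s) - dot δ (c x₂ x₄ s))
      (Icc (t x₂) (t x₃)) := by
    apply Continuous.continuousOn
    have hcc : ∀ x y, Continuous (c x y) := fun x y => by
      simp only [c]
      fun_prop
    exact ((continuous_dot δ).comp (hcc _ _)).sub ((continuous_dot δ).comp (hcc _ _))
  have hc2 : c x₂ x₄ (t x₂) = x₂ := by simp [c]
  have hc3 : c x₁ x₃ (t x₃) = x₃ := by simp [c, (sub_pos.2 h13).ne']
  have h0 : (0 : ℝ) ∈ Icc (dot δ (c x₁ x₃ (t x₂)) - dot δ (c x₂ x₄ (t x₂)))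
      (dot δ (c x₁ x₃ (t x₃)) - dot δ (c x₂ x₄ (t x₃))) := by
    rw [hc2, hc3]
    obtain ⟨m1, m2⟩ := hc x₁ x₃ (t x₂) h13 h12 h23
    obtain ⟨m3, m4⟩ := hc x₂ x₄ (t x₃) h24 h23 h34
    have := ha _ m1 m2
    have := hb _ m3 m4
    constructor <;> linarith
  obtain ⟨s, hs, hs0⟩ := intermediate_value_Icc h23 hcont h0
  obtain ⟨m1, m2⟩ := hc x₁ x₃ s h13 (h12.trans hs.1) hs.2
  obtain ⟨m3, m4⟩ := hc x₂ x₄ s h24 hs.1 (hs.2.trans h34)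
  refine ⟨c x₁ x₃ s, m1, ?_⟩
  have : c x₁ x₃ s = c x₂ x₄ s := eq_of_frame hδ (m2.trans m4.symm) (by
    simp only at hs0; linarith)
  rw [this]; exact m3

lemma dot_mem_segment {w x y z : Plane} {c : ℝ} (hz : z ∈ segment ℝ x y) (hx : dot w x ≤ c)
    (hy : dot w y ≤ c) : dot w z ≤ c := by
  rw [mem_segment_iff] at hz
  obtain ⟨t, ht, rfl⟩ := hz
  rw [dot_add, dot_smul, dot_sub]
  nlinarith [ht.1, ht.2]

lemma dot_eq_of_mem_segment {w x y z : Plane} {c : ℝ} (hz : z ∈ segment ℝ x y)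
    (hx : dot w x = c) (hy : dot w y = c) : dot w z = c := by
  rw [mem_segment_iff] at hz
  obtain ⟨t, ht, rfl⟩ := hz
  rw [dot_add, dot_smul, dot_sub, hx, hy]
  ring

/-- The points of a segment closer to `v` than to `w`: the bisector is a line. -/
lemma dist_lt_of_mem_segment {v w x y z : Plane} (hz : z ∈ segment ℝ x y)
    (hx : dist x v < dist x w) (hy : dist y v < dist y w) : dist z v < dist z w := by
  have key : ∀ p : Plane, dist p v < dist p w ↔ dot (w - v) p <
      ((w 0 ^ 2 + w 1 ^ 2) - (v 0 ^ 2 + v 1 ^ 2)) / 2 := by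
    intro p
    rw [lt_dist_iff dist_nonneg, dist_sq]
    simp only [dot, PiLp.sub_apply]
    constructor <;> intro h <;> nlinarith
  rw [key] at hx hy ⊢
  rw [mem_segment_iff] at hz
  obtain ⟨t, ht, rfl⟩ := hz
  rw [dot_add, dot_smul, dot_sub]
  rcases eq_or_lt_of_le ht.1 with h | h
  · rw [← h]; linarith
  · nlinarith [ht.2]

/-! ### Outlines, and the intersection of a convex set with another set -/

/-- `X` is traced by the curves in `C` outside the finite set `Z`: near each other point, `X`
coincides with the only curve of `C` through that point. All circles in `C` have radius `ρ`, and
`X` does not enter their interiors. At most `k` curves of `C` leave a point along `X`. -/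
structure Outline (X : Set Plane) (C : Finset Curve) (Z : Finset Plane) (ρ : ℝ) (k : ℕ) :
    Prop where
  valid : ∀ c ∈ C, c.Valid
  radius : ∀ v r, circ v r ∈ C → r = ρ
  clear : ∀ v, circ v ρ ∈ C → ∀ x ∈ X, ρ ≤ dist x v
  ends : ∀ c ∈ C, (c.path 0 ∈ X → c.path 0 ∈ Z) ∧ (c.path 1 ∈ X → c.path 1 ∈ Z)
  traced : ∀ x ∈ X, x ∉ Z → ∃ c ∈ C, x ∈ c.carrier ∧ ∀ᶠ y in 𝓝 x, (y ∈ X ↔ y ∈ c.carrier)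
  unique : ∀ x ∈ X, x ∉ Z → ∀ c ∈ C, ∀ c' ∈ C, x ∈ c.carrier → x ∈ c'.carrier → c = c'
  germs : ∀ z, ∀ J ⊆ C, (∀ c ∈ J, c.Germ X z) → J.card ≤ k

lemma Outline.dist_lt {X : Set Plane} {C : Finset Curve} {Z : Finset Plane} {ρ : ℝ} {k : ℕ}
    (h : Outline X C Z ρ k) {x v w : Plane} {r s : ℝ} (hx : x ∈ X) (hxZ : x ∉ Z)
    (hv : circ v r ∈ C) (hw : circ w s ∈ C) (hxv : x ∈ (circ v r).carrier)
    (hne : circ v r ≠ circ w s) : dist x v < dist x w := by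
  have hr := h.radius v r hv
  have hs := h.radius w s hw
  subst hr
  subst hs
  have hd : dist x v = s := hxv
  rw [hd]
  refine lt_of_le_of_ne (h.clear w hw x hx) fun he => hne ?_
  exact h.unique x hx hxZ _ hv _ hw hxv he.symm

/-- A supporting line at a boundary point of a convex set. -/
lemma exists_support {K : Set Plane} (hK : Convex ℝ K) (hKi : (interior K).Nonempty) {x : Plane}
    (hx : x ∉ interior K) : ∃ ν : Plane, ν ≠ 0 ∧ ∀ y ∈ K, dot ν y ≤ dot ν x := by
  obtain ⟨f, hf⟩ := geometric_hahn_banach_open_point hK.interior isOpen_interior hx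
  let ν : Plane := !₂[f (EuclideanSpace.single 0 1), f (EuclideanSpace.single 1 1)]
  have hfν : ∀ y, f y = dot ν y := by
    intro y
    have hy : y = y 0 • EuclideanSpace.single 0 (1 : ℝ) +
        y 1 • EuclideanSpace.single 1 (1 : ℝ) := by
      refine plane_ext ?_ ?_ <;> simp
    conv_lhs => rw [hy]
    rw [map_add, map_smul, map_smul]
    simp only [dot, ν, smul_eq_mul, Matrix.cons_val_zero, Matrix.cons_val_one]
    ring
  refine ⟨ν, ?_, fun y hy => ?_⟩
  · intro h0
    obtain ⟨a, ha⟩ := hKi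
    have := hf a ha
    rw [hfν, hfν, h0] at this
    simp [dot] at this
  · have hcl : y ∈ closure (interior K) := by
      rw [hK.closure_interior_eq_closure_of_nonempty_interior hKi]; exact subset_closure hy
    have : closure (interior K) ⊆ {z | dot ν z ≤ dot ν x} :=
      closure_minimal (fun z hz => by
        have := hf z hz
        rw [hfν, hfν] at this
        exact this.le) (isClosed_le (continuous_dot ν) continuous_const)
    exact this hcl

lemma not_mem_interior_of_support {K : Set Plane} {ν x : Plane} (hν : ν ≠ 0)
    (h : ∀ y ∈ K, dot ν y ≤ dot ν x) : x ∉ interior K := by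
  intro hx
  have hev : ∀ᶠ t in 𝓝 (0 : ℝ), x + t • ν ∈ K := by
    have hc : ContinuousAt (fun t : ℝ => x + t • ν) 0 := by fun_prop
    refine hc.eventually ?_
    simpa using mem_interior_iff_mem_nhds.1 hx
  obtain ⟨t, ht1, ht2⟩ := ((hev.filter_mono nhdsWithin_le_nhds).and
    (self_mem_nhdsWithin : Ioi (0 : ℝ) ∈ 𝓝[>] 0)).exists
  have := h _ ht1
  rw [dot_add, dot_smul] at this
  have hpos : 0 < dot ν ν := by
    have := norm_sq_eq ν
    have h2 : 0 < ‖ν‖ ^ 2 := by positivity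
    simp only [dot]; nlinarith
  have : (0 : ℝ) < t := ht2
  nlinarith

/-- A functional that is maximal on a set at an interior point of a segment of the set is constant
on the segment. -/
lemma dot_const_of_local_max {K : Set Plane} {ν a b x : Plane} (hx : x ∈ openSegment ℝ a b)
    (hloc : ∀ᶠ y in 𝓝 x, y ∈ segment ℝ a b → y ∈ K) (hmax : ∀ y ∈ K, dot ν y ≤ dot ν x) :
    dot ν a = dot ν x ∧ dot ν b = dot ν x := by
  rw [mem_openSegment_iff] at hx
  obtain ⟨t, ht, rfl⟩ := hx
  have hc : ContinuousAt (fun s : ℝ => a + s • (b - a)) t := by fun_prop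
  have hev : ∀ᶠ s in 𝓝 t, dot ν (a + s • (b - a)) ≤ dot ν (a + t • (b - a)) := by
    filter_upwards [hc.eventually hloc, Ioo_mem_nhds ht.1 ht.2] with s hs hs'
    refine hmax _ (hs ?_)
    rw [mem_segment_iff]
    exact ⟨s, ⟨hs'.1.le, hs'.2.le⟩, rfl⟩
  have h0 : dot ν (b - a) = 0 := by
    have h1 : IsLocalMax (fun s : ℝ => dot ν (a + s • (b - a))) t := hev
    have h2 : HasDerivAt (fun s : ℝ => dot ν (a + s • (b - a))) (dot ν (b - a)) t := by
      have : (fun s : ℝ => dot ν (a + s • (b - a))) = fun s => dot ν a + s * dot ν (b - a) := by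
        ext s; rw [dot_add, dot_smul]
      rw [this]
      simpa using ((hasDerivAt_id t).mul_const (dot ν (b - a))).const_add (dot ν a)
    exact h1.hasDerivAt_eq_zero h2
  have hb : dot ν b = dot ν a := by rw [dot_sub] at h0; linarith
  rw [dot_add, dot_smul, h0, hb]
  constructor <;> ring

/-- On a segment `a b`, the middle one of three points. -/
lemma exists_middle_of_segment {a b : Plane} {U : Finset Plane} (hU : 2 < U.card)
    (hab : ∀ x ∈ U, x ∈ segment ℝ a b) :
    ∃ x₁ ∈ U, ∃ x₂ ∈ U, ∃ x₃ ∈ U, x₂ ∈ openSegment ℝ x₁ x₃ ∧ x₁ ≠ x₃ := by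
  classical
  have hpar : ∀ x ∈ U, ∃ t : ℝ, a + t • (b - a) = x := fun x hx => by
    have := hab x hx
    rw [mem_segment_iff] at this
    obtain ⟨t, -, h⟩ := this
    exact ⟨t, h⟩
  choose! p hp using hpar
  have mid : ∀ x ∈ U, ∀ y ∈ U, ∀ z ∈ U, p x < p y → p y < p z →
      y ∈ openSegment ℝ x z ∧ x ≠ z := by
    intro x hx y hy z hz h1 h2
    constructor
    · rw [mem_openSegment_iff]
      refine ⟨(p y - p x) / (p z - p x), ⟨div_pos (by linarith) (by linarith), ?_⟩, ?_⟩
      · rw [div_lt_one (by linarith)]; linarith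
      · have e : z - x = (p z - p x) • (b - a) := by
          conv_lhs => rw [← hp x hx, ← hp z hz]
          module
        rw [e, smul_smul, div_mul_cancel₀ _ (by linarith)]
        have e2 : a + p x • (b - a) + (p y - p x) • (b - a) = a + p y • (b - a) := by module
        rwa [hp x hx, hp y hy] at e2
    · rintro rfl; linarith
  have hinj : ∀ x ∈ U, ∀ y ∈ U, x ≠ y → p x ≠ p y := fun x hx y hy h h' =>
    h (by rw [← hp x hx, ← hp y hy, h'])
  obtain ⟨x, y, z, hx, hy, hz, hxy, hxz, hyz⟩ := Finset.two_lt_card_iff.1 hU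
  have h1 := hinj x hx y hy hxy
  have h2 := hinj x hx z hz hxz
  have h3 := hinj y hy z hz hyz
  rcases lt_or_gt_of_ne h1 with h1 | h1 <;> rcases lt_or_gt_of_ne h2 with h2 | h2 <;>
    rcases lt_or_gt_of_ne h3 with h3 | h3
  · exact ⟨x, hx, y, hy, z, hz, mid x hx y hy z hz h1 h3⟩
  · exact ⟨x, hx, z, hz, y, hy, mid x hx z hz y hy h2 h3⟩
  · linarith
  · exact ⟨z, hz, x, hx, y, hy, mid z hz x hx y hy h2 h1⟩
  · exact ⟨y, hy, x, hx, z, hz, mid y hy x hx z hz h1 h2⟩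
  · linarith
  · exact ⟨y, hy, z, hz, x, hx, mid y hy z hz x hx h3 h2⟩
  · exact ⟨z, hz, y, hy, x, hx, mid z hz y hy x hx h3 h1⟩

/-- If a segment `a b` runs along the boundary of a convex set near a point of its interior, and
this boundary is a curve `c` near the point, then `c` runs along the segment. -/
lemma curve_along_segment {X : Set Plane} {c : Curve} {a b x : Plane} (hab : a ≠ b)
    (hx : x ∈ openSegment ℝ a b) (hX : ∀ y ∈ segment ℝ a b, y ∈ X)
    (hloc : ∀ᶠ y in 𝓝 x, (y ∈ X ↔ y ∈ c.carrier)) :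
    ∀ᶠ y in 𝓝 x, y ∈ X → y ∈ segment ℝ a b := by
  classical
  rw [mem_openSegment_iff] at hx
  obtain ⟨t, ht, rfl⟩ := hx
  have hcts : ContinuousAt (fun s : ℝ => a + s • (b - a)) t := by fun_prop
  have hev : ∀ᶠ s in 𝓝 t, s ∈ Ioo (0 : ℝ) 1 ∧ a + s • (b - a) ∈ c.carrier := by
    filter_upwards [hcts.eventually hloc, Ioo_mem_nhds ht.1 ht.2] with s hs hs'
    exact ⟨hs', hs.1 (hX _ (by rw [mem_segment_iff]; exact ⟨s, ⟨hs'.1.le, hs'.2.le⟩, rfl⟩))⟩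
  obtain ⟨ε, hε, hball⟩ := Metric.eventually_nhds_iff.1 hev
  have hba : b - a ≠ 0 := sub_ne_zero.2 hab.symm
  have hw : rot (b - a) ≠ 0 := by
    intro h
    apply hba
    have h0 := congrArg (fun z : Plane => z 0) h
    have h1 := congrArg (fun z : Plane => z 1) h
    simp only [rot_zero, rot_one, PiLp.zero_apply] at h0 h1
    exact plane_ext h1 (by simpa using neg_eq_zero.1 h0)
  have hdr : dot (rot (b - a)) (b - a) = 0 := by simp only [dot, rot_zero, rot_one]; ring
  have hline : ∀ s : ℝ, dot (rot (b - a)) (a + s • (b - a)) = dot (rot (b - a)) a := by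
    intro s; rw [dot_add, dot_smul, hdr]; ring
  have hm : ∀ s : ℝ, |s| < ε → a + (t + s) • (b - a) ∈ c.carrier := fun s hs =>
    (hball (by simpa [Real.dist_eq] using hs)).2
  have hinj : ∀ s s' : ℝ, a + s • (b - a) = a + s' • (b - a) → s = s' := by
    intro s s' h
    exact smul_left_injective ℝ hba (add_left_cancel h)
  cases c with
  | circ v r =>
    exfalso
    -- a circle cannot contain three points of a line
    let U : Finset Plane := {a + (t + 0) • (b - a), a + (t + ε / 2) • (b - a),
      a + (t + ε / 3) • (b - a)}
    have hU : U.card = 3 := by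
      rw [Finset.card_eq_three]
      refine ⟨_, _, _, fun h => ?_, fun h => ?_, fun h => ?_, rfl⟩
      · have := hinj _ _ h; linarith
      · have := hinj _ _ h; linarith
      · have := hinj _ _ h; linarith
    have := card_le_two_of_line_of_circle U v (rot (b - a)) r (dot (rot (b - a)) a) hw ?_ ?_
    · omega
    · intro x hx
      simp only [U, Finset.mem_insert, Finset.mem_singleton] at hx
      rcases hx with rfl | rfl | rfl
      · exact hm 0 (by simpa using hε)
      · exact hm _ (by rw [abs_of_pos (by linarith)]; linarith)
      · exact hm _ (by rw [abs_of_pos (by linarith)]; linarith)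
    · intro x hx
      simp only [U, Finset.mem_insert, Finset.mem_singleton] at hx
      rcases hx with rfl | rfl | rfl <;> exact hline _
  | seg p q =>
    have h1 := hm 0 (by simpa using hε)
    have h2 := hm (ε / 2) (by rw [abs_of_pos (by linarith)]; linarith)
    simp only [carrier] at h1 h2
    rw [mem_segment_iff] at h1 h2
    obtain ⟨s1, -, h1⟩ := h1
    obtain ⟨s2, -, h2⟩ := h2
    -- the line through `p` and `q` contains two points of the line through `a` and `b`
    have e1 : dot (rot (b - a)) p + s1 * dot (rot (b - a)) (q - p) = dot (rot (b - a)) a := by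
      rw [← hline (t + 0), ← h1, dot_add, dot_smul]
    have e2 : dot (rot (b - a)) p + s2 * dot (rot (b - a)) (q - p) = dot (rot (b - a)) a := by
      rw [← hline (t + ε / 2), ← h2, dot_add, dot_smul]
    have hne : s1 ≠ s2 := by
      rintro rfl
      have := hinj _ _ (h1.symm.trans h2); linarith
    have e3 : dot (rot (b - a)) (q - p) = 0 := by
      have : (s1 - s2) * dot (rot (b - a)) (q - p) = 0 := by linarith
      exact (mul_eq_zero.1 this).resolve_left (sub_ne_zero.2 hne)
    have hpos : 0 < dot (b - a) (b - a) := by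
      have := norm_sq_eq (b - a)
      have h2 : 0 < ‖b - a‖ ^ 2 := by positivity
      simp only [dot]; nlinarith
    have hcl : ∀ᶠ y in 𝓝 (a + t • (b - a)), 0 < dot (b - a) (y - a) ∧
        dot (b - a) (y - a) < dot (b - a) (b - a) := by
      have hcd : ContinuousAt (fun y => dot (b - a) (y - a)) (a + t • (b - a)) :=
        ((continuous_dot _).comp (continuous_id.sub continuous_const)).continuousAt
      refine hcd.eventually (Ioo_mem_nhds ?_ ?_)
      · simp only [add_sub_cancel_left, dot_smul]; exact mul_pos ht.1 hpos
      · simp only [add_sub_cancel_left, dot_smul]; nlinarith [ht.2]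
    filter_upwards [hloc, hcl] with y hy hy2 hyX
    have hyc := hy.1 hyX
    simp only [carrier] at hyc
    rw [mem_segment_iff] at hyc ⊢
    obtain ⟨s, -, rfl⟩ := hyc
    set y := p + s • (q - p) with hyd
    refine ⟨dot (b - a) (y - a) / dot (b - a) (b - a), ⟨(div_pos hy2.1 hpos).le, ?_⟩, ?_⟩
    · rw [div_le_one hpos]; exact hy2.2.le
    · refine eq_of_frame hba ?_ ?_
      · rw [e3, mul_zero, add_zero] at e1
        rw [hline, hyd, dot_add, dot_smul, e3, mul_zero, add_zero, e1]
      · rw [dot_add, dot_smul, div_mul_cancel₀ _ hpos.ne', dot_sub]; ring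

section Crossing

variable {K L : Set Plane} {CK CL : Finset Curve} {ZK ZL : Finset Plane} {α ρ : ℝ} {k l : ℕ}

lemma Outline.mem_openSegment {X : Set Plane} {C : Finset Curve} {Z : Finset Plane} {ρ : ℝ}
    {k : ℕ} (h : Outline X C Z ρ k) {x a b : Plane} (hx : x ∈ X) (hxZ : x ∉ Z)
    (hc : seg a b ∈ C) (hxc : x ∈ (seg a b).carrier) : x ∈ openSegment ℝ a b := by
  have he := h.ends _ hc
  simp only [path, AffineMap.lineMap_apply_zero, AffineMap.lineMap_apply_one] at he
  refine mem_openSegment_of_ne_left_right ?_ ?_ hxc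
  · rintro rfl; exact hxZ (he.1 hx)
  · rintro rfl; exact hxZ (he.2 hx)

/-- A convex boundary crosses a line segment of the other outline at most twice: at the middle one
of three crossings the segment would lie in a supporting line, hence in the boundary. -/
lemma card_crossing_seg_le (hK : Convex ℝ K) (hKc : IsClosed K) (hKi : (interior K).Nonempty)
    (hoK : Outline (frontier K) CK ZK α k) {a b : Plane} (U : Finset Plane)
    (hU : ∀ x ∈ U, x ∈ frontier K ∧ x ∉ ZK ∧ ¬ (∀ᶠ y in 𝓝 x, (y ∈ frontier K ↔ y ∈ L)) ∧
      x ∈ segment ℝ a b ∧ ∀ᶠ y in 𝓝 x, (y ∈ L ↔ y ∈ segment ℝ a b)) : U.card ≤ 2 := by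
  by_contra! hcard
  obtain ⟨x₁, h₁, x₂, h₂, x₃, h₃, hmid, hne⟩ :=
    exists_middle_of_segment hcard fun x hx => (hU x hx).2.2.2.1
  obtain ⟨hx₂, hx₂Z, hx₂no, hx₂ab, hx₂L⟩ := hU x₂ h₂
  refine hx₂no ?_
  have hsubK : segment ℝ x₁ x₃ ⊆ K := hK.segment_subset (hKc.frontier_subset (hU x₁ h₁).1)
    (hKc.frontier_subset (hU x₃ h₃).1)
  obtain ⟨ν, hν, hsup⟩ := exists_support hK hKi hx₂.2
  obtain ⟨e1, e3⟩ := dot_const_of_local_max hmid (Eventually.of_forall fun y hy => hsubK hy) hsup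
  have hfr : ∀ y ∈ segment ℝ x₁ x₃, y ∈ frontier K := fun y hy =>
    ⟨subset_closure (hsubK hy), not_mem_interior_of_support hν fun z hz =>
      (hsup z hz).trans_eq (dot_eq_of_mem_segment hy e1 e3).symm⟩
  obtain ⟨c, hc, hxc, hloc⟩ := hoK.traced x₂ hx₂ hx₂Z
  have h13 : segment ℝ x₁ x₃ ⊆ segment ℝ a b :=
    (convex_segment a b).segment_subset (hU x₁ h₁).2.2.2.1 (hU x₃ h₃).2.2.2.1
  have hab : a ≠ b := by
    rintro rfl
    have m1 := (hU x₁ h₁).2.2.2.1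
    have m3 := (hU x₃ h₃).2.2.2.1
    rw [segment_same, mem_singleton_iff] at m1 m3
    exact hne (m1.trans m3.symm)
  -- `x₂` is an interior point of `segment a b`, so near it this segment is its part `[x₁, x₃]`
  have hloc13 : ∀ᶠ y in 𝓝 x₂, y ∈ segment ℝ a b → y ∈ segment ℝ x₁ x₃ := by
    refine curve_along_segment hne hmid h13 (c := seg a b) ?_
    exact Eventually.of_forall fun y => Iff.rfl
  filter_upwards [curve_along_segment hne hmid hfr hloc, hloc13, hx₂L] with y hy1 hy2 hy3
  exact ⟨fun h => hy3.2 (h13 (hy1 h)), fun h => hfr y (hy2 (hy3.1 h))⟩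

/-- Circles of an outline do not alternate along the upper boundary of a convex set, as the
boundary points nearest to one of two centers are separated from the others by a line. -/
lemma circ_eq_of_alternation {X : Set Plane} {C : Finset Curve} {Z : Finset Plane}
    (ho : Outline X C Z ρ k) {δ x₁ x₂ x₃ x₄ v w : Plane} {r s : ℝ} (hδ : δ ≠ 0)
    (hup : ∀ x ∈ K, ∀ y ∈ ({x₁, x₂, x₃, x₄} : Set Plane), dot (rot δ) x = dot (rot δ) y →
      dot δ x ≤ dot δ y)
    (hK : Convex ℝ K) (hxK : ∀ x ∈ ({x₁, x₂, x₃, x₄} : Set Plane), x ∈ K ∧ x ∈ X ∧ x ∉ Z)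
    (h12 : dot (rot δ) x₁ < dot (rot δ) x₂) (h23 : dot (rot δ) x₂ < dot (rot δ) x₃)
    (h34 : dot (rot δ) x₃ < dot (rot δ) x₄) (hv : circ v r ∈ C) (hw : circ w s ∈ C)
    (h1 : x₁ ∈ (circ v r).carrier) (h2 : x₂ ∈ (circ w s).carrier)
    (h3 : x₃ ∈ (circ v r).carrier) (h4 : x₄ ∈ (circ w s).carrier) : circ v r = circ w s := by
  by_contra hne
  obtain ⟨z, hz13, hz24⟩ := segments_cross hδ h12.le h23.le h34.le (h12.trans h23)
    (h23.trans h34)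
    (fun z hz h => hup z (hK.segment_subset (hxK _ (by simp)).1 (hxK _ (by simp)).1 hz) x₂
      (by simp) h)
    (fun z hz h => hup z (hK.segment_subset (hxK _ (by simp)).1 (hxK _ (by simp)).1 hz) x₃
      (by simp) h)
  have m1 := hxK x₁ (by simp)
  have m2 := hxK x₂ (by simp)
  have m3 := hxK x₃ (by simp)
  have m4 := hxK x₄ (by simp)
  have d1 := dist_lt_of_mem_segment hz13 (ho.dist_lt m1.2.1 m1.2.2 hv hw h1 hne)
    (ho.dist_lt m3.2.1 m3.2.2 hv hw h3 hne)
  have d2 := dist_lt_of_mem_segment hz24 (ho.dist_lt m2.2.1 m2.2.2 hw hv h2 (Ne.symm hne))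
    (ho.dist_lt m4.2.1 m4.2.2 hw hv h4 (Ne.symm hne))
  exact lt_asymm d1 d2

/-- Crossings of a convex boundary with circles of the other outline, at points where `δ` points
out of the convex set. -/
lemma card_crossing_circ_le (hK : Convex ℝ K) (hKc : IsClosed K)
    (hoK : Outline (frontier K) CK ZK α k) (hoL : Outline (frontier L) CL ZL ρ l) {δ : Plane}
    (hδ : δ ≠ 0) (U : Finset Plane)
    (hU : ∀ x ∈ U, x ∈ frontier K ∧ x ∉ ZK ∧ x ∈ frontier L ∧ x ∉ ZL ∧
      ¬ (∀ᶠ y in 𝓝 x, (y ∈ frontier K ↔ y ∈ frontier L)) ∧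
      (∃ ν, (∀ y ∈ K, dot ν y ≤ dot ν x) ∧ 0 < dot ν δ) ∧
      ∃ v r, circ v r ∈ CL ∧ x ∈ (circ v r).carrier ∧
        ∀ᶠ y in 𝓝 x, (y ∈ frontier L ↔ y ∈ (circ v r).carrier)) :
    U.card ≤ 2 * (2 * CL.card + 2 * CK.card) := by
  classical
  have exK : ∀ x ∈ U, ∃ c ∈ CK, x ∈ c.carrier ∧ ∀ᶠ y in 𝓝 x, (y ∈ frontier K ↔ y ∈ c.carrier) :=
    fun x hx => hoK.traced x (hU x hx).1 (hU x hx).2.1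
  have exL : ∀ x ∈ U, ∃ c ∈ CL, (∃ v r, c = circ v r) ∧ x ∈ c.carrier ∧
      ∀ᶠ y in 𝓝 x, (y ∈ frontier L ↔ y ∈ c.carrier) := by
    intro x hx
    obtain ⟨v, r, h1, h2, h3⟩ := (hU x hx).2.2.2.2.2.2
    exact ⟨_, h1, ⟨v, r, rfl⟩, h2, h3⟩
  -- the two labels of a crossing are the curves of both outlines on which it lies
  choose! cK hcK hxK hlK using exK
  choose! cL hcL hcirc hxL hlL using exL
  choose! ν hν hνδ using fun x hx => (hU x hx).2.2.2.2.2.1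
  have hmemK : ∀ x ∈ U, x ∈ K := fun x hx => hKc.frontier_subset (hU x hx).1
  -- the points of `U` lie on the upper boundary of `K`
  have hup : ∀ x ∈ K, ∀ y ∈ U, dot (rot δ) x = dot (rot δ) y → dot δ x ≤ dot δ y := by
    intro x hx y hy h
    by_contra! hlt
    have hpos : 0 < dot δ δ := by
      have := norm_sq_eq δ
      have h2 : 0 < ‖δ‖ ^ 2 := by positivity
      simp only [dot]; nlinarith
    have hxy : x = y + ((dot δ x - dot δ y) / dot δ δ) • δ := by
      refine eq_of_frame hδ ?_ ?_
      · have h0 : dot (rot δ) δ = 0 := by simp only [dot, rot_zero, rot_one]; ring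
        rw [dot_add, dot_smul, h0, mul_zero, add_zero, h]
      · rw [dot_add, dot_smul, div_mul_cancel₀ _ hpos.ne']; ring
    have h1 := hν y hy x hx
    rw [hxy, dot_add, dot_smul] at h1
    have := mul_pos (div_pos (sub_pos.2 hlt) hpos) (hνδ y hy)
    linarith
  have hkey : InjOn (fun x => dot (rot δ) x) U := by
    intro x hx y hy h
    exact eq_of_frame hδ h (le_antisymm (hup x (hmemK x hx) y hy h)
      (hup y (hmemK y hy) x hx h.symm))
  have hcross : ∀ {x₁ x₂ x₃ x₄}, x₁ ∈ U → x₂ ∈ U → x₃ ∈ U → x₄ ∈ U →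
      ∀ x ∈ K, ∀ y ∈ ({x₁, x₂, x₃, x₄} : Set Plane), dot (rot δ) x = dot (rot δ) y →
      dot δ x ≤ dot δ y := by
    intro x₁ x₂ x₃ x₄ h₁ h₂ h₃ h₄ x hx y hy
    refine hup x hx y ?_
    rcases hy with rfl | rfl | rfl | rfl <;> assumption
  -- the points of a segment of `∂K` are consecutive
  have hseg : ∀ x₁ ∈ U, ∀ x₂ ∈ U, ∀ x₃ ∈ U, dot (rot δ) x₁ < dot (rot δ) x₂ →
      dot (rot δ) x₂ < dot (rot δ) x₃ → ∀ a b, cK x₁ = seg a b → cK x₃ = seg a b →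
      cK x₂ = seg a b := by
    intro x₁ h₁ x₂ h₂ x₃ h₃ h12 h23 a b e1 e3
    obtain ⟨hK1, hZ1, -⟩ := hU x₁ h₁
    have hx1 := hoK.mem_openSegment hK1 hZ1 (e1 ▸ hcK x₁ h₁)
      (show x₁ ∈ (seg a b).carrier from e1 ▸ hxK x₁ h₁)
    have hl1 := hlK x₁ h₁
    rw [e1] at hl1
    obtain ⟨da, db⟩ := dot_const_of_local_max hx1
      (hl1.mono fun y hy h => hKc.frontier_subset (hy.2 h)) (hν x₁ h₁)
    have m1 : x₁ ∈ (seg a b).carrier := e1 ▸ hxK x₁ h₁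
    have m3 : x₃ ∈ (seg a b).carrier := e3 ▸ hxK x₃ h₃
    obtain ⟨z, hz, hz2⟩ := exists_mem_segment_of_dot h12.le h23.le (h12.trans h23)
    have hzab : z ∈ segment ℝ a b := (convex_segment a b).segment_subset m1 m3 hz
    have hz3 := dot_eq_of_mem_segment hzab da db
    have hle := hup z (hK.segment_subset (hmemK _ h₁) (hmemK _ h₃) hz) x₂ h₂ hz2
    have hpos : 0 < dot δ δ := by
      have := norm_sq_eq δ
      have h2 : 0 < ‖δ‖ ^ 2 := by positivity
      simp only [dot]; nlinarith
    have hxy : x₂ = z + ((dot δ x₂ - dot δ z) / dot δ δ) • δ := by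
      refine eq_of_frame hδ ?_ ?_
      · have h0 : dot (rot δ) δ = 0 := by simp only [dot, rot_zero, rot_one]; ring
        rw [dot_add, dot_smul, h0, mul_zero, add_zero, hz2]
      · rw [dot_add, dot_smul, div_mul_cancel₀ _ hpos.ne']; ring
    have h5 := hν x₁ h₁ x₂ (hmemK _ h₂)
    rw [hxy, dot_add, dot_smul, hz3] at h5
    have h6 : (dot δ x₂ - dot δ z) / dot δ δ ≤ 0 := by
      by_contra! h7
      have := mul_pos h7 (hνδ x₁ h₁)
      linarith
    have h7 : dot δ x₂ - dot δ z ≤ 0 := by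
      by_contra! h8
      exact absurd h6 (not_le.2 (div_pos h8 hpos))
    have hzx : x₂ = z := eq_of_frame hδ hz2.symm (by linarith)
    exact hoK.unique x₂ (hU x₂ h₂).1 (hU x₂ h₂).2.1 _ (hcK x₂ h₂) _ (e1 ▸ hcK x₁ h₁)
      (hxK x₂ h₂) (hzx ▸ hzab)
  refine (card_le_of_alternation_free U (fun x => dot (rot δ) x) hkey cL cK 2 ?_ ?_ ?_).trans ?_
  · intro x₁ h₁ x₂ h₂ x₃ h₃ x₄ h₄ h12 h23 h34 e13 e24
    obtain ⟨v, r, hv⟩ := hcirc x₁ h₁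
    obtain ⟨w, s, hw⟩ := hcirc x₂ h₂
    rw [hv, hw]
    refine circ_eq_of_alternation hoL hδ (hcross h₁ h₂ h₃ h₄) hK ?_ h12 h23 h34
      (hv ▸ hcL x₁ h₁) (hw ▸ hcL x₂ h₂) (hv ▸ hxL x₁ h₁) (hw ▸ hxL x₂ h₂)
      (hv ▸ e13 ▸ hxL x₃ h₃) (hw ▸ e24 ▸ hxL x₄ h₄)
    intro x hx
    have : x ∈ U := by rcases hx with rfl | rfl | rfl | rfl <;> assumption
    exact ⟨hmemK x this, (hU x this).2.2.1, (hU x this).2.2.2.1⟩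
  -- the boundary of `K` may be labelled by a segment: it contains all points between two of its
  -- points, so nothing alternates with it
  · intro x₁ h₁ x₂ h₂ x₃ h₃ x₄ h₄ h12 h23 h34 e13 e24
    cases hv : cK x₁ with
    | seg a b => exact (hseg x₁ h₁ x₂ h₂ x₃ h₃ h12 h23 a b hv (e13 ▸ hv)).symm
    | circ v r =>
      cases hw : cK x₂ with
      | seg a b =>
        rw [← hv, e13]
        exact hseg x₂ h₂ x₃ h₃ x₄ h₄ h23 h34 a b hw (e24 ▸ hw)
      | circ w s =>
        refine circ_eq_of_alternation hoK hδ (hcross h₁ h₂ h₃ h₄) hK ?_ h12 h23 h34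
          (hv ▸ hcK x₁ h₁) (hw ▸ hcK x₂ h₂) (hv ▸ hxK x₁ h₁) (hw ▸ hxK x₂ h₂)
          (hv ▸ e13 ▸ hxK x₃ h₃) (hw ▸ e24 ▸ hxK x₄ h₄)
        intro x hx
        have : x ∈ U := by rcases hx with rfl | rfl | rfl | rfl <;> assumption
        exact ⟨hmemK x this, (hU x this).1, (hU x this).2.1⟩
  -- equally labelled crossings lie on two different curves, one of which is a circle
  · intro V hV hlab
    rcases V.eq_empty_or_nonempty with rfl | ⟨o, ho⟩
    · simp
    obtain ⟨v, r, hv⟩ := hcirc o (hV ho)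
    have hVL : ∀ x ∈ V, dist x v = r := fun x hx => by
      have := hxL x (hV hx)
      rw [(hlab x hx o ho).1, hv] at this
      exact this
    cases hc : cK o with
    | seg a b =>
      have hab : a ≠ b := by
        have := hoK.valid _ (hcK o (hV ho))
        rw [hc] at this
        exact this
      refine card_le_two_of_line_of_circle V v (rot (b - a)) r (dot (rot (b - a)) a) ?_ hVL ?_
      · intro h
        have h0 := congrArg (fun z : Plane => z 0) h
        have h1 := congrArg (fun z : Plane => z 1) h
        simp only [rot_zero, rot_one, PiLp.zero_apply, PiLp.sub_apply] at h0 h1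
        exact hab (plane_ext (by linarith) (by linarith))
      · intro x hx
        have := hxK x (hV hx)
        rw [(hlab x hx o ho).2, hc] at this
        refine dot_eq_of_mem_segment this rfl ?_
        simp only [dot, rot_zero, rot_one, PiLp.sub_apply]; ring
    | circ w s =>
      have hVK : ∀ x ∈ V, dist x w = s := fun x hx => by
        have := hxK x (hV hx)
        rw [(hlab x hx o ho).2, hc] at this
        exact this
      by_cases hne : v ≠ w ∨ r ≠ s
      · exact card_le_two_of_two_circles V v w r s hne hVL hVK
      · push Not at hne
        obtain ⟨rfl, rfl⟩ := hne
        exfalso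
        refine (hU o (hV ho)).2.2.2.2.1 ?_
        have l1 := hlK o (hV ho)
        have l2 := hlL o (hV ho)
        rw [hc] at l1
        rw [hv] at l2
        filter_upwards [l1, l2] with y h1 h2
        rw [h1, h2]
  · have h1 : (U.image cL).card ≤ CL.card :=
      Finset.card_le_card (Finset.image_subset_iff.2 hcL)
    have h2 : (U.image cK).card ≤ CK.card :=
      Finset.card_le_card (Finset.image_subset_iff.2 hcK)
    omega

/-- The number of crossings of the outline of a convex set with another outline is linear. -/
theorem card_crossing_le (hK : Convex ℝ K) (hKc : IsClosed K) (hKi : (interior K).Nonempty)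
    (hoK : Outline (frontier K) CK ZK α k) (hoL : Outline (frontier L) CL ZL ρ l)
    (U : Finset Plane)
    (hU : ∀ x ∈ U, x ∈ frontier K ∧ x ∉ ZK ∧ x ∈ frontier L ∧ x ∉ ZL ∧
      ¬ (∀ᶠ y in 𝓝 x, (y ∈ frontier K ↔ y ∈ frontier L))) :
    U.card ≤ 18 * CL.card + 16 * CK.card := by
  classical
  have exL : ∀ x ∈ U, ∃ c ∈ CL, x ∈ c.carrier ∧
      ∀ᶠ y in 𝓝 x, (y ∈ frontier L ↔ y ∈ c.carrier) :=
    fun x hx => hoL.traced x (hU x hx).2.2.1 (hU x hx).2.2.2.1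
  choose! cL hcL hxL hlL using exL
  choose! ν hν0 hν using fun x hx => exists_support hK hKi (hU x hx).1.2
  -- the crossings with segments, and the crossings with circles by the direction of the outer
  -- normal of `K`: it has a positive product with one of `e0`, `-e0`, `e1`, `-e1`
  let A := U.filter fun x => ∃ a b, cL x = seg a b
  let D (δ : Plane) := U.filter fun x => 0 < dot (ν x) δ ∧ ∃ v r, cL x = circ v r
  have hA : A.card ≤ 2 * CL.card := by
    refine Finset.card_le_mul_card_image_of_maps_to (f := cL)
      (fun x hx => hcL x (Finset.mem_filter.1 hx).1) 2 fun c _ => ?_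
    cases c with
    | circ v r =>
      rw [Finset.card_eq_zero.2]
      · omega
      · refine Finset.filter_eq_empty_iff.2 fun x hx h => ?_
        obtain ⟨a, b, h'⟩ := (Finset.mem_filter.1 hx).2
        rw [h] at h'; cases h'
    | seg a b =>
      refine card_crossing_seg_le (L := frontier L) (a := a) (b := b) hK hKc hKi hoK _
        fun x hx => ?_
      obtain ⟨hx1, hx2⟩ := Finset.mem_filter.1 hx
      have hxU := (Finset.mem_filter.1 hx1).1
      obtain ⟨u1, u2, u3, u4, u5⟩ := hU x hxU
      have e1 := hxL x hxU
      have e2 := hlL x hxU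
      rw [hx2] at e1 e2
      exact ⟨u1, u2, u5, e1, e2⟩
  have hD : ∀ δ : Plane, δ ≠ 0 → (D δ).card ≤ 2 * (2 * CL.card + 2 * CK.card) := by
    intro δ hδ
    refine card_crossing_circ_le hK hKc hoK hoL hδ _ fun x hx => ?_
    obtain ⟨hxU, hx2, v, r, hx3⟩ := Finset.mem_filter.1 hx
    obtain ⟨u1, u2, u3, u4, u5⟩ := hU x hxU
    have e0 := hcL x hxU
    have e1 := hxL x hxU
    have e2 := hlL x hxU
    rw [hx3] at e0 e1 e2
    exact ⟨u1, u2, u3, u4, u5, ⟨ν x, hν x hxU, hx2⟩, v, r, e0, e1, e2⟩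
  let e0 : Plane := !₂[1, 0]
  let e1 : Plane := !₂[0, 1]
  have d0 : ∀ u, dot u e0 = u 0 := fun u => by simp [dot, e0]
  have d1 : ∀ u, dot u e1 = u 1 := fun u => by simp [dot, e1]
  have d0' : ∀ u, dot u (-e0) = -u 0 := fun u => by simp [dot, e0]
  have d1' : ∀ u, dot u (-e1) = -u 1 := fun u => by simp [dot, e1]
  have n0 : e0 ≠ 0 := fun h => by
    have := congrArg (fun z : Plane => z 0) h; simp [e0] at this
  have n1 : e1 ≠ 0 := fun h => by
    have := congrArg (fun z : Plane => z 1) h; simp [e1] at this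
  have hcover : U ⊆ A ∪ (D e0 ∪ (D (-e0) ∪ (D e1 ∪ D (-e1)))) := by
    intro x hx
    simp only [Finset.mem_union, A, D, Finset.mem_filter, d0, d1, d0', d1', hx, true_and]
    cases hc : cL x with
    | seg a b => exact Or.inl ⟨a, b, rfl⟩
    | circ v r =>
      have hr : ∃ v' r', circ v r = circ v' r' := ⟨v, r, rfl⟩
      have : ν x 0 ≠ 0 ∨ ν x 1 ≠ 0 := by
        by_contra! h
        exact hν0 x hx (plane_ext h.1 h.2)
      rcases this with h | h <;> rcases lt_or_gt_of_ne h with h | h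
      · exact Or.inr (Or.inr (Or.inl ⟨by linarith, hr⟩))
      · exact Or.inr (Or.inl ⟨h, hr⟩)
      · exact Or.inr (Or.inr (Or.inr (Or.inr ⟨by linarith, hr⟩)))
      · exact Or.inr (Or.inr (Or.inr (Or.inl ⟨h, hr⟩)))
  have c1 := Finset.card_le_card hcover
  have c2 := Finset.card_union_le A (D e0 ∪ (D (-e0) ∪ (D e1 ∪ D (-e1))))
  have c3 := Finset.card_union_le (D e0) (D (-e0) ∪ (D e1 ∪ D (-e1)))
  have c4 := Finset.card_union_le (D (-e0)) (D e1 ∪ D (-e1))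
  have c5 := Finset.card_union_le (D e1) (D (-e1))
  have f1 := hD e0 n0
  have f2 := hD (-e0) (neg_ne_zero.2 n0)
  have f3 := hD e1 n1
  have f4 := hD (-e1) (neg_ne_zero.2 n1)
  omega

end Crossing

lemma frontier_inter_of_isClosed {K L : Set Plane} (hK : IsClosed K) (hL : IsClosed L) :
    frontier (K ∩ L) = (frontier K ∩ L) ∪ (K ∩ frontier L) := by
  rw [(hK.inter hL).frontier_eq, hK.frontier_eq, hL.frontier_eq, interior_inter]
  ext x
  simp only [Set.mem_sdiff, mem_inter_iff, mem_union]
  tauto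

/-- If the boundaries of a convex set and of another set have outlines of linear size, then so has
the boundary of the intersection. -/
theorem exists_consistsOf_inter {K L : Set Plane} {CK CL : Finset Curve} {ZK ZL : Finset Plane}
    {α ρ : ℝ} {k l : ℕ} (hK : Convex ℝ K) (hKc : IsClosed K) (hKi : (interior K).Nonempty)
    (hLc : IsClosed L) (hoK : Outline (frontier K) CK ZK α k)
    (hoL : Outline (frontier L) CL ZL ρ l) :
    ∃ (V : Finset Plane) (A R : Finset (Set Plane)), ConsistsOf (frontier (K ∩ L)) V A R ∧
      V.card + A.card + R.card ≤
        (1 + 2 * (k + l)) * (ZK.card + ZL.card + 18 * CL.card + 16 * CK.card) := by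
  classical
  obtain ⟨W, hW, hWc⟩ := exists_finset_of_card_le {x | x ∈ frontier K ∧ x ∉ ZK ∧ x ∈ frontier L ∧
    x ∉ ZL ∧ ¬ (∀ᶠ y in 𝓝 x, (y ∈ frontier K ↔ y ∈ frontier L))} (18 * CL.card + 16 * CK.card)
    fun T hT => card_crossing_le hK hKc hKi hoK hoL T fun x hx => hT hx
  set X := frontier (K ∩ L) with hXdef
  have hX : X = (frontier K ∩ L) ∪ (K ∩ frontier L) := frontier_inter_of_isClosed hKc hLc
  have hXK : frontier K ∩ L ⊆ X := hX ▸ subset_union_left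
  have hXL : K ∩ frontier L ⊆ X := hX ▸ subset_union_right
  let Z : Finset Plane := (ZK ∪ ZL ∪ W).filter (· ∈ X)
  have hZ : ∀ x ∈ X, x ∉ Z → x ∉ ZK ∧ x ∉ ZL ∧ x ∉ W := by
    intro x hx hxZ
    simp only [Z, Finset.mem_filter, Finset.mem_union, hx, and_true, not_or] at hxZ
    tauto
  -- at a common boundary point outside `Z` the two boundaries coincide
  have hover : ∀ x ∈ frontier K ∩ frontier L, x ∉ Z →
      ∀ᶠ y in 𝓝 x, (y ∈ frontier K ↔ y ∈ frontier L) := by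
    rintro x ⟨h1, h2⟩ hxZ
    obtain ⟨z1, z2, z3⟩ := hZ x (hXK ⟨h1, hLc.frontier_subset h2⟩) hxZ
    by_contra hno
    exact z3 (by rw [← Finset.mem_coe, hW]; exact ⟨h1, z1, h2, z2, hno⟩)
  have hnear : ∀ x, x ∉ Z → ∀ᶠ y in 𝓝 x, y ∉ Z := fun x hx => by
    have := Z.finite_toSet.isClosed.isOpen_compl.mem_nhds hx
    exact this
  -- the curves of both outlines with the parts of them that bound the intersection; common parts
  -- of the two boundaries are assigned to `K`
  let c : Curve ⊕ Curve → Curve := Sum.elim id id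
  let Y : Curve ⊕ Curve → Set Plane := Sum.elim
    (fun c => {x | x ∈ frontier K ∧ x ∈ L ∧ x ∉ Z ∧ x ∈ c.carrier})
    (fun c => {x | x ∈ interior K ∧ x ∈ frontier L ∧ x ∉ Z ∧ x ∈ c.carrier})
  let I : Finset (Curve ⊕ Curve) := CK.disjSum CL
  have hKL : ∀ x, x ∈ interior K → x ∈ frontier K → False := fun x h1 h2 => h2.2 h1
  suffices H : ∃ (V : Finset Plane) (A R : Finset (Set Plane)), ConsistsOf X V A R ∧
      V.card + A.card + R.card ≤ (1 + 2 * (k + l)) * Z.card by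
    obtain ⟨V, A, R, hcons, hcard⟩ := H
    refine ⟨V, A, R, hcons, hcard.trans (Nat.mul_le_mul_left _ ?_)⟩
    have h1 : Z.card ≤ (ZK ∪ ZL ∪ W).card := Finset.card_filter_le _ _
    have h2 := Finset.card_union_le (ZK ∪ ZL) W
    have h3 := Finset.card_union_le ZK ZL
    omega
  refine exists_consistsOf I c Y X Z (k + l) isClosed_frontier ?_ ?_ ?_ ?_ ?_ ?_ ?_ ?_ ?_ ?_ ?_
  · rintro (i | i) hi
    · exact hoK.valid i (Finset.inl_mem_disjSum.1 hi)
    · exact hoL.valid i (Finset.inr_mem_disjSum.1 hi)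
  · intro x hx
    exact (Finset.mem_filter.1 hx).2
  · intro x hx hxZ
    obtain ⟨z1, z2, z3⟩ := hZ x hx hxZ
    rw [hX] at hx
    by_cases hxK : x ∈ frontier K
    · have hxL : x ∈ L := hx.elim (fun h => h.2) fun h => hLc.frontier_subset h.2
      obtain ⟨i, hi, hxi, -⟩ := hoK.traced x hxK z1
      exact ⟨Sum.inl i, Finset.inl_mem_disjSum.2 hi, hxK, hxL, hxZ, hxi⟩
    · have h := hx.resolve_left fun h => hxK h.1
      obtain ⟨i, hi, hxi, -⟩ := hoL.traced x h.2 z2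
      refine ⟨Sum.inr i, Finset.inr_mem_disjSum.2 hi, ?_, h.2, hxZ, hxi⟩
      by_contra hno
      exact hxK ⟨subset_closure h.1, hno⟩
  · rintro (i | i) - x hx
    · exact hXK ⟨hx.1, hx.2.1⟩
    · exact hXL ⟨interior_subset hx.1, hx.2.1⟩
  · rintro (i | i) - x hx
    · exact hx.2.2.1
    · exact hx.2.2.1
  · rintro (i | i) - x hx
    · exact hx.2.2.2
    · exact hx.2.2.2
  · rintro (i | i) hi (j | j) hj x hx hx'
    · have hz := hZ x (hXK ⟨hx.1, hx.2.1⟩) hx.2.2.1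
      rw [hoK.unique x hx.1 hz.1 i (Finset.inl_mem_disjSum.1 hi) j (Finset.inl_mem_disjSum.1 hj)
        hx.2.2.2 hx'.2.2.2]
    · exact (hKL x hx'.1 hx.1).elim
    · exact (hKL x hx.1 hx'.1).elim
    · have hz := hZ x (hXL ⟨interior_subset hx.1, hx.2.1⟩) hx.2.2.1
      rw [hoL.unique x hx.2.1 hz.2.1 i (Finset.inr_mem_disjSum.1 hi) j
        (Finset.inr_mem_disjSum.1 hj) hx.2.2.2 hx'.2.2.2]
  · rintro (i | i) hi x ⟨h1, h2, h3, h4⟩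
    · have hz := hZ x (hXK ⟨h1, h2⟩) h3
      obtain ⟨j, hj, hxj, hloc⟩ := hoK.traced x h1 hz.1
      obtain rfl := hoK.unique x h1 hz.1 i (Finset.inl_mem_disjSum.1 hi) j hj h4 hxj
      by_cases hxL : x ∈ interior L
      · filter_upwards [hloc, hnear x h3, isOpen_interior.mem_nhds hxL] with y y1 y2 y3 y4
        exact ⟨y1.2 y4, interior_subset y3, y2, y4⟩
      · filter_upwards [hloc, hnear x h3, hover x ⟨h1, subset_closure h2, hxL⟩ h3]
          with y y1 y2 y3 y4
        exact ⟨y1.2 y4, hLc.frontier_subset (y3.1 (y1.2 y4)), y2, y4⟩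
    · have hz := hZ x (hXL ⟨interior_subset h1, h2⟩) h3
      obtain ⟨j, hj, hxj, hloc⟩ := hoL.traced x h2 hz.2.1
      obtain rfl := hoL.unique x h2 hz.2.1 i (Finset.inr_mem_disjSum.1 hi) j hj h4 hxj
      filter_upwards [hloc, hnear x h3, isOpen_interior.mem_nhds h1] with y y1 y2 y3 y4
      exact ⟨y3, y1.2 y4, y2, y4⟩
  · rintro (i | i) hi x ⟨h1, h2, h3, h4⟩
    · have hz := hZ x (hXK ⟨h1, h2⟩) h3
      obtain ⟨j, hj, hxj, hloc⟩ := hoK.traced x h1 hz.1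
      obtain rfl := hoK.unique x h1 hz.1 i (Finset.inl_mem_disjSum.1 hi) j hj h4 hxj
      have hyK : ∀ᶠ y in 𝓝 x, y ∈ X → y ∈ frontier K ∧ y ∈ L := by
        by_cases hxL : x ∈ interior L
        · filter_upwards [isOpen_interior.mem_nhds hxL] with y y1 y2
          rw [hX] at y2
          exact y2.resolve_right fun h => h.2.2 y1
        · filter_upwards [hover x ⟨h1, subset_closure h2, hxL⟩ h3] with y y1 y2
          rw [hX] at y2
          rcases y2 with h | h
          · exact h
          · exact ⟨y1.2 h.2, hLc.frontier_subset h.2⟩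
      filter_upwards [hyK, hnear x h3, hloc] with y y1 y2 y3 y4
      exact ⟨(y1 y4).1, (y1 y4).2, y2, y3.1 (y1 y4).1⟩
    · have hz := hZ x (hXL ⟨interior_subset h1, h2⟩) h3
      obtain ⟨j, hj, hxj, hloc⟩ := hoL.traced x h2 hz.2.1
      obtain rfl := hoL.unique x h2 hz.2.1 i (Finset.inr_mem_disjSum.1 hi) j hj h4 hxj
      filter_upwards [hloc, hnear x h3, isOpen_interior.mem_nhds h1] with y y1 y2 y3 y4
      rw [hX] at y4
      have h := y4.resolve_left fun h => hKL y y3 h.1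
      exact ⟨y3, h.2, y2, y1.1 h.2⟩
  · rintro (i | i) hi
    · have he := hoK.ends i (Finset.inl_mem_disjSum.1 hi)
      constructor
      · rintro ⟨h1, h2, h3, -⟩
        exact (hZ _ (hXK ⟨h1, h2⟩) h3).1 (he.1 h1)
      · rintro ⟨h1, h2, h3, -⟩
        exact (hZ _ (hXK ⟨h1, h2⟩) h3).1 (he.2 h1)
    · have he := hoL.ends i (Finset.inr_mem_disjSum.1 hi)
      constructor
      · rintro ⟨h1, h2, h3, -⟩
        exact (hZ _ (hXL ⟨interior_subset h1, h2⟩) h3).2.1 (he.1 h2)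
      · rintro ⟨h1, h2, h3, -⟩
        exact (hZ _ (hXL ⟨interior_subset h1, h2⟩) h3).2.1 (he.2 h2)
  · intro z _ J hJ hg
    have h1 := hoK.germs z (J.toLeft) (fun i hi =>
      Finset.inl_mem_disjSum.1 (hJ (Finset.mem_toLeft.1 hi)))
      fun i hi => (hg _ (Finset.mem_toLeft.1 hi)).mono fun x hx => hx.1
    have h2 := hoL.germs z (J.toRight) (fun i hi =>
      Finset.inr_mem_disjSum.1 (hJ (Finset.mem_toRight.1 hi)))
      fun i hi => (hg _ (Finset.mem_toRight.1 hi)).mono fun x hx => hx.2.1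
    rw [← Finset.card_toLeft_add_card_toRight (u := J)]
    omega

/-! ### Normals of oriented segments -/

/-- The unit normal on the right-hand side of the direction from `a` to `b`. -/
noncomputable def normal (a b : Plane) : Plane := ‖b - a‖⁻¹ • -rot (b - a)

lemma dot_self (u : Plane) : dot u u = ‖u‖ ^ 2 := by rw [norm_sq_eq, dot]; ring

lemma norm_rot (u : Plane) : ‖rot u‖ = ‖u‖ := by
  rw [← sq_eq_sq₀ (norm_nonneg _) (norm_nonneg _), norm_sq_eq, norm_sq_eq, rot_zero, rot_one]
  ring

lemma rot_smul (c : ℝ) (u : Plane) : rot (c • u) = c • rot u := by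
  refine plane_ext ?_ ?_ <;> simp

lemma rot_neg (u : Plane) : rot (-u) = -rot u := by
  refine plane_ext ?_ ?_ <;> simp

lemma rot_rot (u : Plane) : rot (rot u) = -u := by
  refine plane_ext ?_ ?_ <;> simp

lemma norm_normal {a b : Plane} (hab : a ≠ b) : ‖normal a b‖ = 1 := by
  have : ‖b - a‖ ≠ 0 := norm_ne_zero_iff.2 (sub_ne_zero.2 hab.symm)
  rw [normal, norm_smul, norm_neg, norm_rot, norm_inv, norm_norm, inv_mul_cancel₀ this]

lemma dot_normal (a b : Plane) : dot (normal a b) (b - a) = 0 := by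
  simp only [normal, dot, PiLp.smul_apply, PiLp.neg_apply, rot_zero, rot_one, smul_eq_mul]
  ring

lemma rot_normal (a b : Plane) : rot (normal a b) = ‖b - a‖⁻¹ • (b - a) := by
  rw [normal, rot_smul, rot_neg, rot_rot, neg_neg]

lemma normal_swap (a b : Plane) : normal b a = -normal a b := by
  rw [normal, normal, ← norm_sub_rev a b, ← neg_sub b a, rot_neg, neg_neg, smul_neg, neg_neg]

lemma normal_ne_zero {a b : Plane} (hab : a ≠ b) : normal a b ≠ 0 := fun h => by
  have := norm_normal hab
  rw [h, norm_zero] at this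
  exact zero_ne_one this

lemma sub_eq_norm_smul_rot_normal {a b : Plane} (hab : a ≠ b) :
    b - a = ‖b - a‖ • rot (normal a b) := by
  rw [rot_normal, smul_smul, mul_inv_cancel₀ (norm_ne_zero_iff.2 (sub_ne_zero.2 hab.symm)),
    one_smul]

/-- Vectors orthogonal to a segment are multiples of its normal. -/
lemma eq_smul_normal {a b v : Plane} (hab : a ≠ b) (h : dot (b - a) v = 0) :
    v = dot (normal a b) v • normal a b := by
  refine eq_of_frame (normal_ne_zero hab) ?_ ?_
  · rw [dot_smul, rot_normal]
    have h1 : dot (‖b - a‖⁻¹ • (b - a)) v = 0 := by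
      rw [dot_comm, dot_smul, dot_comm, h, mul_zero]
    have h2 : dot (‖b - a‖⁻¹ • (b - a)) (normal a b) = 0 := by
      rw [dot_comm, dot_smul, dot_normal, mul_zero]
    rw [h1, h2, mul_zero]
  · rw [dot_smul, dot_self, norm_normal hab]; ring

lemma eq_normal_or {a b v : Plane} {r : ℝ} (hab : a ≠ b) (h : dot (b - a) v = 0)
    (hv : ‖v‖ = r) : v = r • normal a b ∨ v = r • normal b a := by
  have h1 := eq_smul_normal hab h
  have h2 : |dot (normal a b) v| = r := by
    rw [← hv]
    conv_rhs => rw [h1, norm_smul, norm_normal hab, mul_one]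
    rfl
  rcases abs_eq (hv ▸ norm_nonneg v) |>.1 h2 with h3 | h3
  · left; rw [← h3]; exact h1
  · right; rw [normal_swap, smul_neg, ← neg_smul, ← h3]; exact h1

/-- The offset of a segment by `r` to the right. -/
noncomputable def offset (r : ℝ) (e : Plane × Plane) : Curve :=
  seg (e.1 + r • normal e.1 e.2) (e.2 + r • normal e.1 e.2)

lemma mem_offset {r : ℝ} {e : Plane × Plane} {x : Plane} :
    x ∈ (offset r e).carrier ↔ ∃ p ∈ segment ℝ e.1 e.2, x = p + r • normal e.1 e.2 := by
  simp only [offset, carrier, mem_segment_iff]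
  constructor
  · rintro ⟨t, ht, rfl⟩
    exact ⟨_, ⟨t, ht, rfl⟩, by module⟩
  · rintro ⟨p, ⟨t, ht, rfl⟩, rfl⟩
    exact ⟨t, ht, by module⟩

/-- The nearest point of a segment, if it is not an endpoint, is the foot of a perpendicular. -/
lemma dot_eq_zero_of_nearest {a b x q : Plane} (hq : q ∈ openSegment ℝ a b)
    (h : ∀ z ∈ openSegment ℝ a b, dist x q ≤ dist x z) : dot (b - a) (x - q) = 0 := by
  rw [mem_openSegment_iff] at hq
  obtain ⟨t, ht, rfl⟩ := hq
  have h1 : IsLocalMin (fun s : ℝ => (x 0 - (a 0 + s * (b 0 - a 0))) ^ 2 +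
      (x 1 - (a 1 + s * (b 1 - a 1))) ^ 2) t := by
    filter_upwards [Ioo_mem_nhds ht.1 ht.2] with s hs
    have := h _ (mem_openSegment_iff.2 ⟨s, hs, rfl⟩)
    rw [← pow_le_pow_iff_left₀ dist_nonneg dist_nonneg two_ne_zero, dist_sq, dist_sq] at this
    simpa using this
  have hd : ∀ u v w : ℝ, HasDerivAt (fun s : ℝ => (u - (v + s * w)) ^ 2)
      (2 * (u - (v + t * w)) * -w) t := by
    intro u v w
    have h2 := (((hasDerivAt_id t).mul_const w).const_add v).const_sub u
    refine (h2.fun_pow 2).congr_deriv ?_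
    simp
  have := h1.hasDerivAt_eq_zero ((hd _ _ _).fun_add (hd _ _ _))
  simp only [dot, PiLp.sub_apply, PiLp.add_apply, PiLp.smul_apply, smul_eq_mul]
  linarith

/-! ### Networks of segments -/

/-- A straight-line drawing with vertices `W` and oriented edges `E`: edges are nondegenerate and
meet only in vertices. Every vertex is the tail of at most one edge and the head of at most
one. -/
structure Network (W : Finset Plane) (E : Finset (Plane × Plane)) : Prop where
  tail_mem : ∀ e ∈ E, e.1 ∈ W
  head_mem : ∀ e ∈ E, e.2 ∈ W
  ne : ∀ e ∈ E, e.1 ≠ e.2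
  avoid : ∀ e ∈ E, ∀ w ∈ W, w ∉ openSegment ℝ e.1 e.2
  disjoint : ∀ e ∈ E, ∀ e' ∈ E, ∀ x, x ∈ openSegment ℝ e.1 e.2 → x ∈ openSegment ℝ e'.1 e'.2 →
    e = e'
  tail_inj : ∀ e ∈ E, ∀ e' ∈ E, e.1 = e'.1 → e = e'
  head_inj : ∀ e ∈ E, ∀ e' ∈ E, e.2 = e'.2 → e = e'

/-- The point set of a network. -/
def netSupport (W : Finset Plane) (E : Finset (Plane × Plane)) : Set Plane :=
  {x | x ∈ W ∨ ∃ e ∈ E, x ∈ openSegment ℝ e.1 e.2}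

/-- The edges of a network in both orientations. -/
noncomputable def darts (E : Finset (Plane × Plane)) : Finset (Plane × Plane) :=
  open Classical in E ∪ E.image Prod.swap

lemma mem_darts {E : Finset (Plane × Plane)} {e : Plane × Plane} :
    e ∈ darts E ↔ e ∈ E ∨ e.swap ∈ E := by
  classical
  simp only [darts, Finset.mem_union, Finset.mem_image]
  constructor
  · rintro (h | ⟨f, hf, rfl⟩)
    · exact Or.inl h
    · right; simpa using hf
  · rintro (h | h)
    · exact Or.inl h
    · exact Or.inr ⟨_, h, Prod.swap_swap e⟩

lemma card_darts_le (E : Finset (Plane × Plane)) : (darts E).card ≤ 2 * E.card := by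
  classical
  have h1 := Finset.card_union_le E (E.image Prod.swap)
  have h2 := Finset.card_image_le (s := E) (f := Prod.swap)
  rw [darts]
  omega

namespace Network

variable {W : Finset Plane} {E : Finset (Plane × Plane)}

lemma card_le (h : Network W E) : E.card ≤ W.card :=
  Finset.card_le_card_of_injOn Prod.fst (fun e he => h.tail_mem e he)
    fun e he f hf => h.tail_inj e he f hf

lemma dart_ne (h : Network W E) {e : Plane × Plane} (he : e ∈ darts E) : e.1 ≠ e.2 :=
  (mem_darts.1 he).elim (fun h' => h.ne e h') fun h' => (h.ne _ h').symm

lemma dart_fst (h : Network W E) {e : Plane × Plane} (he : e ∈ darts E) : e.1 ∈ W :=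
  (mem_darts.1 he).elim (fun h' => h.tail_mem e h') fun h' => h.head_mem _ h'

lemma dart_snd (h : Network W E) {e : Plane × Plane} (he : e ∈ darts E) : e.2 ∈ W :=
  (mem_darts.1 he).elim (fun h' => h.head_mem e h') fun h' => h.tail_mem _ h'

lemma dart_avoid (h : Network W E) {e : Plane × Plane} (he : e ∈ darts E) {w : Plane}
    (hw : w ∈ W) : w ∉ openSegment ℝ e.1 e.2 :=
  (mem_darts.1 he).elim (fun h' => h.avoid e h' w hw) fun h' => by
    rw [openSegment_symm]; exact h.avoid _ h' w hw

lemma dart_disjoint (h : Network W E) {e f : Plane × Plane} (he : e ∈ darts E) (hf : f ∈ darts E)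
    {x : Plane} (hx : x ∈ openSegment ℝ e.1 e.2) (hx' : x ∈ openSegment ℝ f.1 f.2) :
    e = f ∨ e = f.swap := by
  have hsw : ∀ {g : Plane × Plane}, x ∈ openSegment ℝ g.1 g.2 →
      x ∈ openSegment ℝ g.swap.1 g.swap.2 := fun hg => by
    rw [openSegment_symm] at hg; exact hg
  rcases mem_darts.1 he with h1 | h1 <;> rcases mem_darts.1 hf with h2 | h2
  · exact Or.inl (h.disjoint e h1 f h2 x hx hx')
  · exact Or.inr (h.disjoint e h1 _ h2 x hx (hsw hx'))
  · right; rw [← h.disjoint _ h1 f h2 x (hsw hx) hx', Prod.swap_swap]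
  · left; rw [← Prod.swap_swap e, h.disjoint _ h1 _ h2 x (hsw hx) (hsw hx'), Prod.swap_swap]

lemma openSegment_subset {e : Plane × Plane} (he : e ∈ darts E) :
    openSegment ℝ e.1 e.2 ⊆ netSupport W E := by
  intro x hx
  rcases mem_darts.1 he with h1 | h1
  · exact Or.inr ⟨e, h1, hx⟩
  · rw [openSegment_symm] at hx; exact Or.inr ⟨_, h1, hx⟩

lemma segment_subset (h : Network W E) {e : Plane × Plane} (he : e ∈ darts E) :
    segment ℝ e.1 e.2 ⊆ netSupport W E := by
  rw [← insert_endpoints_openSegment]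
  rintro x (rfl | rfl | hx)
  · exact Or.inl (h.dart_fst he)
  · exact Or.inl (h.dart_snd he)
  · exact openSegment_subset he hx

end Network

/-! ### The local shape of the boundary of a thickened network -/

section LocalShape

lemma unit_sq {N : Plane} (hN : ‖N‖ = 1) : N 0 ^ 2 + N 1 ^ 2 = 1 := by
  rw [← norm_sq_eq, hN, one_pow]

/-- Coordinates in the orthonormal frame `(rot N, N)`. -/
lemma frame_expand {N : Plane} (hN : ‖N‖ = 1) (v : Plane) :
    v = dot (rot N) v • rot N + dot N v • N := by
  have h := unit_sq hN
  refine plane_ext ?_ ?_ <;>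
    simp only [dot, PiLp.add_apply, PiLp.smul_apply, rot_zero, rot_one, smul_eq_mul]
  · linear_combination (-v 0) * h
  · linear_combination (-v 1) * h

lemma dist_sq_frame {N : Plane} (hN : ‖N‖ = 1) (y z : Plane) :
    dist y z ^ 2 = dot (rot N) (y - z) ^ 2 + dot N (y - z) ^ 2 := by
  have h := unit_sq hN
  rw [dist_sq]
  simp only [dot, PiLp.sub_apply, rot_zero, rot_one]
  linear_combination (-(y 0 - z 0) ^ 2 - (y 1 - z 1) ^ 2) * h

lemma dot_rot_self (u : Plane) : dot u (rot u) = 0 := by simp only [dot, rot_zero, rot_one]; ring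

lemma eventually_mem_openSegment {a b p : Plane} (hp : p ∈ openSegment ℝ a b) :
    ∀ᶠ s in 𝓝 (0 : ℝ), p + s • rot (normal a b) ∈ openSegment ℝ a b := by
  rw [mem_openSegment_iff] at hp
  obtain ⟨t, ht, rfl⟩ := hp
  have hc : ContinuousAt (fun s : ℝ => t + s * ‖b - a‖⁻¹) 0 := by fun_prop
  have : Ioo (0 : ℝ) 1 ∈ 𝓝 (t + 0 * ‖b - a‖⁻¹) := by
    rw [zero_mul, add_zero]; exact Ioo_mem_nhds ht.1 ht.2
  filter_upwards [hc.eventually this] with s hs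
  rw [mem_openSegment_iff]
  exact ⟨_, hs, by rw [rot_normal]; module⟩

lemma dot_normal_of_mem_segment {a b p q : Plane} (hp : p ∈ segment ℝ a b)
    (hq : q ∈ segment ℝ a b) : dot (normal a b) (q - p) = 0 := by
  have hb : dot (normal a b) b = dot (normal a b) a := by
    have := dot_normal a b
    rw [dot_sub] at this; linarith
  rw [dot_sub, dot_eq_of_mem_segment hp rfl hb, dot_eq_of_mem_segment hq rfl hb, sub_self]

lemma frontier_congr_nhds {L H : Set Plane} {x : Plane} (h : ∀ᶠ y in 𝓝 x, (y ∈ L ↔ y ∈ H)) :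
    ∀ᶠ y in 𝓝 x, (y ∈ frontier L ↔ y ∈ frontier H) := by
  filter_upwards [h.eventually_nhds] with y hy
  have h1 : y ∈ closure L ↔ y ∈ closure H := by
    rw [mem_closure_iff_frequently, mem_closure_iff_frequently, frequently_congr hy]
  have h2 : y ∈ interior L ↔ y ∈ interior H := by
    rw [mem_interior_iff_mem_nhds, mem_interior_iff_mem_nhds]
    exact eventually_congr hy
  rw [frontier, frontier, Set.mem_sdiff, Set.mem_sdiff, h1, h2]

lemma frontier_halfplane {ν : Plane} (hν : ν ≠ 0) (c : ℝ) :
    frontier {y : Plane | dot ν y ≤ c} = {y | dot ν y = c} := by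
  rw [(isClosed_le (continuous_dot ν) continuous_const).frontier_eq]
  ext y
  constructor
  · rintro ⟨h1, h2⟩
    refine le_antisymm h1 (not_lt.1 fun h => h2 ?_)
    exact interior_maximal (fun z (hz : dot ν z < c) => hz.le)
      (isOpen_lt (continuous_dot ν) continuous_const) h
  · intro h
    exact ⟨le_of_eq h, not_mem_interior_of_support hν fun z hz => le_of_le_of_eq hz
      (Eq.symm h)⟩

/-- Near its boundary, `L` is the closed `r`-neighbourhood of `S`, and this boundary is at
distance `r` from `S`. -/
structure IsThickening (S L : Set Plane) (r : ℝ) : Prop where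
  far : ∀ x ∈ frontier L, ∀ q ∈ S, r ≤ dist x q
  touch : ∀ x ∈ frontier L, ∃ q ∈ S, dist x q = r
  loc : ∀ x ∈ frontier L, ∀ᶠ y in 𝓝 x, (y ∈ L ↔ ∃ q ∈ S, dist y q ≤ r)

variable {W : Finset Plane} {E : Finset (Plane × Plane)} {L : Set Plane} {r : ℝ}

/-- A nearest point which is a vertex does not lie ahead of the vertex along an edge. -/
lemma dot_nonpos_of_nearest {a b x : Plane} (h : ∀ z ∈ openSegment ℝ a b, dist x a ≤ dist x z) :
    dot (b - a) (x - a) ≤ 0 := by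
  by_contra! hpos
  set c := dot (b - a) (x - a) with hc
  set n := dot (b - a) (b - a) with hn
  have hn0 : 0 ≤ n := by rw [hn, dot_self]; positivity
  -- a point on the edge just after `a`
  obtain ⟨t, ht0, ht1, htc⟩ : ∃ t : ℝ, 0 < t ∧ t < 1 ∧ t * n < c := by
    refine ⟨min (1 / 2) (c / (2 * (n + 1))), by positivity,
      (min_le_left _ _).trans_lt (by norm_num), ?_⟩
    calc _ ≤ c / (2 * (n + 1)) * n := by gcongr; exact min_le_right _ _
      _ < c := by rw [div_mul_eq_mul_div, div_lt_iff₀ (by positivity)]; nlinarith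
  have h1 := h _ (mem_openSegment_iff.2 ⟨t, ⟨ht0, ht1⟩, rfl⟩)
  rw [← pow_le_pow_iff_left₀ dist_nonneg dist_nonneg two_ne_zero, dist_sq, dist_sq] at h1
  simp only [dot, PiLp.sub_apply] at hc hn
  simp only [PiLp.sub_apply, PiLp.add_apply, PiLp.smul_apply, smul_eq_mul] at h1
  have h2 : 2 * t * c ≤ t * (t * n) := by rw [hc, hn]; linarith
  nlinarith

/-- Near a boundary point whose only nearest point is a vertex, and which is not on the
perpendicular to an edge at this vertex, the boundary is the circle about the vertex. -/
lemma IsThickening.frontier_of_vertex (hG : Network W E) (hL : IsThickening (netSupport W E) L r)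
    {x p : Plane} (hx : x ∈ frontier L) (hpW : p ∈ W) (hp : dist x p = r)
    (huniq : ∀ q ∈ netSupport W E, dist x q = r → q = p)
    (hperp : ∀ e ∈ darts E, e.1 = p → dot (e.2 - e.1) (x - p) ≠ 0) :
    ∀ᶠ y in 𝓝 x, (y ∈ frontier L ↔ dist y p = r) := by
  have hfar : ∀ q ∈ netSupport W E, q ≠ p → r < dist x q := fun q hq hne =>
    lt_of_le_of_ne (hL.far x hx q hq) fun h => hne (huniq q hq h.symm)
  -- `p` remains a nearest point of the network near `x`: of the vertices, of the edges at `p`, and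
  -- of the other edges
  have hW : ∀ᶠ y in 𝓝 x, ∀ w ∈ W, dist y p ≤ dist y w := by
    rw [Filter.eventually_all_finset]
    intro w hw
    by_cases h : w = p
    · rw [h]; simp
    · have := hfar w (Or.inl hw) h
      rw [← hp] at this
      have hc : Continuous fun y : Plane => dist y w - dist y p := by fun_prop
      filter_upwards [hc.continuousAt.eventually (lt_mem_nhds (sub_pos.2 this))] with y hy
      linarith
  have hdart : ∀ e ∈ darts E, e.1 = p → ∀ᶠ y in 𝓝 x, ∀ q ∈ segment ℝ e.1 e.2,
      dist y p ≤ dist y q := by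
    rintro ⟨a, b⟩ he (rfl : a = p)
    have h1 : dot (b - a) (x - a) < 0 := by
      refine lt_of_le_of_ne (dot_nonpos_of_nearest fun z hz => ?_) (hperp _ he rfl)
      rw [hp]; exact hL.far x hx z (Network.openSegment_subset he hz)
    have hc : Continuous fun y : Plane => dot (b - a) (y - a) :=
      (continuous_dot _).comp (by fun_prop)
    filter_upwards [hc.continuousAt.eventually (gt_mem_nhds h1)] with y hy q hq
    obtain ⟨t, ht, rfl⟩ := mem_segment_iff.1 hq
    rw [← pow_le_pow_iff_left₀ dist_nonneg dist_nonneg two_ne_zero, dist_sq, dist_sq]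
    simp only [dot, PiLp.sub_apply] at hy
    simp only [PiLp.sub_apply, PiLp.add_apply, PiLp.smul_apply, smul_eq_mul]
    nlinarith [mul_nonneg ht.1 (neg_nonneg.2 hy.le), sq_nonneg (t * (b 0 - a 0)),
      sq_nonneg (t * (b 1 - a 1))]
  have hE : ∀ᶠ y in 𝓝 x, ∀ e ∈ E, ∀ q ∈ segment ℝ e.1 e.2, dist y p ≤ dist y q := by
    rw [Filter.eventually_all_finset]
    intro e he
    by_cases h1 : e.1 = p
    · exact hdart e (mem_darts.2 (Or.inl he)) h1
    by_cases h2 : e.2 = p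
    · have := hdart e.swap (mem_darts.2 (Or.inr (by simpa using he))) h2
      simp only [Prod.fst_swap, Prod.snd_swap] at this
      rwa [segment_symm] at this
    have hps : p ∉ segment ℝ e.1 e.2 := by
      rw [← insert_endpoints_openSegment]
      rintro (h | h | h)
      · exact h1 h.symm
      · exact h2 h.symm
      · exact hG.avoid e he p hpW h
    have hcpt : IsCompact (segment ℝ e.1 e.2) := by
      rw [segment_eq_image']; exact isCompact_Icc.image (by fun_prop)
    refine hcpt.eventually_forall_of_forall_eventually fun q hq => ?_
    have h3 := hfar q (hG.segment_subset (mem_darts.2 (Or.inl he)) hq) fun h => hps (h ▸ hq)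
    rw [← hp] at h3
    have hc : Continuous fun z : Plane × Plane => dist z.1 z.2 - dist z.1 p := by fun_prop
    filter_upwards [hc.continuousAt.eventually (lt_mem_nhds (a := 0) (sub_pos.2 h3))] with z hz
    linarith
  have hloc : ∀ᶠ y in 𝓝 x, (y ∈ L ↔ y ∈ closedBall p r) := by
    filter_upwards [hL.loc x hx, hW, hE] with y h1 h2 h3
    rw [h1, mem_closedBall]
    constructor
    · rintro ⟨q, hq | ⟨e, he, hq⟩, hd⟩
      · exact (h2 q hq).trans hd
      · exact (h3 e he q (openSegment_subset_segment _ _ _ hq)).trans hd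
    · intro h
      exact ⟨p, Or.inl hpW, h⟩
  filter_upwards [frontier_congr_nhds hloc] with y hy
  rw [hy]
  by_cases hr : r = 0
  · subst hr
    rw [closedBall_zero, (finite_singleton p).isClosed.frontier_eq, interior_singleton]
    simp
  · rw [frontier_closedBall _ hr, mem_sphere]

/-- Near a boundary point whose only nearest point is in the interior of an edge, the boundary is
an offset of this edge. -/
lemma IsThickening.frontier_of_edge (hG : Network W E) (hL : IsThickening (netSupport W E) L r)
    (hr : 0 < r) {x p : Plane} {e : Plane × Plane} (hx : x ∈ frontier L) (he : e ∈ darts E)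
    (hpe : p ∈ openSegment ℝ e.1 e.2) (hp : x = p + r • normal e.1 e.2)
    (huniq : ∀ q ∈ netSupport W E, dist x q = r → q = p) :
    ∀ᶠ y in 𝓝 x, (y ∈ frontier L ↔ y ∈ (offset r e).carrier) := by
  have hN := norm_normal (hG.dart_ne he)
  have hpW : p ∉ W := fun h => hG.dart_avoid he h hpe
  have hps := openSegment_subset_segment ℝ _ _ hpe
  have hfar : ∀ q ∈ netSupport W E, q ≠ p → r < dist x q := fun q hq hne =>
    lt_of_le_of_ne (hL.far x hx q hq) fun h => hne (huniq q hq h.symm)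
  -- only the edge `e` matters near `x`
  have hW : ∀ᶠ y in 𝓝 x, ∀ w ∈ W, r < dist y w := by
    rw [Filter.eventually_all_finset]
    intro w hw
    have := hfar w (Or.inl hw) fun h => hpW (h ▸ hw)
    have hc : Continuous fun y : Plane => dist y w := by fun_prop
    exact hc.continuousAt.eventually (lt_mem_nhds this)
  have hE : ∀ᶠ y in 𝓝 x, ∀ f ∈ E, f ≠ e → f ≠ e.swap → ∀ q ∈ segment ℝ f.1 f.2,
      r < dist y q := by
    rw [Filter.eventually_all_finset]
    intro f hf
    by_cases h : f = e ∨ f = e.swap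
    · filter_upwards with y h1 h2
      exact (h.elim h1 h2).elim
    have hps : p ∉ segment ℝ f.1 f.2 := by
      rw [← insert_endpoints_openSegment]
      rintro (h' | h' | h')
      · exact hpW (h' ▸ hG.tail_mem f hf)
      · exact hpW (h' ▸ hG.head_mem f hf)
      · exact h (hG.dart_disjoint (mem_darts.2 (Or.inl hf)) he h' hpe)
    have hcpt : IsCompact (segment ℝ f.1 f.2) := by
      rw [segment_eq_image']; exact isCompact_Icc.image (by fun_prop)
    have : ∀ᶠ y in 𝓝 x, ∀ q ∈ segment ℝ f.1 f.2, r < dist y q := by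
      refine hcpt.eventually_forall_of_forall_eventually fun q hq => ?_
      have h3 := hfar q (hG.segment_subset (mem_darts.2 (Or.inl hf)) hq) fun h => hps (h ▸ hq)
      have hc : Continuous fun z : Plane × Plane => dist z.1 z.2 := by fun_prop
      exact hc.continuousAt.eventually (lt_mem_nhds h3)
    filter_upwards [this] with y hy _ _
    exact hy
  set N := normal e.1 e.2 with hNdef
  have hcs : Continuous fun y : Plane => dot (rot N) (y - p) :=
    (continuous_dot _).comp (by fun_prop)
  have hch : Continuous fun y : Plane => dot N (y - p) := (continuous_dot _).comp (by fun_prop)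
  have hxp : x - p = r • N := by rw [hp]; abel
  have hs0 : dot (rot N) (x - p) = 0 := by
    rw [hxp, dot_smul, dot_comm, dot_rot_self, mul_zero]
  have hh0 : dot N (x - p) = r := by
    rw [hxp, dot_smul, dot_self, hN]; ring
  have hfoot : ∀ᶠ y in 𝓝 x, p + dot (rot N) (y - p) • rot N ∈ openSegment ℝ e.1 e.2 :=
    hcs.continuousAt.eventually (hs0 ▸ eventually_mem_openSegment hpe)
  have hhpos : ∀ᶠ y in 𝓝 x, 0 < dot N (y - p) :=
    hch.continuousAt.eventually (lt_mem_nhds (show 0 < dot N (x - p) by rw [hh0]; exact hr))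
  have hfd : ∀ y : Plane, dist y (p + dot (rot N) (y - p) • rot N) ^ 2 = dot N (y - p) ^ 2 := by
    intro y
    have e1 : y - (p + dot (rot N) (y - p) • rot N) = dot N (y - p) • N := by
      rw [← sub_sub, sub_eq_iff_eq_add']
      exact frame_expand hN (y - p)
    rw [dist_eq_norm, e1, norm_smul, hN, mul_one, Real.norm_eq_abs, sq_abs]
  -- near `x`, the set `L` is a half-plane bounded by a parallel of the edge
  have hloc : ∀ᶠ y in 𝓝 x, (y ∈ L ↔ y ∈ {y : Plane | dot N y ≤ r + dot N p}) := by
    filter_upwards [hL.loc x hx, hW, hE, hfoot, hhpos] with y h1 h2 h3 h4 h5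
    rw [h1]
    rw [← sub_le_iff_le_add, ← dot_sub]
    constructor
    · rintro ⟨q, hq, hd⟩
      have hqe : q ∈ segment ℝ e.1 e.2 := by
        rcases hq with hq | ⟨f, hf, hq⟩
        · exact absurd hd (not_le.2 (h2 q hq))
        · have hq' := openSegment_subset_segment _ _ _ hq
          by_cases e1 : f = e
          · rwa [← e1]
          by_cases e2 : f = e.swap
          · rw [segment_symm, ← Prod.fst_swap, ← Prod.snd_swap (p := e), ← e2]; exact hq'
          exact absurd hd (not_le.2 (h3 f hf e1 e2 q hq'))
      have h6 : dot N (y - q) = dot N (y - p) := by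
        have := dot_normal_of_mem_segment hps hqe
        rw [← hNdef, dot_sub] at this
        rw [dot_sub, dot_sub]; linarith
      have h7 := dist_sq_frame hN y q
      rw [h6] at h7
      have h8 : dist y q ^ 2 ≤ r ^ 2 := by gcongr
      nlinarith [sq_nonneg (dot (rot N) (y - q))]
    · intro h
      refine ⟨_, Network.openSegment_subset he h4, ?_⟩
      rw [← pow_le_pow_iff_left₀ dist_nonneg hr.le two_ne_zero, hfd]
      gcongr
  filter_upwards [frontier_congr_nhds hloc, hfoot] with y hy hf
  rw [hy, frontier_halfplane (normal_ne_zero (hG.dart_ne he)), Set.mem_ofPred_eq, mem_offset,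
    ← sub_eq_iff_eq_add, ← dot_sub]
  constructor
  · intro h
    refine ⟨_, openSegment_subset_segment _ _ _ hf, ?_⟩
    have := frame_expand hN (y - p)
    rw [h] at this
    rw [add_assoc, ← hNdef, ← this]; abel
  · rintro ⟨q, hq, rfl⟩
    have := dot_normal_of_mem_segment hps hq
    rw [← hNdef] at this ⊢
    rw [add_sub_right_comm, dot_add, this, dot_smul, dot_self, hN]; ring

end LocalShape

/-! ### The outline of a thickened network -/

section OutlineOfEvents

lemma nonneg_of_hasDerivAt_of_right {f : ℝ → ℝ} {f' s ε : ℝ} (hf : HasDerivAt f f' s) (hε : 0 < ε)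
    (h : ∀ t ∈ Ioo s (s + ε), f s ≤ f t) : 0 ≤ f' := by
  have h1 := (hasDerivAt_iff_tendsto_slope.1 hf).mono_left
    (nhdsWithin_mono s fun t (ht : t ∈ Ioi s) => (ne_of_gt ht : t ≠ s))
  refine ge_of_tendsto h1 ?_
  filter_upwards [Ioo_mem_nhdsGT (show s < s + ε by linarith)] with t ht
  rw [slope_def_field]
  exact div_nonneg (sub_nonneg.2 (h t ht)) (sub_nonneg.2 ht.1.le)

/-- A curve starting at `z` that keeps at least its initial distance from `q` does not start
towards `q`. -/
lemma dot_nonneg_of_leaving {γ : ℝ → Plane} {v z q : Plane} {r s ε : ℝ} (hr : 0 ≤ r)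
    (h0 : HasDerivAt (fun t => γ t 0) (v 0) s) (h1 : HasDerivAt (fun t => γ t 1) (v 1) s)
    (hε : 0 < ε) (hz : γ s = z) (hq : dist z q = r) (h : ∀ t ∈ Ioo s (s + ε), r ≤ dist (γ t) q) :
    0 ≤ dot v (z - q) := by
  have hd : HasDerivAt (fun t => (γ t 0 - q 0) ^ 2 + (γ t 1 - q 1) ^ 2) (2 * dot v (z - q)) s := by
    refine (((h0.sub_const (q 0)).fun_pow 2).fun_add
      ((h1.sub_const (q 1)).fun_pow 2)).congr_deriv ?_
    simp only [hz, dot, PiLp.sub_apply]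
    ring
  have := nonneg_of_hasDerivAt_of_right hd hε fun t ht => by
    rw [← dist_sq, ← dist_sq, hz, hq]
    have := h t ht
    gcongr
  linarith

lemma hasDerivAt_path_seg (a b : Plane) (i : Fin 2) (s : ℝ) :
    HasDerivAt (fun t => (seg a b).path t i) ((b - a) i) s := by
  have : (fun t => (seg a b).path t i) = fun t => a i + t * (b - a) i := by
    ext t
    simp only [path, AffineMap.lineMap_apply_module', PiLp.add_apply, PiLp.smul_apply, smul_eq_mul]
    ring
  rw [this]
  simpa using ((hasDerivAt_id s).mul_const ((b - a) i)).const_add (a i)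

lemma hasDerivAt_path_circ (c : Plane) (r s : ℝ) :
    HasDerivAt (fun t => (circ c r).path t 0) (2 * Real.pi * rot ((circ c r).path s - c) 0) s ∧
    HasDerivAt (fun t => (circ c r).path t 1) (2 * Real.pi * rot ((circ c r).path s - c) 1) s := by
  have hl : HasDerivAt (fun t : ℝ => 2 * Real.pi * t) (2 * Real.pi) s := by
    simpa using (hasDerivAt_id s).const_mul (2 * Real.pi)
  constructor
  · simp only [path, circlePoint_zero, rot_zero, PiLp.sub_apply, circlePoint_one]
    refine ((hl.cos.const_mul r).const_add (c 0)).congr_deriv ?_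
    ring
  · simp only [path, circlePoint_one, rot_one, PiLp.sub_apply, circlePoint_zero]
    refine ((hl.sin.const_mul r).const_add (c 1)).congr_deriv ?_
    ring

/-- The curves outlining a network thickened by `r`: circles around its vertices and offsets of
its edges to both sides. -/
noncomputable def offsetCurves (W : Finset Plane) (E : Finset (Plane × Plane)) (r : ℝ) :
    Finset Curve :=
  open Classical in W.image (fun w => circ w r) ∪ (darts E).image (offset r)

lemma mem_offsetCurves {W : Finset Plane} {E : Finset (Plane × Plane)} {r : ℝ} {c : Curve} :
    c ∈ offsetCurves W E r ↔ (∃ w ∈ W, circ w r = c) ∨ ∃ e ∈ darts E, offset r e = c := by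
  classical
  simp [offsetCurves]

lemma card_offsetCurves_le (W : Finset Plane) (E : Finset (Plane × Plane)) (r : ℝ) :
    (offsetCurves W E r).card ≤ W.card + 2 * E.card := by
  classical
  have h1 := Finset.card_union_le (W.image (fun w => circ w r)) ((darts E).image (offset r))
  have h2 := Finset.card_image_le (s := W) (f := fun w => circ w r)
  have h3 := Finset.card_image_le (s := darts E) (f := offset r)
  have h4 := card_darts_le E
  rw [offsetCurves]
  omega

variable {W : Finset Plane} {E : Finset (Plane × Plane)} {L : Set Plane} {r : ℝ}

lemma eventually_mem_openSegment_right {a b p : Plane} (hab : a ≠ b) (hp : p ∈ segment ℝ a b)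
    (hpb : p ≠ b) : ∀ᶠ s in 𝓝[>] (0 : ℝ), p + s • rot (normal a b) ∈ openSegment ℝ a b := by
  obtain ⟨t, ht, rfl⟩ := mem_segment_iff.1 hp
  have ht1 : t < 1 := lt_of_le_of_ne ht.2 fun h => hpb (by rw [h]; module)
  have hd : 0 < ‖b - a‖ := norm_pos_iff.2 (sub_ne_zero.2 hab.symm)
  have hc : ContinuousAt (fun s : ℝ => t + s * ‖b - a‖⁻¹) 0 := by fun_prop
  have : ∀ᶠ s in 𝓝 (0 : ℝ), t + s * ‖b - a‖⁻¹ < 1 :=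
    hc.eventually (gt_mem_nhds (by simpa using ht1))
  filter_upwards [this.filter_mono nhdsWithin_le_nhds, self_mem_nhdsWithin] with s hs hs0
  rw [mem_openSegment_iff]
  refine ⟨_, ⟨?_, hs⟩, by rw [rot_normal]; module⟩
  have : (0 : ℝ) < s := hs0
  have : 0 < s * ‖b - a‖⁻¹ := by positivity
  linarith [ht.1]

lemma normal_swap_ne {a b : Plane} (hab : a ≠ b) : normal b a ≠ normal a b := by
  intro h
  have h1 : (2 : ℝ) • normal a b = 0 := by
    rw [two_smul]
    nth_rewrite 1 [← h]
    rw [normal_swap, neg_add_cancel]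
  exact normal_ne_zero hab ((smul_eq_zero.1 h1).resolve_left two_ne_zero)

/-- A curve leaving `z` along the boundary of a thickened network turns counterclockwise about a
nearest point `p` of the network, and it does not turn towards other nearest points. -/
lemma exists_site_of_germ (hG : Network W E) (hL : IsThickening (netSupport W E) L r) (hr : 0 < r)
    {z : Plane} {c : Curve} (hc : c ∈ offsetCurves W E r) (hg : c.Germ (frontier L) z) :
    ∃ p ∈ netSupport W E, dist z p = r ∧
      (∀ q ∈ netSupport W E, dist z q = r → 0 ≤ dot (rot (z - p)) (z - q)) ∧
      (c = circ p r ∨ ∃ e ∈ darts E, c = offset r e ∧ z = p + r • normal e.1 e.2 ∧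
        p ∈ segment ℝ e.1 e.2 ∧ p ≠ e.2) := by
  obtain ⟨s, hs, hz, ε, hε, hg⟩ := hg
  have hfar : ∀ q ∈ netSupport W E, ∀ t ∈ Ioo s (s + ε), r ≤ dist (c.path t) q :=
    fun q hq t ht => hL.far _ (hg t ht) q hq
  rcases mem_offsetCurves.1 hc with ⟨w, hw, rfl⟩ | ⟨e, he, rfl⟩
  · refine ⟨w, Or.inl hw, ?_, fun q hq hzq => ?_, Or.inl rfl⟩
    · have : (circ w r).path s ∈ (circ w r).carrier :=
        path_mem_carrier (c := circ w r) hr ⟨hs.1, hs.2.le⟩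
      rw [hz] at this
      exact this
    · have hd := hasDerivAt_path_circ w r s
      have := dot_nonneg_of_leaving (v := (2 * Real.pi) • rot (z - w)) hr.le
        (by simpa [hz] using hd.1) (by simpa [hz] using hd.2) hε hz hzq (hfar q hq)
      rw [dot_comm, dot_smul, dot_comm] at this
      exact nonneg_of_mul_nonneg_right this (by positivity)
  · have hne := hG.dart_ne he
    have hzp : z = e.1 + s • (e.2 - e.1) + r • normal e.1 e.2 := by
      rw [← hz, offset, path, AffineMap.lineMap_apply_module']; module
    have hps : e.1 + s • (e.2 - e.1) ∈ segment ℝ e.1 e.2 :=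
      mem_segment_iff.2 ⟨s, ⟨hs.1, hs.2.le⟩, rfl⟩
    have hzsub : z - (e.1 + s • (e.2 - e.1)) = r • normal e.1 e.2 := by rw [hzp]; abel
    refine ⟨_, hG.segment_subset he hps, ?_, fun q hq hzq => ?_, Or.inr ⟨e, he, rfl, hzp, hps, ?_⟩⟩
    · rw [dist_eq_norm, hzsub, norm_smul, norm_normal hne, mul_one, Real.norm_eq_abs,
        abs_of_pos hr]
    · have := dot_nonneg_of_leaving hr.le (hasDerivAt_path_seg _ _ 0 s)
        (hasDerivAt_path_seg _ _ 1 s) hε hz hzq (hfar q hq)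
      rw [add_sub_add_right_eq_sub, sub_eq_norm_smul_rot_normal hne, dot_comm, dot_smul,
        dot_comm] at this
      rw [hzsub, rot_smul, dot_comm, dot_smul, dot_comm]
      have h2 := nonneg_of_mul_nonneg_right this (norm_pos_iff.2 (sub_ne_zero.2 hne.symm))
      positivity
    · intro h
      have h2 : (1 - s) • (e.2 - e.1) = 0 := by
        rw [sub_smul, one_smul, sub_eq_zero, eq_comm, ← add_right_inj e.1, h]; abel
      rcases smul_eq_zero.1 h2 with h3 | h3
      · linarith [hs.2]
      · exact hne (sub_eq_zero.1 h3).symm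

/-- Vectors of the same length, each not to the right of the other, are equal or opposite. -/
lemma eq_or_eq_neg_of_dot_rot {u v : Plane} (huv : ‖u‖ = ‖v‖) (h1 : 0 ≤ dot (rot u) v)
    (h2 : 0 ≤ dot (rot v) u) : v = u ∨ v = -u := by
  have h0 : dot (rot v) u = -dot (rot u) v := by simp only [dot, rot_zero, rot_one]; ring
  have h3 : dot (rot u) v = 0 := by linarith
  have hsq : u 0 ^ 2 + u 1 ^ 2 = v 0 ^ 2 + v 1 ^ 2 := by rw [← norm_sq_eq, ← norm_sq_eq, huv]
  simp only [dot, rot_zero, rot_one] at h3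
  have h4 : (dot u v - (u 0 ^ 2 + u 1 ^ 2)) * (dot u v + (u 0 ^ 2 + u 1 ^ 2)) = 0 := by
    simp only [dot]
    linear_combination (-(u 0 ^ 2 + u 1 ^ 2)) * hsq - (-u 1 * v 0 + u 0 * v 1) * h3
  rcases mul_eq_zero.1 h4 with h | h <;> simp only [dot] at h
  · left
    have h5 : (v 0 - u 0) ^ 2 + (v 1 - u 1) ^ 2 = 0 := by linear_combination -hsq - 2 * h
    exact plane_ext (by nlinarith) (by nlinarith)
  · right
    have h5 : (v 0 + u 0) ^ 2 + (v 1 + u 1) ^ 2 = 0 := by linear_combination -hsq + 2 * h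
    exact plane_ext (by simp only [PiLp.neg_apply]; nlinarith)
      (by simp only [PiLp.neg_apply]; nlinarith)

/-- At most four curves leave a point along the boundary of a thickened network: those turning
about the same nearest point are its circle and one offset curve, and only two opposite nearest
points are possible. -/
lemma card_germs_le (hG : Network W E) (hL : IsThickening (netSupport W E) L r) (hr : 0 < r)
    (z : Plane) (J : Finset Curve) (hJ : J ⊆ offsetCurves W E r)
    (hg : ∀ c ∈ J, c.Germ (frontier L) z) : J.card ≤ 4 := by
  classical
  rcases J.eq_empty_or_nonempty with rfl | ⟨c₀, h₀⟩
  · simp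
  obtain ⟨p₀, hp₀, hz₀, ht₀, -⟩ := exists_site_of_germ hG hL hr (hJ h₀) (hg c₀ h₀)
  -- the offset curves leaving `z` whose edge touches the circle about `z` in `p`
  let D (p : Plane) := J.filter fun c => ∃ e ∈ darts E, c = offset r e ∧
    z = p + r • normal e.1 e.2 ∧ p ∈ segment ℝ e.1 e.2 ∧ p ≠ e.2
  have hD : ∀ p, (D p).card ≤ 1 := by
    intro p
    refine Finset.card_le_one.2 fun c hc c' hc' => ?_
    obtain ⟨-, e, he, rfl, h1, h2, h3⟩ := Finset.mem_filter.1 hc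
    obtain ⟨-, f, hf, rfl, h1', h2', h3'⟩ := Finset.mem_filter.1 hc'
    have hN : normal e.1 e.2 = normal f.1 f.2 := by
      rw [h1] at h1'
      exact smul_right_injective _ hr.ne' (add_left_cancel h1')
    obtain ⟨s, hs, hs'⟩ := ((eventually_mem_openSegment_right (hG.dart_ne he) h2 h3).and
      (eventually_mem_openSegment_right (hG.dart_ne hf) h2' h3')).exists
    rw [← hN] at hs'
    rcases hG.dart_disjoint he hf hs hs' with rfl | rfl
    · rfl
    · exact (normal_swap_ne (hG.dart_ne hf) hN).elim
  have hsub : J ⊆ ({circ p₀ r, circ (z + (z - p₀)) r} ∪ D p₀) ∪ D (z + (z - p₀)) := by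
    intro c hc
    obtain ⟨p, hp, hz, ht, hcase⟩ := exists_site_of_germ hG hL hr (hJ hc) (hg c hc)
    have hpp : p = p₀ ∨ p = z + (z - p₀) := by
      rcases eq_or_eq_neg_of_dot_rot (u := z - p₀) (v := z - p)
        (by rw [← dist_eq_norm, ← dist_eq_norm, hz, hz₀]) (ht₀ p hp hz) (ht p₀ hp₀ hz₀) with h | h
      · left; exact sub_right_injective h
      · right
        rw [← neg_eq_iff_eq_neg, neg_sub] at h
        rw [← h]; abel
    simp only [Finset.mem_union, Finset.mem_insert, Finset.mem_singleton, D, Finset.mem_filter, hc,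
      true_and]
    rcases hpp with rfl | rfl <;> rcases hcase with h | h
    · exact Or.inl (Or.inl (Or.inl h))
    · exact Or.inl (Or.inr h)
    · exact Or.inl (Or.inl (Or.inr h))
    · exact Or.inr h
  have h1 := Finset.card_le_card hsub
  have h2 := Finset.card_union_le ({circ p₀ r, circ (z + (z - p₀)) r} ∪ D p₀) (D (z + (z - p₀)))
  have h3 := Finset.card_union_le {circ p₀ r, circ (z + (z - p₀)) r} (D p₀)
  have h4 := Finset.card_le_two (a := circ p₀ r) (b := circ (z + (z - p₀)) r)
  have h5 := hD p₀
  have h6 := hD (z + (z - p₀))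
  omega

/-- Once the points with several nearest points of the network are counted, the boundary of a
thickened network has an outline. -/
theorem exists_outline_of_events (hG : Network W E) (hL : IsThickening (netSupport W E) L r)
    (hr : 0 < r) (T : Finset Plane) (hT : ∀ x ∈ frontier L, x ∉ T → ∀ p ∈ netSupport W E,
      ∀ q ∈ netSupport W E, dist x p = r → dist x q = r → p = q) :
    ∃ (C : Finset Curve) (Z : Finset Plane), Outline (frontier L) C Z r 4 ∧
      C.card ≤ W.card + 2 * E.card ∧ Z.card ≤ T.card + W.card + 4 * E.card := by
  classical
  let C := offsetCurves W E r
  -- the exceptional points: those with several nearest points, and the ends of all curves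
  let Z : Finset Plane := ((T ∪ W.image fun w => (circ w r).path 0) ∪
    (darts E).image fun e => (offset r e).path 0) ∪ (darts E).image fun e => (offset r e).path 1
  have p0 : ∀ e, (offset r e).path 0 = e.1 + r • normal e.1 e.2 := fun e => by
    simp [offset, path]
  have p1 : ∀ e, (offset r e).path 1 = e.2 + r • normal e.1 e.2 := fun e => by
    simp [offset, path]
  have hZ : ∀ x, x ∉ Z → x ∉ T ∧ ∀ e ∈ darts E, x ≠ e.1 + r • normal e.1 e.2 ∧
      x ≠ e.2 + r • normal e.1 e.2 := by
    intro x hx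
    simp only [Z, Finset.mem_union, Finset.mem_image, not_or, not_exists, not_and] at hx
    exact ⟨hx.1.1.1, fun e he => ⟨fun h => hx.1.2 e he (by rw [p0, h]),
      fun h => hx.2 e he (by rw [p1, h])⟩⟩
  -- the nearest point that is responsible for a curve at a point of the boundary
  have hsite : ∀ x ∈ frontier L, x ∉ Z → ∀ c ∈ C, x ∈ c.carrier →
      ∃ p ∈ netSupport W E, dist x p = r ∧ ((p ∈ W ∧ c = circ p r) ∨
        ∃ e ∈ darts E, c = offset r e ∧ p ∈ openSegment ℝ e.1 e.2 ∧
          x = p + r • normal e.1 e.2) := by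
    intro x hx hxZ c hc hxc
    rcases mem_offsetCurves.1 hc with ⟨w, hw, rfl⟩ | ⟨e, he, rfl⟩
    · exact ⟨w, Or.inl hw, hxc, Or.inl ⟨hw, rfl⟩⟩
    · obtain ⟨p, hp, hxp⟩ := mem_offset.1 hxc
      refine ⟨p, hG.segment_subset he hp, ?_, Or.inr ⟨e, he, rfl, ?_, hxp⟩⟩
      · rw [dist_eq_norm, hxp, add_sub_cancel_left, norm_smul, norm_normal (hG.dart_ne he), mul_one,
          Real.norm_eq_abs, abs_of_pos hr]
      · rw [← insert_endpoints_openSegment] at hp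
        have := (hZ x hxZ).2 e he
        rcases hp with rfl | rfl | hp
        · exact (this.1 hxp).elim
        · exact (this.2 hxp).elim
        · exact hp
  refine ⟨C, Z, ⟨?_, ?_, ?_, ?_, ?_, ?_, ?_⟩, card_offsetCurves_le W E r, ?_⟩
  · intro c hc
    rcases mem_offsetCurves.1 hc with ⟨w, hw, rfl⟩ | ⟨e, he, rfl⟩
    · exact hr
    · exact fun h => hG.dart_ne he (add_right_cancel h)
  · intro v s hc
    rcases mem_offsetCurves.1 hc with ⟨w, hw, h⟩ | ⟨e, he, h⟩
    · cases h; rfl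
    · cases h
  · intro v hc x hx
    rcases mem_offsetCurves.1 hc with ⟨w, hw, h⟩ | ⟨e, he, h⟩
    · cases h; exact hL.far x hx v (Or.inl hw)
    · cases h
  · intro c hc
    simp only [Z, Finset.mem_union, Finset.mem_image]
    rcases mem_offsetCurves.1 hc with ⟨w, hw, rfl⟩ | ⟨e, he, rfl⟩
    · have : (circ w r).path 1 = (circ w r).path 0 := by
        simp [path, circlePoint]
      exact ⟨fun _ => Or.inl (Or.inl (Or.inr ⟨w, hw, rfl⟩)),
        fun _ => Or.inl (Or.inl (Or.inr ⟨w, hw, this.symm⟩))⟩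
    · exact ⟨fun _ => Or.inl (Or.inr ⟨e, he, rfl⟩), fun _ => Or.inr ⟨e, he, rfl⟩⟩
  · intro x hx hxZ
    obtain ⟨p, hp, hxp⟩ := hL.touch x hx
    obtain ⟨hxT, hxE⟩ := hZ x hxZ
    have huniq : ∀ q ∈ netSupport W E, dist x q = r → q = p := fun q hq h =>
      hT x hx hxT q hq p hp h hxp
    have hnorm : ‖x - p‖ = r := by rw [← dist_eq_norm, hxp]
    rcases hp with hpW | ⟨e, he, hpe⟩
    · refine ⟨circ p r, mem_offsetCurves.2 (Or.inl ⟨p, hpW, rfl⟩), hxp,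
        hL.frontier_of_vertex hG hx hpW hxp huniq ?_⟩
      -- on the perpendicular at an end of an edge, `x` would be an end of an offset curve
      rintro e he rfl h0
      rcases eq_normal_or (hG.dart_ne he) h0 hnorm with h | h
      · exact (hxE e he).1 (by rw [← h]; abel)
      · have hsw : e.swap ∈ darts E := mem_darts.2 (by
          rw [Prod.swap_swap]; exact (mem_darts.1 he).symm)
        exact (hxE e.swap hsw).2 (by
          rw [Prod.fst_swap, Prod.snd_swap, ← h]; abel)
    · have h0 := dot_eq_zero_of_nearest hpe fun z hz => by
        rw [hxp]; exact hL.far x hx z (Or.inr ⟨e, he, hz⟩)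
      have key : ∀ f ∈ darts E, p ∈ openSegment ℝ f.1 f.2 → x - p = r • normal f.1 f.2 →
          ∃ c ∈ C, x ∈ c.carrier ∧ ∀ᶠ y in 𝓝 x, (y ∈ frontier L ↔ y ∈ c.carrier) := by
        intro f hf hpf hxf
        have hx' : x = p + r • normal f.1 f.2 := by rw [← hxf]; abel
        refine ⟨offset r f, mem_offsetCurves.2 (Or.inr ⟨f, hf, rfl⟩),
          mem_offset.2 ⟨p, openSegment_subset_segment _ _ _ hpf, hx'⟩,
          hL.frontier_of_edge hG hr hx hf hpf hx' huniq⟩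
      rcases eq_normal_or (hG.ne e he) h0 hnorm with h | h
      · exact key e (mem_darts.2 (Or.inl he)) hpe h
      · exact key e.swap (mem_darts.2 (Or.inr (by simpa using he)))
          (by rw [openSegment_symm] at hpe; exact hpe) h
  · intro x hx hxZ c hc c' hc' hxc hxc'
    obtain ⟨p, hp, hxp, h⟩ := hsite x hx hxZ c hc hxc
    obtain ⟨q, hq, hxq, h'⟩ := hsite x hx hxZ c' hc' hxc'
    obtain rfl := hT x hx (hZ x hxZ).1 p hp q hq hxp hxq
    rcases h with ⟨hW, rfl⟩ | ⟨e, he, rfl, hpe, hx1⟩ <;>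
      rcases h' with ⟨hW', rfl⟩ | ⟨f, hf, rfl, hpf, hx2⟩
    · rfl
    · exact (hG.dart_avoid hf hW hpf).elim
    · exact (hG.dart_avoid he hW' hpe).elim
    · rcases hG.dart_disjoint he hf hpe hpf with rfl | rfl
      · rfl
      · exfalso
        rw [hx2, add_right_inj] at hx1
        exact normal_swap_ne (hG.dart_ne hf) (smul_right_injective _ hr.ne' hx1).symm
  · exact fun z J hJ hg => card_germs_le hG hL hr z J hJ hg
  · have h1 := Finset.card_union_le ((T ∪ W.image fun w => (circ w r).path 0) ∪
      (darts E).image fun e => (offset r e).path 0) ((darts E).image fun e => (offset r e).path 1)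
    have h2 := Finset.card_union_le (T ∪ W.image fun w => (circ w r).path 0)
      ((darts E).image fun e => (offset r e).path 0)
    have h3 := Finset.card_union_le T (W.image fun w => (circ w r).path 0)
    have h4 := Finset.card_image_le (s := W) (f := fun w => (circ w r).path 0)
    have h5 := Finset.card_image_le (s := darts E) (f := fun e => (offset r e).path 0)
    have h6 := Finset.card_image_le (s := darts E) (f := fun e => (offset r e).path 1)
    have h7 := card_darts_le E
    simp only [Z]
    omega

end OutlineOfEvents

/-! ### Points equally near to two edges -/

section EdgeEdge

variable {W : Finset Plane} {E : Finset (Plane × Plane)} {L : Set Plane} {r : ℝ}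

lemma swap_mem_darts {e : Plane × Plane} (he : e ∈ darts E) : e.swap ∈ darts E :=
  mem_darts.2 (by rw [Prod.swap_swap]; exact (mem_darts.1 he).symm)

/-- Edges are parametrized by arc length. -/
lemma mem_openSegment_iff_dir {a b z : Plane} (hab : a ≠ b) :
    z ∈ openSegment ℝ a b ↔ ∃ t, 0 < t ∧ t < ‖b - a‖ ∧ z = a + t • rot (normal a b) := by
  have hd : 0 < ‖b - a‖ := norm_pos_iff.2 (sub_ne_zero.2 hab.symm)
  rw [mem_openSegment_iff]
  constructor
  · rintro ⟨t, ht, rfl⟩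
    refine ⟨t * ‖b - a‖, mul_pos ht.1 hd, by nlinarith [ht.2], ?_⟩
    rw [rot_normal, smul_smul, mul_assoc, mul_inv_cancel₀ hd.ne', mul_one]
  · rintro ⟨t, h0, h1, rfl⟩
    refine ⟨t * ‖b - a‖⁻¹, ⟨by positivity, ?_⟩, by rw [rot_normal, smul_smul]⟩
    rw [← div_eq_mul_inv, div_lt_one hd]; exact h1

/-- A nearest point in the interior of an edge is the foot of the perpendicular, on the right of
the suitably oriented edge. -/
lemma IsThickening.exists_dart (hG : Network W E) (hL : IsThickening (netSupport W E) L r)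
    {x p : Plane} {e : Plane × Plane} (hx : x ∈ frontier L) (he : e ∈ E)
    (hpe : p ∈ openSegment ℝ e.1 e.2) (hp : dist x p = r) :
    ∃ f ∈ darts E, (f = e ∨ f = e.swap) ∧ p ∈ openSegment ℝ f.1 f.2 ∧
      x = p + r • normal f.1 f.2 := by
  have h0 := dot_eq_zero_of_nearest hpe fun z hz => by
    rw [hp]; exact hL.far x hx z (Or.inr ⟨e, he, hz⟩)
  rcases eq_normal_or (hG.ne e he) h0 (by rw [← dist_eq_norm, hp]) with h | h
  · exact ⟨e, mem_darts.2 (Or.inl he), Or.inl rfl, hpe, by rw [← h]; abel⟩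
  · refine ⟨e.swap, mem_darts.2 (Or.inr (by simpa using he)), Or.inr rfl, ?_, ?_⟩
    · rw [openSegment_symm] at hpe; exact hpe
    · rw [Prod.fst_swap, Prod.snd_swap, ← h]; abel

/-- A boundary point of the thickening does not lie midway between two parallel edges at distance
`r` from it. -/
lemma IsThickening.not_antiparallel (hL : IsThickening (netSupport W E) L r) (hr : 0 < r)
    (hG : Network W E) {x p q : Plane} {e f : Plane × Plane} (hx : x ∈ frontier L)
    (he : e ∈ darts E) (hf : f ∈ darts E)
    (hp : p ∈ openSegment ℝ e.1 e.2) (hq : q ∈ openSegment ℝ f.1 f.2)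
    (hxp : x = p + r • normal e.1 e.2) (hxq : x = q + r • normal f.1 f.2) :
    normal f.1 f.2 ≠ -normal e.1 e.2 := by
  intro hN
  rw [hN] at hxq
  have h1 := norm_normal (hG.dart_ne he)
  have hfe := eventually_mem_openSegment hp
  have hff := eventually_mem_openSegment hq
  rw [hN] at hff
  set N := normal e.1 e.2
  have hcs : Continuous fun y : Plane => dot (rot N) (y - x) :=
    (continuous_dot _).comp (by fun_prop)
  have hcs' : Continuous fun y : Plane => -dot (rot N) (y - x) := hcs.neg
  have hch : Continuous fun y : Plane => dot N (y - x) := (continuous_dot _).comp (by fun_prop)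
  have z1 : dot (rot N) (x - x) = 0 := by simp [dot]
  have z2 : dot N (x - x) = 0 := by simp [dot]
  -- all points near `x` are at distance at most `r` from one of the two edges
  refine hx.2 (mem_interior_iff_mem_nhds.2 ?_)
  filter_upwards [hL.loc x hx,
    hcs.continuousAt.eventually (show ∀ᶠ s in 𝓝 (dot (rot N) (x - x)), _ by rw [z1]; exact hfe),
    hcs'.continuousAt.eventually (show ∀ᶠ s in 𝓝 (-dot (rot N) (x - x)), _ by
      rw [z1, neg_zero]; exact hff),
    hch.continuousAt.eventually (show ∀ᶠ s in 𝓝 (dot N (x - x)), s ∈ Ioo (-r) r by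
      rw [z2]; exact Ioo_mem_nhds (by linarith) hr)] with y hy hy1 hy2 hy3
  refine hy.2 ?_
  have hexp := frame_expand h1 (y - x)
  set s := dot (rot N) (y - x)
  set h := dot N (y - x)
  rcases le_total h 0 with hh | hh
  · refine ⟨_, Network.openSegment_subset he hy1, ?_⟩
    have : y - (p + s • rot N) = (r + h) • N := by
      calc y - (p + s • rot N) = (y - x) + (x - p) - s • rot N := by abel
        _ = (r + h) • N := by rw [hexp, hxp]; module
    rw [dist_eq_norm, this, norm_smul, h1, mul_one, Real.norm_eq_abs, abs_le]
    constructor <;> linarith [hy3.1]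
  · refine ⟨_, Network.openSegment_subset hf hy2, ?_⟩
    have : y - (q + (-s) • rot (-N)) = (h - r) • N := by
      calc y - (q + (-s) • rot (-N)) = (y - x) + (x - q) - s • rot N := by
            rw [rot_neg]; module
        _ = (h - r) • N := by rw [hexp, hxq]; module
    rw [dist_eq_norm, this, norm_smul, h1, mul_one, Real.norm_eq_abs, abs_le]
    constructor <;> linarith [hy3.2]

/-- Let `x` be equally near to two edges. Their lines meet in an apex. Of the two edges, take one
(`e`) whose end towards the apex, its tail, is not nearer to the apex than that of the other
(`f`); as the edges do not cross, this tail has not passed the apex. Here `c` and `s` are the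
cosine and sine of the angle between the normals `n`, `n'` towards `x`, and `r * (1 - c) / s` is
the distance of the apex from both nearest points. -/
lemma exists_charge (hG : Network W E) (hL : IsThickening (netSupport W E) L r) (hr : 0 < r)
    {x p q : Plane} (hx : x ∈ frontier L) (hp : ∃ e ∈ E, p ∈ openSegment ℝ e.1 e.2)
    (hq : ∃ e ∈ E, q ∈ openSegment ℝ e.1 e.2) (hxp : dist x p = r) (hxq : dist x q = r)
    (hpq : p ≠ q) :
    ∃ e ∈ darts E, ∃ f ∈ darts E, ∃ n : Plane, ∃ c s t t' : ℝ,
      (n = normal e.1 e.2 ∨ n = -normal e.1 e.2) ∧ 0 < s ∧ c ^ 2 + s ^ 2 = 1 ∧ 0 < t ∧ t ≤ t' ∧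
      t' < ‖f.2 - f.1‖ ∧ t * s ≤ r * (1 - c) ∧ x = e.1 + t • rot (normal e.1 e.2) + r • n ∧
      rot (normal f.1 f.2) = (-c) • rot (normal e.1 e.2) + s • n ∧
      x = f.1 + t' • rot (normal f.1 f.2) + r • (c • n + s • rot (normal e.1 e.2)) := by
  obtain ⟨e₀, he₀, hpe₀⟩ := hp
  obtain ⟨f₀, hf₀, hqf₀⟩ := hq
  obtain ⟨e₁, he₁, -, hpe₁, hxe₁⟩ := hL.exists_dart hG hx he₀ hpe₀ hxp
  obtain ⟨f₁, hf₁, -, hqf₁, hxf₁⟩ := hL.exists_dart hG hx hf₀ hqf₀ hxq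
  have hN := norm_normal (hG.dart_ne he₁)
  have hN' := norm_normal (hG.dart_ne hf₁)
  -- the configuration up to the order of the two edges
  obtain ⟨e, he, f, hf, n, c, s, hn, hn', hs, hcs, hpe, hqf, hxe, hxf, hd⟩ :
      ∃ e ∈ darts E, ∃ f ∈ darts E, ∃ n : Plane, ∃ c s : ℝ,
      (n = normal e.1 e.2 ∨ n = -normal e.1 e.2) ∧
      (c • n + s • rot (normal e.1 e.2) = normal f.1 f.2 ∨
        c • n + s • rot (normal e.1 e.2) = -normal f.1 f.2) ∧ 0 < s ∧ c ^ 2 + s ^ 2 = 1 ∧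
      p ∈ openSegment ℝ e.1 e.2 ∧ q ∈ openSegment ℝ f.1 f.2 ∧ x = p + r • n ∧
      x = q + r • (c • n + s • rot (normal e.1 e.2)) ∧
      rot (normal f.1 f.2) = (-c) • rot (normal e.1 e.2) + s • n := by
    have hexp := frame_expand hN (normal f₁.1 f₁.2)
    have hanti := hL.not_antiparallel hr hG hx he₁ hf₁ hpe₁ hqf₁ hxe₁ hxf₁
    set N := normal e₁.1 e₁.2 with hNdef
    set N' := normal f₁.1 f₁.2 with hNdef'
    set s := dot (rot N) N' with hsdef
    set c := dot N N' with hcdef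
    have hcs : c ^ 2 + s ^ 2 = 1 := by
      have h1 := unit_sq hN
      have h2 := unit_sq hN'
      simp only [hcdef, hsdef, dot, rot_zero, rot_one]
      linear_combination (N' 0 ^ 2 + N' 1 ^ 2) * h1 + h2
    -- parallel edges: either the nearest points coincide, or `x` is midway between the edges
    have hs0 : s ≠ 0 := by
      intro h0
      rw [h0, zero_smul, zero_add] at hexp
      have hc1 : (c - 1) * (c + 1) = 0 := by rw [h0] at hcs; linear_combination hcs
      rcases mul_eq_zero.1 hc1 with h | h
      · rw [sub_eq_zero.1 h, one_smul] at hexp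
        refine hpq ?_
        rw [hxf₁, hexp] at hxe₁
        exact (add_right_cancel hxe₁).symm
      · rw [eq_neg_of_add_eq_zero_left h, neg_one_smul] at hexp
        exact hanti hexp
    -- one of the edges is reversed, such that both tails are towards the apex
    rcases lt_or_gt_of_ne hs0 with hneg | hpos
    · have h1 : normal e₁.swap.1 e₁.swap.2 = -N := normal_swap _ _
      have e1 : c • N + (-s) • rot (-N) = N' := by
        rw [hexp, rot_neg]; module
      refine ⟨e₁.swap, swap_mem_darts he₁, f₁, hf₁, N, c, -s, Or.inr ?_, Or.inl ?_, by linarith,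
        by rw [neg_sq, hcs], ?_, hqf₁, hxe₁, ?_, ?_⟩
      · rw [h1, neg_neg]
      · rw [h1, e1]
      · rw [openSegment_symm] at hpe₁; exact hpe₁
      · rw [h1, e1, ← hxf₁]
      · rw [h1, ← hNdef', rot_neg]
        refine plane_ext ?_ ?_
        · have := congrArg (fun z : Plane => z 1) hexp
          simp only [PiLp.add_apply, PiLp.smul_apply, rot_zero, rot_one, smul_eq_mul,
            PiLp.neg_apply] at this ⊢
          linarith
        · have := congrArg (fun z : Plane => z 0) hexp
          simp only [PiLp.add_apply, PiLp.smul_apply, rot_zero, rot_one, smul_eq_mul,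
            PiLp.neg_apply] at this ⊢
          linarith
    · have h1 : normal f₁.swap.1 f₁.swap.2 = -N' := normal_swap _ _
      have e1 : c • N + s • rot N = N' := by rw [add_comm]; exact hexp.symm
      refine ⟨e₁, he₁, f₁.swap, swap_mem_darts hf₁, N, c, s, Or.inl rfl, Or.inr ?_, hpos, hcs,
        hpe₁, ?_, hxe₁, ?_, ?_⟩
      · rw [h1, neg_neg, ← hNdef, e1]
      · rw [openSegment_symm] at hqf₁; exact hqf₁
      · rw [← hNdef, e1, ← hxf₁]
      · rw [h1, ← hNdef, rot_neg]
        refine plane_ext ?_ ?_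
        · have := congrArg (fun z : Plane => z 1) hexp
          simp only [PiLp.add_apply, PiLp.smul_apply, rot_zero, rot_one, smul_eq_mul,
            PiLp.neg_apply] at this ⊢
          linarith
        · have := congrArg (fun z : Plane => z 0) hexp
          simp only [PiLp.add_apply, PiLp.smul_apply, rot_zero, rot_one, smul_eq_mul,
            PiLp.neg_apply] at this ⊢
          linarith
  obtain ⟨t, ht0, ht1, rfl⟩ := (mem_openSegment_iff_dir (hG.dart_ne he)).1 hpe
  obtain ⟨t', ht0', ht1', rfl⟩ := (mem_openSegment_iff_dir (hG.dart_ne hf)).1 hqf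
  -- the edges do not both reach the apex
  have hapex : t * s ≤ r * (1 - c) ∨ t' * s ≤ r * (1 - c) := by
    by_contra! hcon
    obtain ⟨h1, h2⟩ := hcon
    -- otherwise both edges contain the apex, at distance `l` from `p` and `q`
    set l := r * (1 - c) / s with hl
    have hls : l * s = r * (1 - c) := div_mul_cancel₀ _ hs.ne'
    have hc1 : c ≤ 1 := by nlinarith
    have hl0 : 0 ≤ l := div_nonneg (mul_nonneg hr.le (by linarith)) hs.le
    have h3 : l < t := (div_lt_iff₀ hs).2 h1
    have h4 : l < t' := (div_lt_iff₀ hs).2 h2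
    have m1 : e.1 + (t - l) • rot (normal e.1 e.2) ∈ openSegment ℝ e.1 e.2 :=
      (mem_openSegment_iff_dir (hG.dart_ne he)).2 ⟨_, by linarith, by linarith, rfl⟩
    have m2 : f.1 + (t' - l) • rot (normal f.1 f.2) ∈ openSegment ℝ f.1 f.2 :=
      (mem_openSegment_iff_dir (hG.dart_ne hf)).2 ⟨_, by linarith, by linarith, rfl⟩
    have hlc : l * (1 + c) = r * s := by
      have : l * (1 + c) * s = r * s * s := by
        calc l * (1 + c) * s = (l * s) * (1 + c) := by ring
          _ = r * s * s := by rw [hls]; linear_combination (-r) * hcs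
      exact mul_right_cancel₀ hs.ne' this
    have heq : e.1 + (t - l) • rot (normal e.1 e.2) = f.1 + (t' - l) • rot (normal f.1 f.2) := by
      have e1 : e.1 + t • rot (normal e.1 e.2) = x - r • n := by rw [hxe]; abel
      have e2 : f.1 + t' • rot (normal f.1 f.2) =
          x - r • (c • n + s • rot (normal e.1 e.2)) := by
        conv_rhs => rw [hxf]
        abel
      rw [sub_smul, sub_smul, ← add_sub_assoc, ← add_sub_assoc, e1, e2, hd]
      have e3 : r • (c • n + s • rot (normal e.1 e.2)) +
          l • ((-c) • rot (normal e.1 e.2) + s • n) =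
          (r * c + l * s) • n + (r * s - l * c) • rot (normal e.1 e.2) := by module
      rw [sub_sub, sub_sub, e3, hls, ← hlc]
      module
    rw [← heq] at m2
    have hdd : rot (normal f.1 f.2) = rot (normal e.1 e.2) ∨
        rot (normal f.1 f.2) = -rot (normal e.1 e.2) := by
      rcases hG.dart_disjoint he hf m1 m2 with h | h
      · left; rw [h]
      · right; rw [h, Prod.fst_swap, Prod.snd_swap, normal_swap f.1 f.2, rot_neg, neg_neg]
    have hnd : dot n (rot (normal e.1 e.2)) = 0 := by
      rcases hn with rfl | rfl
      · exact dot_rot_self _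
      · simp only [dot, PiLp.neg_apply, rot_zero, rot_one]; ring
    have hnn : dot n n = 1 := by
      rw [dot_self]
      rcases hn with rfl | rfl
      · rw [norm_normal (hG.dart_ne he), one_pow]
      · rw [norm_neg, norm_normal (hG.dart_ne he), one_pow]
    have h5 : dot n (rot (normal f.1 f.2)) = s := by
      rw [hd, dot_add, dot_smul, dot_smul, hnd, hnn]; ring
    rcases hdd with h | h
    · rw [h, hnd] at h5; exact hs.ne h5
    · have : dot n (-rot (normal e.1 e.2)) = -dot n (rot (normal e.1 e.2)) := by
        simp only [dot, PiLp.neg_apply]; ring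
      rw [h, this, hnd, neg_zero] at h5; exact hs.ne h5
  rcases le_total t t' with htt | htt
  · refine ⟨e, he, f, hf, n, c, s, t, t', hn, hs, hcs, ht0, htt, ht1', ?_, hxe, hd, hxf⟩
    rcases hapex with h | h
    · exact h
    · nlinarith
  · -- the roles of the edges are exchanged
    have hd' : rot (normal e.1 e.2) = (-c) • rot (normal f.1 f.2) +
        s • (c • n + s • rot (normal e.1 e.2)) := by
      rw [hd]
      have : (-c) • ((-c) • rot (normal e.1 e.2) + s • n) +
        s • (c • n + s • rot (normal e.1 e.2)) = (c ^ 2 + s ^ 2) • rot (normal e.1 e.2) := by module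
      rw [this, hcs, one_smul]
    have hn2 : c • (c • n + s • rot (normal e.1 e.2)) + s • rot (normal f.1 f.2) = n := by
      rw [hd]
      have : c • (c • n + s • rot (normal e.1 e.2)) + s • ((-c) • rot (normal e.1 e.2) + s • n) =
        (c ^ 2 + s ^ 2) • n := by module
      rw [this, hcs, one_smul]
    refine ⟨f, hf, e, he, c • n + s • rot (normal e.1 e.2), c, s, t', t, hn', hs, hcs, ht0', htt,
      ht1, ?_, hxf, hd', by rw [hn2]; exact hxe⟩
    rcases hapex with h | h
    · nlinarith
    · exact h

/-- The estimate behind the injectivity of charges. In the frame of the edge charged, the vector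
with components `r * s - Δ * (1 + c)` and `r * c + Δ * s` leads from a reflected foot to the centre
of a disc that is to avoid it. -/
lemma charge_contradiction {r Δ c s t : ℝ} (hΔ : 0 < Δ) (hs : 0 < s)
    (hcs : c ^ 2 + s ^ 2 = 1) (ht : Δ < t) (hts : t * s ≤ r * (1 - c))
    (h : (r * s - Δ * (1 + c)) ^ 2 + (r * c + Δ * s) ^ 2 ≥ r ^ 2) : False := by
  have h1 : (r * s - Δ * (1 + c)) ^ 2 + (r * c + Δ * s) ^ 2 =
      r ^ 2 + 2 * Δ * (Δ * (1 + c) - r * s) := by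
    linear_combination (r ^ 2 + Δ ^ 2) * hcs
  have h2 : 0 ≤ Δ * (Δ * (1 + c) - r * s) := by linarith
  have h3 : 0 ≤ Δ * (1 + c) - r * s := nonneg_of_mul_nonneg_right h2 hΔ
  have hc1 : 0 < 1 - c := by
    have : c ^ 2 < 1 := by
      have := pow_pos hs 2
      linarith
    linarith [(abs_lt.1 ((sq_lt_one_iff_abs_lt_one c).1 this)).2]
  have h4 : Δ * s < r * (1 - c) := (mul_lt_mul_of_pos_right ht hs).trans_le hts
  -- multiplying by `s` and `1 - c` gives contradictory estimates
  have h5 : Δ * s * s < r * (1 - c) * s := mul_lt_mul_of_pos_right h4 hs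
  have h6 : 0 ≤ (Δ * (1 + c) - r * s) * (1 - c) := mul_nonneg h3 hc1.le
  have h7 : Δ * (1 + c) * (1 - c) = Δ * s * s := by linear_combination (-Δ) * hcs
  linarith

/-- The number of boundary points that are equally near to two edges is linear: the edge charged
by `exists_charge`, its tail and its side determine the point. For if two points charge the same
tail, the mirror image, about the bisector through the more distant one, of the foot of the nearer
one lies on an edge and is too close to the nearer one. -/
theorem card_edge_edge_le (hG : Network W E) (hL : IsThickening (netSupport W E) L r) (hr : 0 < r)
    (T : Finset Plane) (hT : ∀ x ∈ T, x ∈ frontier L ∧ ∃ p q, p ≠ q ∧ dist x p = r ∧ dist x q = r ∧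
      (∃ e ∈ E, p ∈ openSegment ℝ e.1 e.2) ∧ ∃ e ∈ E, q ∈ openSegment ℝ e.1 e.2) :
    T.card ≤ 4 * E.card := by
  classical
  choose! p q hpq hxp hxq hp hq using fun x hx => (hT x hx).2
  have hch := fun x (hx : x ∈ T) =>
    exists_charge hG hL hr (hT x hx).1 (hp x hx) (hq x hx) (hxp x hx) (hxq x hx) (hpq x hx)
  choose! e he f hf n c s t t' hn hs hcs ht htt' ht' hts hxe hd hxf using hch
  -- two points with the same charge do not have different feet
  have hno : ∀ x ∈ T, ∀ y ∈ T, e x = e y → n x = n y → ¬ t x < t y := by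
    intro x hx y hy hexy hnxy hlt
    set d := rot (normal (e y).1 (e y).2) with hddef
    set Δ := t y - t x with hΔ
    -- the foot of `x`, reflected to the other edge of `y`
    have hz : (f y).1 + (t' y - Δ) • rot (normal (f y).1 (f y).2) ∈
        openSegment ℝ (f y).1 (f y).2 :=
      (mem_openSegment_iff_dir (hG.dart_ne (hf y hy))).2
        ⟨_, by linarith [ht x hx, htt' y hy], by linarith [ht' y hy], rfl⟩
    have hfar := hL.far x (hT x hx).1 _ (Network.openSegment_subset (hf y hy) hz)
    have e1 : x - ((f y).1 + (t' y - Δ) • rot (normal (f y).1 (f y).2)) =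
        (r * s y - Δ * (1 + c y)) • d + (r * c y + Δ * s y) • n y := by
      have e2 : (f y).1 + t' y • rot (normal (f y).1 (f y).2) =
          y - r • (c y • n y + s y • d) := eq_sub_of_add_eq (hxf y hy).symm
      have e3 : x = y - Δ • d := by
        have h1 := hxe x hx
        have h2 := hxe y hy
        rw [hexy, hnxy] at h1
        calc x = (e y).1 + t x • d + r • n y := h1
          _ = (e y).1 + t y • d + r • n y - Δ • d := by module
          _ = y - Δ • d := by rw [← h2]
      rw [sub_smul, ← add_sub_assoc, e2, e3, hd y hy]
      module
    have hnd : dot d (n y) = 0 := by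
      rcases hn y hy with h | h
      · rw [h, dot_comm]; exact dot_rot_self _
      · rw [h]; simp only [hddef, dot, PiLp.neg_apply, rot_zero, rot_one]; ring
    have hdd : d 0 ^ 2 + d 1 ^ 2 = 1 := by
      rw [← norm_sq_eq, hddef, norm_rot, norm_normal (hG.dart_ne (he y hy)), one_pow]
    have hnn : n y 0 ^ 2 + n y 1 ^ 2 = 1 := by
      rw [← norm_sq_eq]
      rcases hn y hy with h | h
      · rw [h, norm_normal (hG.dart_ne (he y hy)), one_pow]
      · rw [h, norm_neg, norm_normal (hG.dart_ne (he y hy)), one_pow]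
    rw [dist_eq_norm, e1, ← pow_le_pow_iff_left₀ hr.le (norm_nonneg _) two_ne_zero, norm_sq_eq]
      at hfar
    simp only [PiLp.add_apply, PiLp.smul_apply, smul_eq_mul] at hfar
    have h1 : (r * s y - Δ * (1 + c y)) ^ 2 + (r * c y + Δ * s y) ^ 2 ≥ r ^ 2 := by
      simp only [dot] at hnd
      set A := r * s y - Δ * (1 + c y)
      set B := r * c y + Δ * s y
      have : (A * d 0 + B * n y 0) ^ 2 + (A * d 1 + B * n y 1) ^ 2 = A ^ 2 + B ^ 2 := by
        linear_combination A ^ 2 * hdd + B ^ 2 * hnn + 2 * A * B * hnd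
      linarith
    exact charge_contradiction (by linarith) (hs y hy) (hcs y hy) (by linarith [ht x hx])
      (hts y hy) h1
  have hcard : T.card ≤ (darts E ×ˢ (Finset.univ : Finset Bool)).card := by
    refine Finset.card_le_card_of_injOn
      (fun x => (e x, decide (n x = normal (e x).1 (e x).2))) ?_ ?_
    · intro x hx
      exact Finset.mem_product.2 ⟨he x hx, Finset.mem_univ _⟩
    · intro x hx y hy hxy
      simp only [Prod.mk.injEq, decide_eq_decide] at hxy
      obtain ⟨h1, h2⟩ := hxy
      have hnxy : n x = n y := by
        rw [h1] at h2
        have hnx := hn x hx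
        have hny := hn y hy
        rw [h1] at hnx
        by_cases h : n x = normal (e y).1 (e y).2
        · rw [h, h2.1 h]
        · rw [hnx.resolve_left h, hny.resolve_left fun h' => h (h2.2 h')]
      have htxy : t x = t y := le_antisymm
        (not_lt.1 (hno y hy x hx h1.symm hnxy.symm)) (not_lt.1 (hno x hx y hy h1 hnxy))
      rw [hxe x hx, hxe y hy, h1, hnxy, htxy]
  rw [Finset.card_product, Finset.card_univ, Fintype.card_bool] at hcard
  have := card_darts_le E
  omega

end EdgeEdge

/-! ### Discs resting on a network -/

/-- The disc of radius `r` about `x` does not meet `S` in its interior, and it touches `S` in `q`,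
on its lower side with respect to the upward direction `δ`. -/
structure Rests (S : Set Plane) (r : ℝ) (δ x q : Plane) : Prop where
  mem : q ∈ S
  dist_eq : dist x q = r
  above : r / 4 ≤ dot δ (x - q)
  far : ∀ z ∈ S, r ≤ dist x z

/-- Strict concavity of the circle `a ^ 2 + g ^ 2 = r ^ 2`: over an intermediate abscissa, a point
not inside the circle is above the chord. -/
lemma lt_of_circle {r a b g h k l : ℝ} (hg : a ^ 2 + g ^ 2 = r ^ 2) (hh : b ^ 2 + h ^ 2 = r ^ 2)
    (hl0 : 0 < l) (hl1 : l < 1) (hab : a ≠ b) (hk : 0 ≤ k)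
    (hK : r ^ 2 ≤ (l * a + (1 - l) * b) ^ 2 + k ^ 2) : l * g + (1 - l) * h < k := by
  have h1 : 0 < (a - b) ^ 2 := by
    have := sub_ne_zero.2 hab
    positivity
  have h2 : g * h < r ^ 2 - a * b := by nlinarith [sq_nonneg (g - h)]
  have h3 : (l * g + (1 - l) * h) ^ 2 < k ^ 2 := by
    have h4 : 0 < l * (1 - l) * (r ^ 2 - a * b - g * h) :=
      mul_pos (mul_pos hl0 (by linarith)) (by linarith)
    have h5 : (l * a + (1 - l) * b) ^ 2 + (l * g + (1 - l) * h) ^ 2 +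
        2 * (l * (1 - l) * (r ^ 2 - a * b - g * h)) = r ^ 2 := by
      linear_combination l ^ 2 * hg + (1 - l) ^ 2 * hh
    linarith
  exact lt_of_pow_lt_pow_left₀ 2 hk h3

section Rests

variable {S : Set Plane} {r : ℝ} {δ : Plane}

lemma dot_sub_abs_le (hδ : ‖δ‖ = 1) (x y : Plane) : |dot δ (x - y)| ≤ dist x y := by
  rw [← abs_of_nonneg (dist_nonneg (x := x) (y := y)), ← sq_le_sq, dist_sq_frame hδ]
  nlinarith [sq_nonneg (dot (rot δ) (x - y))]

lemma dot_rot_sub_abs_le (hδ : ‖δ‖ = 1) (x y : Plane) : |dot (rot δ) (x - y)| ≤ dist x y := by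
  rw [← abs_of_nonneg (dist_nonneg (x := x) (y := y)), ← sq_le_sq, dist_sq_frame hδ]
  nlinarith [sq_nonneg (dot δ (x - y))]

/-- Below the centre of a resting disc, no point of `S` lies vertically above the contact point. -/
lemma Rests.le_of_below (hδ : ‖δ‖ = 1) (hr : 0 < r) {x q z : Plane} (h : Rests S r δ x q)
    (hz : z ∈ S) (hτ : dot (rot δ) z = dot (rot δ) q) (hzx : dot δ z ≤ dot δ x) :
    dot δ z ≤ dot δ q := by
  have h1 := dist_sq_frame hδ x q
  have h2 := dist_sq_frame hδ x z
  have h3 : r ^ 2 ≤ dist x z ^ 2 := by have := h.far z hz; gcongr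
  rw [h.dist_eq] at h1
  have h4 := h.above
  simp only [dot_sub] at h1 h2 h4
  rw [hτ] at h2
  by_contra! hlt
  nlinarith

/-- Nearby discs rest on `S` in the order of their centres: otherwise each contact point would be
at least `r` away from the other centre, against the strict concavity of the circle. -/
lemma Rests.mono (hδ : ‖δ‖ = 1) (hr : 0 < r) {x₁ x₂ q₁ q₂ : Plane} (h₁ : Rests S r δ x₁ q₁)
    (h₂ : Rests S r δ x₂ q₂) (hx : dist x₁ x₂ ≤ r / 64)
    (hτ : dot (rot δ) x₁ < dot (rot δ) x₂) : dot (rot δ) q₁ ≤ dot (rot δ) q₂ := by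
  by_contra! hlt
  have e1 := dist_sq_frame hδ x₁ q₁
  have e2 := dist_sq_frame hδ x₂ q₂
  have e3 := dist_sq_frame hδ x₂ q₁
  have e4 := dist_sq_frame hδ x₁ q₂
  have f3 : r ^ 2 ≤ dist x₂ q₁ ^ 2 := by have := h₂.far q₁ h₁.mem; gcongr
  have f4 : r ^ 2 ≤ dist x₁ q₂ ^ 2 := by have := h₁.far q₂ h₂.mem; gcongr
  rw [h₁.dist_eq] at e1
  rw [h₂.dist_eq] at e2
  have g1 := h₁.above
  have g2 := h₂.above
  have g3 := abs_le.1 ((dot_sub_abs_le hδ x₁ x₂).trans hx)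
  simp only [dot_sub] at *
  set t := dot (rot δ)
  set u := dot δ
  have hpos : 0 < (t q₁ - t x₁) - (t q₂ - t x₂) := by linarith
  -- the abscissae of both points with respect to the other disc are intermediate
  set l := (t q₁ - t q₂) / ((t q₁ - t x₁) - (t q₂ - t x₂)) with hl
  have hl0 : 0 < l := div_pos (by linarith) hpos
  have hl1 : l < 1 := by rw [hl, div_lt_one hpos]; linarith
  have hlm : l * ((t q₁ - t x₁) - (t q₂ - t x₂)) = t q₁ - t q₂ := div_mul_cancel₀ _ hpos.ne'
  have k1 := lt_of_circle (r := r) (a := t q₁ - t x₁) (b := t q₂ - t x₂) (g := u x₁ - u q₁)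
    (h := u x₂ - u q₂) (k := u x₂ - u q₁) (l := l) (by linarith) (by linarith) hl0 hl1
    (by intro h; linarith) (by linarith) (by
      have : l * (t q₁ - t x₁) + (1 - l) * (t q₂ - t x₂) = t q₁ - t x₂ := by
        linear_combination hlm
      rw [this]; linarith)
  have k2 := lt_of_circle (r := r) (a := t q₁ - t x₁) (b := t q₂ - t x₂) (g := u x₁ - u q₁)
    (h := u x₂ - u q₂) (k := u x₁ - u q₂) (l := 1 - l) (by linarith) (by linarith) (by linarith)
    (by linarith) (by intro h; linarith) (by linarith) (by
      have : (1 - l) * (t q₁ - t x₁) + (1 - (1 - l)) * (t q₂ - t x₂) = t q₂ - t x₁ := by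
        linear_combination -hlm
      rw [this]; linarith)
  linarith

lemma Rests.below (hδ : ‖δ‖ = 1) {x₁ x₂ q₁ : Plane} (h₁ : Rests S r δ x₁ q₁)
    (hx : dist x₁ x₂ ≤ r / 64) : dot δ q₁ ≤ dot δ x₂ - 15 * r / 64 := by
  have g1 := h₁.above
  have g3 := abs_le.1 ((dot_sub_abs_le hδ x₁ x₂).trans hx)
  simp only [dot_sub] at *
  linarith

lemma ne_zero_of_norm_one (hδ : ‖δ‖ = 1) : δ ≠ 0 := by
  rintro rfl; simp at hδ

/-- Contact points of nearby discs with the same abscissa are equal. -/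
lemma Rests.eq_of_dot_eq (hδ : ‖δ‖ = 1) (hr : 0 < r) {x₁ x₂ q₁ q₂ : Plane}
    (h₁ : Rests S r δ x₁ q₁) (h₂ : Rests S r δ x₂ q₂) (hx : dist x₁ x₂ ≤ r / 64)
    (hτ : dot (rot δ) q₁ = dot (rot δ) q₂) : q₁ = q₂ := by
  have b1 := h₁.below hδ hx
  have b2 := h₂.below hδ (by rwa [dist_comm])
  exact eq_of_frame (ne_zero_of_norm_one hδ) hτ (le_antisymm
    (h₂.le_of_below hδ hr h₁.mem hτ (by linarith))
    (h₁.le_of_below hδ hr h₂.mem hτ.symm (by linarith)))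

/-- Nearby resting discs whose centres have the same abscissa are equal. -/
lemma Rests.center_eq (hδ : ‖δ‖ = 1) (hr : 0 < r) {x₁ x₂ q₁ q₂ : Plane}
    (h₁ : Rests S r δ x₁ q₁) (h₂ : Rests S r δ x₂ q₂) (hx : dist x₁ x₂ ≤ r / 64)
    (hτ : dot (rot δ) x₁ = dot (rot δ) x₂) : x₁ = x₂ := by
  have key : ∀ {x₁ x₂ q₁ q₂ : Plane}, Rests S r δ x₁ q₁ → Rests S r δ x₂ q₂ →
      dist x₁ x₂ ≤ r / 64 → dot (rot δ) x₁ = dot (rot δ) x₂ → dot δ x₁ ≤ dot δ x₂ := by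
    intro x₁ x₂ q₁ q₂ h₁ h₂ hx hτ
    -- the upper disc rests on a point inside the lower disc
    have e1 := dist_sq_frame hδ x₁ q₁
    have e3 := dist_sq_frame hδ x₂ q₁
    have f3 : r ^ 2 ≤ dist x₂ q₁ ^ 2 := by have := h₂.far q₁ h₁.mem; gcongr
    rw [h₁.dist_eq] at e1
    have b1 := h₁.below hδ hx
    have g1 := h₁.above
    simp only [dot_sub] at *
    rw [hτ] at e1
    by_contra! hlt
    nlinarith
  exact eq_of_frame (ne_zero_of_norm_one hδ) hτ
    (le_antisymm (key h₁ h₂ hx hτ) (key h₂ h₁ (by rwa [dist_comm]) hτ.symm))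

/-- Nearby discs do not rest alternately on two disjoint convex subsets of `S`. -/
lemma exists_common_of_alternation (hδ : ‖δ‖ = 1) (hr : 0 < r) {x₁ x₂ x₃ x₄ q₁ q₂ q₃ q₄ : Plane}
    {F G : Set Plane} (h₁ : Rests S r δ x₁ q₁) (h₂ : Rests S r δ x₂ q₂) (h₃ : Rests S r δ x₃ q₃)
    (h₄ : Rests S r δ x₄ q₄) (d12 : dist x₁ x₂ ≤ r / 64)
    (d23 : dist x₂ x₃ ≤ r / 64) (d34 : dist x₃ x₄ ≤ r / 64)
    (h12 : dot (rot δ) x₁ < dot (rot δ) x₂) (h23 : dot (rot δ) x₂ < dot (rot δ) x₃)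
    (h34 : dot (rot δ) x₃ < dot (rot δ) x₄) (hF : Convex ℝ F) (hG : Convex ℝ G) (hFS : F ⊆ S)
    (hGS : G ⊆ S) (q1 : q₁ ∈ F) (q2 : q₂ ∈ G) (q3 : q₃ ∈ F) (q4 : q₄ ∈ G) :
    ∃ z, z ∈ F ∧ z ∈ G := by
  have m12 := h₁.mono hδ hr h₂ d12 h12
  have m23 := h₂.mono hδ hr h₃ d23 h23
  have m34 := h₃.mono hδ hr h₄ d34 h34
  rcases eq_or_lt_of_le m12 with e | m12'
  · exact ⟨q₁, q1, h₁.eq_of_dot_eq hδ hr h₂ d12 e ▸ q2⟩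
  rcases eq_or_lt_of_le m34 with e | m34'
  · exact ⟨q₃, q3, h₃.eq_of_dot_eq hδ hr h₄ d34 e ▸ q4⟩
  obtain ⟨z, hz1, hz2⟩ := segments_cross (ne_zero_of_norm_one hδ) m12 m23 m34
    (m12'.trans_le m23) (m23.trans_lt m34')
    (fun z hz hτ => h₂.le_of_below hδ hr (hFS (hF.segment_subset q1 q3 hz)) hτ
      (dot_mem_segment hz (by have := h₁.below hδ d12; linarith)
        (by have := h₃.below hδ (dist_comm x₂ x₃ ▸ d23); linarith)))
    (fun z hz hτ => h₃.le_of_below hδ hr (hGS (hG.segment_subset q2 q4 hz)) hτ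
      (dot_mem_segment hz (by have := h₂.below hδ d23; linarith)
        (by have := h₄.below hδ (dist_comm x₃ x₄ ▸ d34); linarith)))
  exact ⟨z, hF.segment_subset q1 q3 hz1, hG.segment_subset q2 q4 hz2⟩

/-- A line tangent to the lower side of a disc stays below the centre of a nearby disc wherever
the latter has a lower side. -/
lemma tangent_below (hδ : ‖δ‖ = 1) (hr : 0 < r) {x₁ x₂ q₁ q₂ z n : Plane}
    (h₁ : Rests S r δ x₁ q₁) (h₂ : Rests S r δ x₂ q₂) (hx : dist x₁ x₂ ≤ r / 64)
    (hn : x₂ = q₂ + r • n) (hz : dot n (z - q₂) = 0)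
    (hτ : dot (rot δ) z = dot (rot δ) q₁) : dot δ z ≤ dot δ x₁ := by
  have hx2 : x₂ - q₂ = r • n := by rw [hn]; abel
  have hn1 : ‖n‖ = 1 := by
    have := h₂.dist_eq
    rw [dist_eq_norm, hx2, norm_smul, Real.norm_eq_abs, abs_of_pos hr] at this
    exact mul_left_cancel₀ hr.ne' (by rw [this, mul_one])
  have hb : 1 / 4 ≤ dot δ n := by
    have := h₂.above
    rw [hx2, dot_smul] at this
    nlinarith
  have hs : dot (rot δ) n ^ 2 + dot δ n ^ 2 = 1 := by
    have := dist_sq_frame hδ n 0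
    rw [dist_zero_right, hn1, sub_zero] at this
    linarith
  have ha : |dot (rot δ) n| ≤ 31 / 32 := abs_le_of_sq_le_sq (by nlinarith) (by norm_num)
  have hq : |dot (rot δ) (x₁ - q₁)| ≤ 31 / 32 * r := by
    have := dist_sq_frame hδ x₁ q₁
    rw [h₁.dist_eq] at this
    exact abs_le_of_sq_le_sq (by nlinarith [h₁.above]) (by positivity)
  have g3 := (dot_rot_sub_abs_le hδ x₁ x₂).trans hx
  have g4 := abs_le.1 ((dot_sub_abs_le hδ x₁ x₂).trans hx)
  -- the equation of the tangent in the frame `(rot δ, δ)`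
  have heq : dot (rot δ) n * dot (rot δ) (x₂ - z) + dot δ n * dot δ (x₂ - z) = r := by
    have e1 : dot n (x₂ - z) = r := by
      have : x₂ - z = r • n - (z - q₂) := by rw [← hx2]; abel
      rw [this, dot_sub, hz, dot_smul, dot_self, hn1]; ring
    have hd := unit_sq hδ
    rw [← e1]
    simp only [dot, rot_zero, rot_one, PiLp.sub_apply]
    linear_combination (n 0 * (x₂ 0 - z 0) + n 1 * (x₂ 1 - z 1)) * hd
  have hτ2 : |dot (rot δ) (x₂ - z)| ≤ 63 / 64 * r := by
    have : dot (rot δ) (x₂ - z) = dot (rot δ) (x₁ - q₁) - dot (rot δ) (x₁ - x₂) := by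
      simp only [dot_sub]; rw [hτ]; ring
    rw [this]
    refine (abs_sub _ _).trans ?_
    linarith
  have hprod : dot (rot δ) n * dot (rot δ) (x₂ - z) ≤ 31 / 32 * (63 / 64 * r) := by
    refine (le_abs_self _).trans ?_
    rw [abs_mul]
    exact mul_le_mul ha hτ2 (abs_nonneg _) (by norm_num)
  have hle1 : dot δ n ≤ 1 := by nlinarith [sq_nonneg (dot (rot δ) n)]
  have hfin : r / 64 ≤ dot δ (x₂ - z) := by
    by_contra! hlt
    have : dot δ n * dot δ (x₂ - z) ≤ r / 64 := by
      rcases le_total 0 (dot δ (x₂ - z)) with h | h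
      · nlinarith
      · nlinarith
    linarith
  simp only [dot_sub] at *
  linarith

lemma add_smul_mem_openSegment {a b q : Plane} {t k : ℝ} (hab : a ≠ b)
    (hq : q ∈ openSegment ℝ a b) (ha : k ≤ dist q a) (hb : k ≤ dist q b) (ht : |t| < k) :
    q + t • rot (normal a b) ∈ openSegment ℝ a b := by
  rw [mem_openSegment_iff_dir hab] at hq ⊢
  obtain ⟨s, h0, h1, rfl⟩ := hq
  have hN : ‖rot (normal a b)‖ = 1 := by rw [norm_rot, norm_normal hab]
  have hba := sub_eq_norm_smul_rot_normal hab
  have e1 : dist (a + s • rot (normal a b)) a = s := by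
    rw [dist_eq_norm, add_sub_cancel_left, norm_smul, hN, mul_one, Real.norm_eq_abs,
      abs_of_pos h0]
  have e2 : dist (a + s • rot (normal a b)) b = ‖b - a‖ - s := by
    have : a + s • rot (normal a b) - b = (-(‖b - a‖ - s)) • rot (normal a b) := by
      calc a + s • rot (normal a b) - b = s • rot (normal a b) - (b - a) := by abel
        _ = s • rot (normal a b) - ‖b - a‖ • rot (normal a b) := by rw [← hba]
        _ = _ := by module
    rw [dist_eq_norm, this, norm_smul, hN, mul_one, Real.norm_eq_abs, abs_neg,
      abs_of_pos (by linarith)]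
  rw [e1] at ha
  rw [e2] at hb
  have := abs_lt.1 ht
  exact ⟨s + t, by linarith, by linarith, by module⟩

/-- A point of a long edge under a resting disc, at a given abscissa. -/
lemma exists_mem_edge_of_dot (hδ : ‖δ‖ = 1) (hr : 0 < r) {x₁ x₂ q₁ q₂ n a b : Plane}
    (h₁ : Rests S r δ x₁ q₁) (h₂ : Rests S r δ x₂ q₂) (hx : dist x₁ x₂ ≤ r / 64) (hab : a ≠ b)
    (hq : q₂ ∈ openSegment ℝ a b) (hn : x₂ = q₂ + r • n) (hN : n = normal a b ∨ n = -normal a b)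
    (ha : 12 * r ≤ dist x₂ a) (hb : 12 * r ≤ dist x₂ b) :
    ∃ z ∈ openSegment ℝ a b, dot (rot δ) z = dot (rot δ) q₁ := by
  have hx2 : x₂ - q₂ = r • n := by rw [hn]; abel
  have hb4 : 1 / 4 ≤ dot δ n := by
    have := h₂.above
    rw [hx2, dot_smul] at this
    nlinarith
  have hslope : dot (rot δ) (rot (normal a b)) = dot δ (normal a b) := by
    simp only [dot, rot_zero, rot_one]; ring
  have hsl : 1 / 4 ≤ |dot δ (normal a b)| := by
    rcases hN with h | h
    · rw [← h]; exact hb4.trans (le_abs_self _)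
    · have : dot δ (normal a b) = -dot δ n := by
        rw [h]; simp only [dot, PiLp.neg_apply]; ring
      rw [this, abs_neg]; exact hb4.trans (le_abs_self _)
  have hsl0 : dot δ (normal a b) ≠ 0 := fun h => by rw [h, abs_zero] at hsl; linarith
  have hd : |dot (rot δ) (q₁ - q₂)| ≤ 2 * r + r / 64 := by
    refine (dot_rot_sub_abs_le hδ _ _).trans ?_
    have h1 := dist_triangle q₁ x₁ q₂
    have h2 := dist_triangle x₁ x₂ q₂
    rw [dist_comm q₁ x₁, h₁.dist_eq] at h1
    rw [h₂.dist_eq] at h2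
    linarith
  refine ⟨q₂ + (dot (rot δ) (q₁ - q₂) / dot δ (normal a b)) • rot (normal a b),
    add_smul_mem_openSegment (k := 11 * r) hab hq ?_ ?_ ?_, ?_⟩
  · have := dist_triangle x₂ q₂ a
    rw [h₂.dist_eq] at this; linarith
  · have := dist_triangle x₂ q₂ b
    rw [h₂.dist_eq] at this; linarith
  · rw [abs_div, div_lt_iff₀ (by linarith)]
    nlinarith
  · rw [dot_add, dot_smul, hslope, div_mul_cancel₀ _ hsl0, dot_sub]; ring

/-- Two edges on which nearby discs rest far from the ends of both edges have a common point. -/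
lemma exists_common_of_long (hδ : ‖δ‖ = 1) (hr : 0 < r) {x₁ x₂ q₁ q₂ n₁ n₂ a b c d : Plane}
    (h₁ : Rests S r δ x₁ q₁) (h₂ : Rests S r δ x₂ q₂) (hx : dist x₁ x₂ ≤ r / 64)
    (hτ : dot (rot δ) x₁ < dot (rot δ) x₂) (hab : a ≠ b) (hcd : c ≠ d)
    (hS : openSegment ℝ a b ⊆ S) (hS' : openSegment ℝ c d ⊆ S)
    (hq₁ : q₁ ∈ openSegment ℝ a b) (hn₁ : x₁ = q₁ + r • n₁)
    (hN₁ : n₁ = normal a b ∨ n₁ = -normal a b) (ha : 12 * r ≤ dist x₁ a) (hb : 12 * r ≤ dist x₁ b)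
    (hq₂ : q₂ ∈ openSegment ℝ c d) (hn₂ : x₂ = q₂ + r • n₂)
    (hN₂ : n₂ = normal c d ∨ n₂ = -normal c d) (hc : 12 * r ≤ dist x₂ c)
    (hd : 12 * r ≤ dist x₂ d) : ∃ z, z ∈ openSegment ℝ a b ∧ z ∈ openSegment ℝ c d := by
  have hx' : dist x₂ x₁ ≤ r / 64 := by rwa [dist_comm]
  have hm := h₁.mono hδ hr h₂ hx hτ
  rcases eq_or_lt_of_le hm with e | hlt
  · exact ⟨q₁, hq₁, h₁.eq_of_dot_eq hδ hr h₂ hx e ▸ hq₂⟩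
  obtain ⟨z₁, hz₁, hz₁'⟩ := exists_mem_edge_of_dot hδ hr h₁ h₂ hx hcd hq₂ hn₂ hN₂ hc hd
  obtain ⟨z₂, hz₂, hz₂'⟩ := exists_mem_edge_of_dot hδ hr h₂ h₁ hx' hab hq₁ hn₁ hN₁ ha hb
  have perp : ∀ {a b q z n : Plane}, (n = normal a b ∨ n = -normal a b) →
      q ∈ openSegment ℝ a b → z ∈ openSegment ℝ a b → dot n (z - q) = 0 := by
    intro a b q z n hn hq hz
    have := dot_normal_of_mem_segment (openSegment_subset_segment _ _ _ hq)
      (openSegment_subset_segment _ _ _ hz)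
    rcases hn with rfl | rfl
    · exact this
    · rw [dot_comm, ← neg_one_smul ℝ, dot_smul, dot_comm, this, mul_zero]
  have cx : ∀ a b : Plane, Convex ℝ (openSegment ℝ a b) := convex_openSegment
  obtain ⟨z, hz1, hz2⟩ := segments_cross (ne_zero_of_norm_one hδ) (x₁ := z₁) (x₂ := q₁) (x₃ := q₂)
    (x₄ := z₂) hz₁'.le hm hz₂'.ge (hz₁' ▸ hlt) (hz₂' ▸ hlt)
    (fun z hz hτ => by
      have hz' := (cx c d).segment_subset hz₁ hq₂ hz
      exact h₁.le_of_below hδ hr (hS' hz') hτ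
        (tangent_below hδ hr h₁ h₂ hx hn₂ (perp hN₂ hq₂ hz') hτ))
    (fun z hz hτ => by
      have hz' := (cx a b).segment_subset hq₁ hz₂ hz
      exact h₂.le_of_below hδ hr (hS hz') hτ
        (tangent_below hδ hr h₂ h₁ hx' hn₁ (perp hN₁ hq₁ hz') hτ))
  exact ⟨z, (cx a b).segment_subset hq₁ hz₂ hz2, (cx c d).segment_subset hz₁ hq₂ hz1⟩

end Rests

/-! ### Counting the points equally near to a vertex and another place -/

section ClassCount

variable {W : Finset Plane} {E : Finset (Plane × Plane)} {L : Set Plane} {r : ℝ}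

/-- The features of a network: its vertices and its open edges. -/
def featureSet : Plane ⊕ (Plane × Plane) → Set Plane
  | Sum.inl w => {w}
  | Sum.inr e => openSegment ℝ e.1 e.2

lemma convex_featureSet (φ : Plane ⊕ (Plane × Plane)) : Convex ℝ (featureSet φ) := by
  rcases φ with w | e
  · exact convex_singleton w
  · exact convex_openSegment _ _

lemma featureSet_subset {φ : Plane ⊕ (Plane × Plane)} (hφ : φ ∈ W.disjSum E) :
    featureSet φ ⊆ netSupport W E := by
  rcases φ with w | e
  · rintro x rfl
    exact Or.inl (Finset.inl_mem_disjSum.1 hφ)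
  · intro x hx
    exact Or.inr ⟨e, Finset.inr_mem_disjSum.1 hφ, hx⟩

lemma Network.feature_unique (hG : Network W E) {φ ψ : Plane ⊕ (Plane × Plane)}
    (hφ : φ ∈ W.disjSum E) (hψ : ψ ∈ W.disjSum E) {z : Plane} (h1 : z ∈ featureSet φ)
    (h2 : z ∈ featureSet ψ) : φ = ψ := by
  rcases φ with w | e <;> rcases ψ with w' | e'
  · rw [show z = w from h1] at h2
    rw [show w = w' from h2]
  · rw [show z = w from h1] at h2
    exact (hG.avoid e' (Finset.inr_mem_disjSum.1 hψ) w (Finset.inl_mem_disjSum.1 hφ) h2).elim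
  · rw [show z = w' from h2] at h1
    exact (hG.avoid e (Finset.inr_mem_disjSum.1 hφ) w' (Finset.inl_mem_disjSum.1 hψ) h1).elim
  · rw [hG.disjoint e (Finset.inr_mem_disjSum.1 hφ) e' (Finset.inr_mem_disjSum.1 hψ) z h1 h2]

lemma exists_feature {q : Plane} (hq : q ∈ netSupport W E) :
    ∃ φ ∈ W.disjSum E, q ∈ featureSet φ := by
  rcases hq with h | ⟨e, he, h⟩
  · exact ⟨Sum.inl q, Finset.inl_mem_disjSum.2 h, rfl⟩
  · exact ⟨Sum.inr e, Finset.inr_mem_disjSum.2 he, h⟩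

/-- The labelling of nearby resting discs by the features they rest on is free of alternations,
whether sorted from left to right or, for discs upside down, from right to left. -/
lemma feature_alternation (hG : Network W E) (hr : 0 < r) {δ δ' : Plane} (hδ : ‖δ‖ = 1)
    (hδ' : δ' = δ ∨ δ' = -δ) {T : Finset Plane} {q : Plane → Plane}
    {φ : Plane → Plane ⊕ (Plane × Plane)}
    (hclose : ∀ x ∈ T, ∀ y ∈ T, dist x y ≤ r / 64)
    (hq : ∀ x ∈ T, Rests (netSupport W E) r δ' x (q x))
    (hφ : ∀ x ∈ T, φ x ∈ W.disjSum E) (hqφ : ∀ x ∈ T, q x ∈ featureSet (φ x)) :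
    ∀ x₁ ∈ T, ∀ x₂ ∈ T, ∀ x₃ ∈ T, ∀ x₄ ∈ T, dot (rot δ) x₁ < dot (rot δ) x₂ →
      dot (rot δ) x₂ < dot (rot δ) x₃ → dot (rot δ) x₃ < dot (rot δ) x₄ →
      φ x₁ = φ x₃ → φ x₂ = φ x₄ → φ x₁ = φ x₂ := by
  intro x₁ h₁ x₂ h₂ x₃ h₃ x₄ h₄ h12 h23 h34 e13 e24
  rcases hδ' with rfl | rfl
  · obtain ⟨z, hz1, hz2⟩ := exists_common_of_alternation hδ hr (hq x₁ h₁) (hq x₂ h₂) (hq x₃ h₃)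
      (hq x₄ h₄) (hclose _ h₁ _ h₂) (hclose _ h₂ _ h₃) (hclose _ h₃ _ h₄) h12 h23 h34
      (convex_featureSet (φ x₁)) (convex_featureSet (φ x₂)) (featureSet_subset (hφ x₁ h₁))
      (featureSet_subset (hφ x₂ h₂)) (hqφ x₁ h₁) (hqφ x₂ h₂) (e13 ▸ hqφ x₃ h₃) (e24 ▸ hqφ x₄ h₄)
    exact hG.feature_unique (hφ x₁ h₁) (hφ x₂ h₂) hz1 hz2
  · have hneg : ∀ x, dot (rot (-δ)) x = -dot (rot δ) x := fun x => by
      simp only [dot, rot_zero, rot_one, PiLp.neg_apply]; ring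
    obtain ⟨z, hz1, hz2⟩ := exists_common_of_alternation (by rwa [norm_neg]) hr (hq x₄ h₄)
      (hq x₃ h₃) (hq x₂ h₂) (hq x₁ h₁) (hclose _ h₄ _ h₃) (hclose _ h₃ _ h₂) (hclose _ h₂ _ h₁)
      (by rw [hneg, hneg]; linarith) (by rw [hneg, hneg]; linarith)
      (by rw [hneg, hneg]; linarith)
      (convex_featureSet (φ x₂)) (convex_featureSet (φ x₁)) (featureSet_subset (hφ x₂ h₂))
      (featureSet_subset (hφ x₁ h₁)) (e24 ▸ hqφ x₄ h₄) (e13 ▸ hqφ x₃ h₃) (hqφ x₂ h₂) (hqφ x₁ h₁)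
    exact hG.feature_unique (hφ x₁ h₁) (hφ x₂ h₂) hz2 hz1

lemma exists_normal_of_rests (hG : Network W E) {δ x q : Plane}
    {e : Plane × Plane} (he : e ∈ E) (h : Rests (netSupport W E) r δ x q)
    (hq : q ∈ openSegment ℝ e.1 e.2) :
    ∃ n : Plane, x = q + r • n ∧ (n = normal e.1 e.2 ∨ n = -normal e.1 e.2) := by
  have h0 := dot_eq_zero_of_nearest hq fun z hz => by
    rw [h.dist_eq]; exact h.far z (Or.inr ⟨e, he, hz⟩)
  rcases eq_normal_or (hG.ne e he) h0 (by rw [← dist_eq_norm, h.dist_eq]) with h | h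
  · exact ⟨_, by rw [← h]; abel, Or.inl rfl⟩
  · exact ⟨_, by rw [← h]; abel, Or.inr (normal_swap _ _)⟩

/-- Nearby centres of discs that rest both on a vertex and on another feature, in the same
direction up to sign. The vertices close by bound their number: all features involved have a
vertex close by, except for at most one long edge. -/
lemma card_class_le (hG : Network W E) (hr : 0 < r) {δ δ₁ δ₂ : Plane} (hδ : ‖δ‖ = 1)
    (hδ₁ : δ₁ = δ ∨ δ₁ = -δ) (hδ₂ : δ₂ = δ ∨ δ₂ = -δ) (T : Finset Plane) (p q : Plane → Plane)
    (hclose : ∀ x ∈ T, ∀ y ∈ T, dist x y ≤ r / 64) (hpW : ∀ x ∈ T, p x ∈ W)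
    (hpq : ∀ x ∈ T, p x ≠ q x) (hp : ∀ x ∈ T, Rests (netSupport W E) r δ₁ x (p x))
    (hq : ∀ x ∈ T, Rests (netSupport W E) r δ₂ x (q x)) (W' : Finset Plane)
    (hW' : ∀ x ∈ T, ∀ w ∈ W, dist x w < 12 * r → w ∈ W') : T.card ≤ 20 * W'.card := by
  classical
  rcases T.eq_empty_or_nonempty with rfl | ⟨o, ho⟩
  · simp
  have hpW' : ∀ x ∈ T, p x ∈ W' := fun x hx =>
    hW' x hx _ (hpW x hx) (by rw [(hp x hx).dist_eq]; linarith)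
  have hpos : 0 < W'.card := Finset.card_pos.2 ⟨_, hpW' o ho⟩
  have hδ₂n : ‖δ₂‖ = 1 := by rcases hδ₂ with rfl | rfl <;> simp [hδ]
  have hδ₁n : ‖δ₁‖ = 1 := by rcases hδ₁ with rfl | rfl <;> simp [hδ]
  have hτ : ∀ {δ' : Plane}, (δ' = δ ∨ δ' = -δ) → ∀ x y, dot (rot δ') x = dot (rot δ') y ↔
      dot (rot δ) x = dot (rot δ) y := by
    rintro δ' (rfl | rfl) x y
    · rfl
    · have hneg : ∀ x, dot (rot (-δ)) x = -dot (rot δ) x := fun x => by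
        simp only [dot, rot_zero, rot_one, PiLp.neg_apply]; ring
      rw [hneg, hneg, neg_inj]
  -- the two labels of a centre are the vertex `p x` and the feature that contains `q x`
  choose! φ hφ hqφ using fun x (hx : x ∈ T) => exists_feature (hq x hx).mem
  have hmain := card_le_of_alternation_free T (fun x => dot (rot δ) x) ?_ p φ 2 ?_ ?_ ?_
  · -- counting the labels
    have c1 : (T.image p).card ≤ W'.card := Finset.card_le_card (Finset.image_subset_iff.2 hpW')
    -- the labels without a vertex close by are long edges, and two of these would cross
    let long (ψ : Plane ⊕ (Plane × Plane)) : Prop := ∃ e, ψ = Sum.inr e ∧ e.1 ∉ W' ∧ e.2 ∉ W'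
    have c2 : ((T.image φ).filter long).card ≤ 1 := by
      refine Finset.card_le_one.2 ?_
      intro ψ₁ h₁ ψ₂ h₂
      obtain ⟨h₁, e, rfl, he1, he2⟩ := Finset.mem_filter.1 h₁
      obtain ⟨h₂, f, rfl, hf1, hf2⟩ := Finset.mem_filter.1 h₂
      obtain ⟨x, hx, hxe⟩ := Finset.mem_image.1 h₁
      obtain ⟨y, hy, hyf⟩ := Finset.mem_image.1 h₂
      have heE : e ∈ E := Finset.inr_mem_disjSum.1 (hxe ▸ hφ x hx)
      have hfE : f ∈ E := Finset.inr_mem_disjSum.1 (hyf ▸ hφ y hy)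
      have hqe : q x ∈ featureSet (Sum.inr e) := hxe ▸ hqφ x hx
      have hqf : q y ∈ featureSet (Sum.inr f) := hyf ▸ hqφ y hy
      obtain ⟨n₁, hn₁, hN₁⟩ := exists_normal_of_rests hG heE (hq x hx) hqe
      obtain ⟨n₂, hn₂, hN₂⟩ := exists_normal_of_rests hG hfE (hq y hy) hqf
      have far : ∀ x ∈ T, ∀ w ∈ W, w ∉ W' → 12 * r ≤ dist x w := fun x hx w hw h =>
        not_lt.1 fun h' => h (hW' x hx w hw h')
      have key : ∃ z, z ∈ openSegment ℝ e.1 e.2 ∧ z ∈ openSegment ℝ f.1 f.2 := by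
        rcases lt_trichotomy (dot (rot δ₂) x) (dot (rot δ₂) y) with h | h | h
        · exact exists_common_of_long hδ₂n hr (hq x hx) (hq y hy) (hclose x hx y hy) h (hG.ne e heE)
            (hG.ne f hfE) (fun z hz => Or.inr ⟨e, heE, hz⟩) (fun z hz => Or.inr ⟨f, hfE, hz⟩) hqe
            hn₁ hN₁ (far x hx _ (hG.tail_mem e heE) he1) (far x hx _ (hG.head_mem e heE) he2) hqf
            hn₂ hN₂ (far y hy _ (hG.tail_mem f hfE) hf1) (far y hy _ (hG.head_mem f hfE) hf2)
        · have hxy := (hq x hx).center_eq hδ₂n hr (hq y hy) (hclose x hx y hy) h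
          subst hxy
          exact ⟨q x, hqe, hqf⟩
        · obtain ⟨z, h1, h2⟩ := exists_common_of_long hδ₂n hr (hq y hy) (hq x hx)
            (hclose y hy x hx) h (hG.ne f hfE)
            (hG.ne e heE) (fun z hz => Or.inr ⟨f, hfE, hz⟩) (fun z hz => Or.inr ⟨e, heE, hz⟩) hqf
            hn₂ hN₂ (far y hy _ (hG.tail_mem f hfE) hf1) (far y hy _ (hG.head_mem f hfE) hf2) hqe
            hn₁ hN₁ (far x hx _ (hG.tail_mem e heE) he1) (far x hx _ (hG.head_mem e heE) he2)
          exact ⟨z, h2, h1⟩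
      obtain ⟨z, hz1, hz2⟩ := key
      rw [hG.disjoint e heE f hfE z hz1 hz2]
    -- each vertex is the head of at most one edge and the tail of at most one edge
    have c3 : ((T.image φ).filter fun ψ => ¬ long ψ).card ≤ 3 * W'.card := by
      have hsub : ((T.image φ).filter fun ψ => ¬ long ψ) ⊆ (W'.image Sum.inl ∪
          (E.filter fun e => e.1 ∈ W').image Sum.inr) ∪
            (E.filter fun e => e.2 ∈ W').image Sum.inr := by
        intro ψ hψ
        obtain ⟨hψ, hl⟩ := Finset.mem_filter.1 hψ
        obtain ⟨x, hx, rfl⟩ := Finset.mem_image.1 hψ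
        have h1 := hφ x hx
        have h2 := hqφ x hx
        simp only [Finset.mem_union, Finset.mem_image, Finset.mem_filter]
        rcases hψx : φ x with w | e
        · rw [hψx] at h1 h2
          refine Or.inl (Or.inl ⟨w, ?_, rfl⟩)
          refine hW' x hx w (Finset.inl_mem_disjSum.1 h1) ?_
          have : q x = w := h2
          rw [← this, (hq x hx).dist_eq]; linarith
        · rw [hψx] at h1
          have h3 := Finset.inr_mem_disjSum.1 h1
          by_cases he : e.1 ∈ W'
          · exact Or.inl (Or.inr ⟨e, ⟨h3, he⟩, rfl⟩)
          by_cases he' : e.2 ∈ W'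
          · exact Or.inr ⟨e, ⟨h3, he'⟩, rfl⟩
          exact (hl ⟨e, hψx, he, he'⟩).elim
      have d0 := Finset.card_le_card hsub
      have d1 := Finset.card_union_le (W'.image (Sum.inl : Plane → Plane ⊕ (Plane × Plane)) ∪
          (E.filter fun e => e.1 ∈ W').image Sum.inr) ((E.filter fun e => e.2 ∈ W').image Sum.inr)
      have d2 := Finset.card_union_le (W'.image (Sum.inl : Plane → Plane ⊕ (Plane × Plane)))
          ((E.filter fun e => e.1 ∈ W').image Sum.inr)
      have d3 := Finset.card_image_le (s := W')
        (f := (Sum.inl : Plane → Plane ⊕ (Plane × Plane)))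
      have d4 := Finset.card_image_le (s := E.filter fun e => e.1 ∈ W')
        (f := (Sum.inr : Plane × Plane → Plane ⊕ (Plane × Plane)))
      have d5 := Finset.card_image_le (s := E.filter fun e => e.2 ∈ W')
        (f := (Sum.inr : Plane × Plane → Plane ⊕ (Plane × Plane)))
      have d6 : (E.filter fun e => e.1 ∈ W').card ≤ W'.card :=
        Finset.card_le_card_of_injOn Prod.fst (fun e he => (Finset.mem_filter.1 he).2)
          fun e he f hf => hG.tail_inj e (Finset.mem_filter.1 he).1 f (Finset.mem_filter.1 hf).1
      have d7 : (E.filter fun e => e.2 ∈ W').card ≤ W'.card :=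
        Finset.card_le_card_of_injOn Prod.snd (fun e he => (Finset.mem_filter.1 he).2)
          fun e he f hf => hG.head_inj e (Finset.mem_filter.1 he).1 f (Finset.mem_filter.1 hf).1
      omega
    have c4 := Finset.card_filter_add_card_filter_not (s := T.image φ) long
    omega
  · intro x hx y hy hxy
    exact (hp x hx).center_eq hδ₁n hr (hp y hy) (hclose x hx y hy) ((hτ hδ₁ x y).2 hxy)
  · intro x₁ h₁ x₂ h₂ x₃ h₃ x₄ h₄ h12 h23 h34 e13 e24
    have := feature_alternation hG hr hδ hδ₁ (φ := fun x => Sum.inl (p x)) hclose hp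
      (fun x hx => Finset.inl_mem_disjSum.2 (hpW x hx)) (fun x _ => rfl) x₁ h₁ x₂ h₂ x₃ h₃ x₄ h₄
      h12 h23 h34 (congrArg Sum.inl e13) (congrArg Sum.inl e24)
    exact Sum.inl_injective this
  · exact feature_alternation hG hr hδ hδ₂ hclose hq hφ hqφ
  -- equally labelled centres lie on the circle about the vertex, and on the circle about the other
  -- vertex or on a parallel of the edge
  · intro U hU hlab
    rcases U.eq_empty_or_nonempty with rfl | ⟨o, ho⟩
    · simp
    have hUp : ∀ x ∈ U, dist x (p o) = r := fun x hx => by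
      rw [← (hlab x hx o ho).1, (hp x (hU hx)).dist_eq]
    rcases hφo : φ o with w | e
    · have hqw : ∀ x ∈ U, q x = w := fun x hx => by
        have := hqφ x (hU hx)
        rw [(hlab x hx o ho).2, hφo] at this
        exact this
      refine card_le_two_of_two_circles U (p o) w r r (Or.inl ?_) hUp fun x hx => ?_
      · rw [← hqw o ho]; exact hpq o (hU ho)
      · rw [← hqw x hx, (hq x (hU hx)).dist_eq]
    · have heE : e ∈ E := Finset.inr_mem_disjSum.1 (hφo ▸ hφ o (hU ho))
      have hqe : ∀ x ∈ U, q x ∈ openSegment ℝ e.1 e.2 := fun x hx => by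
        have := hqφ x (hU hx)
        rw [(hlab x hx o ho).2, hφo] at this
        exact this
      -- the direction determines the side of the edge
      refine card_le_two_of_line_of_circle U (p o) (normal e.1 e.2) r
        ((if 0 < dot δ₂ (normal e.1 e.2) then r else -r) + dot (normal e.1 e.2) e.1)
        (normal_ne_zero (hG.ne e heE)) hUp fun x hx => ?_
      obtain ⟨n, hn, hN⟩ := exists_normal_of_rests hG heE (hq x (hU hx)) (hqe x hx)
      have hab := (hq x (hU hx)).above
      have hqx := dot_normal_of_mem_segment (left_mem_segment ℝ e.1 e.2)
        (openSegment_subset_segment _ _ _ (hqe x hx))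
      have hxq : x - q x = r • n := sub_eq_of_eq_add' hn
      rw [hxq, dot_smul] at hab
      have hNN : dot (normal e.1 e.2) (normal e.1 e.2) = 1 := by
        rw [dot_self, norm_normal (hG.ne e heE), one_pow]
      have hx' : dot (normal e.1 e.2) x = dot (normal e.1 e.2) (q x) +
          r * dot (normal e.1 e.2) n := by
        rw [← dot_smul, ← dot_add, ← hn]
      have hab' : 0 < dot δ₂ n := by
        by_contra! h
        nlinarith
      rw [dot_sub] at hqx
      rcases hN with rfl | rfl
      · rw [if_pos hab', hx', hNN]; linarith
      · have hneg : ∀ v w : Plane, dot v (-w) = -dot v w := fun v w => by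
          simp only [dot, PiLp.neg_apply]; ring
        rw [hneg] at hab' hx'
        rw [if_neg (by linarith), hx', hNN]; linarith

end ClassCount

section Thickening

variable {W : Finset Plane} {E : Finset (Plane × Plane)} {L : Set Plane} {r : ℝ}

/-- Three directions, such that every unit vector has a large component in all but at most one of
them. -/
noncomputable def testDir : Fin 3 → Plane := ![!₂[1, 0], !₂[0, 1], !₂[3 / 5, 4 / 5]]

lemma norm_testDir (k : Fin 3) : ‖testDir k‖ = 1 := by
  rw [← sq_eq_sq₀ (norm_nonneg _) zero_le_one, norm_sq_eq]
  fin_cases k <;> norm_num [testDir]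

/-- A test direction in which two given unit vectors both have a large component: each of them
excludes at most one of the three directions. -/
lemma exists_testDir {u v : Plane} (hu : ‖u‖ = 1) (hv : ‖v‖ = 1) :
    ∃ k, 1 / 4 ≤ |dot (testDir k) u| ∧ 1 / 4 ≤ |dot (testDir k) v| := by
  have key : ∀ u : Plane, ‖u‖ = 1 → (1 / 4 ≤ |u 0| ∧ 1 / 4 ≤ |u 1|) ∨
      (1 / 4 ≤ |u 0| ∧ 1 / 4 ≤ |3 / 5 * u 0 + 4 / 5 * u 1|) ∨
      (1 / 4 ≤ |u 1| ∧ 1 / 4 ≤ |3 / 5 * u 0 + 4 / 5 * u 1|) := by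
    intro u hu
    have h := unit_sq hu
    by_contra! hcon
    obtain ⟨h1, h2, h3⟩ := hcon
    by_cases h0 : 1 / 4 ≤ |u 0|
    · have a1 := abs_lt.1 (h1 h0)
      have a2 := abs_lt.1 (h2 h0)
      nlinarith
    · have a0 := abs_lt.1 (not_le.1 h0)
      by_cases h4 : 1 / 4 ≤ |u 1|
      · have a1 := abs_lt.1 (h3 h4)
        nlinarith
      · have a1 := abs_lt.1 (not_le.1 h4)
        nlinarith
  have d0 : ∀ u, dot (testDir 0) u = u 0 := fun u => by simp [dot, testDir]
  have d1 : ∀ u, dot (testDir 1) u = u 1 := fun u => by simp [dot, testDir]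
  have d2 : ∀ u, dot (testDir 2) u = 3 / 5 * u 0 + 4 / 5 * u 1 := fun u => by simp [dot, testDir]
  by_contra! hcon
  have h0 := hcon 0
  have h1 := hcon 1
  have h2 := hcon 2
  simp only [d0, d1, d2] at h0 h1 h2
  have hu' := key u hu
  have hv' := key v hv
  rcases hu' with ⟨a, b⟩ | ⟨a, b⟩ | ⟨a, b⟩ <;> rcases hv' with ⟨a', b'⟩ | ⟨a', b'⟩ | ⟨a', b'⟩
  · linarith [h0 a]
  · linarith [h0 a]
  · linarith [h1 b]
  · linarith [h0 a]
  · linarith [h0 a]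
  · linarith [h2 b]
  · linarith [h1 a]
  · linarith [h2 b]
  · linarith [h1 a]

/-- The cell of a point in a square grid of mesh `r / 100`. -/
noncomputable def cell (r : ℝ) (x : Plane) : ℤ × ℤ := (⌊100 * x 0 / r⌋, ⌊100 * x 1 / r⌋)

lemma dist_le_of_cell_eq (hr : 0 < r) {x y : Plane} (h : cell r x = cell r y) :
    dist x y ≤ r / 64 := by
  have key : ∀ i : Fin 2, ⌊100 * x i / r⌋ = ⌊100 * y i / r⌋ → (x i - y i) ^ 2 ≤ (r / 100) ^ 2 := by
    intro i hi
    have h1 := Int.abs_sub_lt_one_of_floor_eq_floor hi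
    rw [← sub_div, ← mul_sub, abs_div, abs_of_pos hr, div_lt_one hr, abs_mul,
      abs_of_pos (by norm_num : (0 : ℝ) < 100)] at h1
    exact sq_le_sq.2 (by rw [abs_of_pos (by positivity : 0 < r / 100)]; linarith)
  rw [dist_le_iff' (by positivity)]
  simp only [cell, Prod.mk.injEq] at h
  have h0 := key 0 h.1
  have h1 := key 1 h.2
  nlinarith

/-- The cells at most `1201` rows and columns away from a given one: all that contain points at
distance less than `12 * r` from points of the given cell. -/
noncomputable def nearCells (Q : ℤ × ℤ) : Finset (ℤ × ℤ) :=
  Finset.Icc (Q.1 - 1201) (Q.1 + 1201) ×ˢ Finset.Icc (Q.2 - 1201) (Q.2 + 1201)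

lemma mem_nearCells_of_dist (hr : 0 < r) {x w : Plane} (h : dist x w < 12 * r) :
    cell r x ∈ nearCells (cell r w) := by
  rw [dist_lt_iff' (by positivity)] at h
  have key : ∀ i : Fin 2, (x i - w i) ^ 2 < (12 * r) ^ 2 →
      ⌊100 * x i / r⌋ ∈ Finset.Icc (⌊100 * w i / r⌋ - 1201) (⌊100 * w i / r⌋ + 1201) := by
    intro i hi
    have h1 := abs_lt_of_sq_lt_sq hi (by positivity)
    have h2 : |100 * x i / r - 100 * w i / r| < 1200 := by
      rw [← sub_div, ← mul_sub, abs_div, abs_of_pos hr, div_lt_iff₀ hr, abs_mul,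
        abs_of_pos (by norm_num : (0 : ℝ) < 100)]
      linarith
    have h3 := abs_lt.1 h2
    have a1 := Int.floor_le (100 * x i / r)
    have a2 := Int.lt_floor_add_one (100 * x i / r)
    have b1 := Int.floor_le (100 * w i / r)
    have b2 := Int.lt_floor_add_one (100 * w i / r)
    rw [Finset.mem_Icc]
    constructor
    · have : ((⌊100 * w i / r⌋ - 1201 : ℤ) : ℝ) < (⌊100 * x i / r⌋ : ℝ) := by
        push_cast; linarith
      exact (Int.cast_lt.1 this).le
    · have : (⌊100 * x i / r⌋ : ℝ) < ((⌊100 * w i / r⌋ + 1201 : ℤ) : ℝ) := by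
        push_cast; linarith
      exact (Int.cast_lt.1 this).le
  refine Finset.mem_product.2 ⟨key 0 ?_, key 1 ?_⟩
  · nlinarith [sq_nonneg (x 1 - w 1)]
  · nlinarith [sq_nonneg (x 0 - w 0)]

lemma card_nearCells (Q : ℤ × ℤ) : (nearCells Q).card = 2403 * 2403 := by
  have : ∀ a : ℤ, (a + 1201 + 1 - (a - 1201)).toNat = 2403 := fun a => by
    have : a + 1201 + 1 - (a - 1201) = 2403 := by ring
    rw [this]; rfl
  rw [nearCells, Finset.card_product, Int.card_Icc, Int.card_Icc, this, this]

/-- The number of boundary points equally near to a vertex and to another point of the network is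
linear: they are classified by a test direction and the signs of both contacts in it, and by their
cell, and `card_class_le` counts the points of a class. -/
theorem card_vertex_events_le (hG : Network W E) (hL : IsThickening (netSupport W E) L r)
    (hr : 0 < r) (T : Finset Plane) (hT : ∀ x ∈ T, x ∈ frontier L ∧ ∃ p ∈ W,
      ∃ q ∈ netSupport W E, p ≠ q ∧ dist x p = r ∧ dist x q = r) :
    T.card ≤ 12 * (20 * (2403 * 2403 * W.card)) := by
  classical
  choose! p hpW q hqS hpq hxp hxq using fun x hx => (hT x hx).2
  -- the directions of both contacts
  let sg : Bool → Plane → Plane := fun b δ => if b then δ else -δ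
  have hsg : ∀ b δ, sg b δ = δ ∨ sg b δ = -δ := fun b δ => by cases b <;> simp [sg]
  have exdir : ∀ x ∈ T, ∃ i : Fin 3 × Bool × Bool,
      Rests (netSupport W E) r (sg i.2.1 (testDir i.1)) x (p x) ∧
      Rests (netSupport W E) r (sg i.2.2 (testDir i.1)) x (q x) := by
    intro x hx
    have hunit : ∀ z, dist x z = r → ‖r⁻¹ • (x - z)‖ = 1 := fun z hz => by
      rw [norm_smul, ← dist_eq_norm, hz, Real.norm_eq_abs, abs_of_pos (inv_pos.2 hr),
        inv_mul_cancel₀ hr.ne']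
    obtain ⟨k, h1, h2⟩ := exists_testDir (hunit _ (hxp x hx)) (hunit _ (hxq x hx))
    have exsg : ∀ z ∈ netSupport W E, dist x z = r → 1 / 4 ≤ |dot (testDir k) (r⁻¹ • (x - z))| →
        ∃ b, Rests (netSupport W E) r (sg b (testDir k)) x z := by
      intro z hz hxz hk
      rw [dot_smul, abs_mul, abs_of_pos (inv_pos.2 hr), inv_mul_eq_div, le_div_iff₀ hr] at hk
      have hfar := hL.far x (hT x hx).1
      rcases le_total 0 (dot (testDir k) (x - z)) with h | h
      · rw [abs_of_nonneg h] at hk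
        exact ⟨true, hz, hxz, by simp only [sg, if_true]; linarith, hfar⟩
      · rw [abs_of_nonpos h] at hk
        refine ⟨false, hz, hxz, ?_, hfar⟩
        have : dot (-testDir k) (x - z) = -dot (testDir k) (x - z) := by
          simp only [dot, PiLp.neg_apply]; ring
        simp only [sg, Bool.false_eq_true, if_false]
        rw [this]; linarith
    obtain ⟨b, hb⟩ := exsg _ (Or.inl (hpW x hx)) (hxp x hx) h1
    obtain ⟨b', hb'⟩ := exsg _ (hqS x hx) (hxq x hx) h2
    exact ⟨(k, b, b'), hb, hb'⟩
  choose! dir hdp hdq using exdir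
  have hclass : ∀ i : Fin 3 × Bool × Bool, (T.filter fun x => dir x = i).card ≤
      20 * (2403 * 2403 * W.card) := by
    intro i
    set Ti := T.filter fun x => dir x = i with hTi
    have hmem : ∀ x ∈ Ti, x ∈ T ∧ dir x = i := fun x hx => Finset.mem_filter.1 hx
    -- the vertices that may be close to the points in the cell `Q`
    let near (Q : ℤ × ℤ) := W.filter fun w => Q ∈ nearCells (cell r w)
    have hcell : ∀ Q, (Ti.filter fun x => cell r x = Q).card ≤ 20 * (near Q).card := by
      intro Q
      have hm : ∀ x ∈ Ti.filter (fun x => cell r x = Q), x ∈ T ∧ dir x = i ∧ cell r x = Q :=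
        fun x hx => by
          obtain ⟨h1, h2⟩ := Finset.mem_filter.1 hx
          exact ⟨(hmem x h1).1, (hmem x h1).2, h2⟩
      refine card_class_le hG hr (norm_testDir i.1) (hsg i.2.1 _) (hsg i.2.2 _) _ p q ?_ ?_ ?_ ?_ ?_
        (near Q) ?_
      · intro x hx y hy
        exact dist_le_of_cell_eq hr ((hm x hx).2.2.trans (hm y hy).2.2.symm)
      · exact fun x hx => hpW x (hm x hx).1
      · exact fun x hx => hpq x (hm x hx).1
      · intro x hx
        have := hdp x (hm x hx).1
        rwa [(hm x hx).2.1] at this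
      · intro x hx
        have := hdq x (hm x hx).1
        rwa [(hm x hx).2.1] at this
      · intro x hx w hw hd
        refine Finset.mem_filter.2 ⟨hw, ?_⟩
        rw [← (hm x hx).2.2]
        exact mem_nearCells_of_dist hr hd
    let Qs := Ti.image (cell r)
    calc Ti.card = ∑ Q ∈ Qs, (Ti.filter fun x => cell r x = Q).card :=
          Finset.card_eq_sum_card_fiberwise fun x hx => Finset.mem_image_of_mem _ hx
      _ ≤ ∑ Q ∈ Qs, 20 * (near Q).card := Finset.sum_le_sum fun Q _ => hcell Q
      _ = 20 * ∑ Q ∈ Qs, (near Q).card := by rw [Finset.mul_sum]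
      -- double counting: every vertex is close to a bounded number of cells
      _ = 20 * ∑ w ∈ W, (Qs.filter fun Q => Q ∈ nearCells (cell r w)).card := by
          congr 1
          exact Finset.sum_card_bipartiteAbove_eq_sum_card_bipartiteBelow
            (fun Q w => Q ∈ nearCells (cell r w))
      _ ≤ 20 * ∑ w ∈ W, 2403 * 2403 := by
          gcongr with w hw
          rw [← card_nearCells (cell r w)]
          exact Finset.card_le_card fun Q hQ => (Finset.mem_filter.1 hQ).2
      _ = 20 * (2403 * 2403 * W.card) := by
          rw [Finset.sum_const, smul_eq_mul]; ring
  calc T.card = ∑ i : Fin 3 × Bool × Bool, (T.filter fun x => dir x = i).card :=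
        Finset.card_eq_sum_card_fiberwise fun x _ => Finset.mem_univ _
    _ ≤ ∑ _i : Fin 3 × Bool × Bool, 20 * (2403 * 2403 * W.card) :=
        Finset.sum_le_sum fun i _ => hclass i
    _ = 12 * (20 * (2403 * 2403 * W.card)) := by
        rw [Finset.sum_const, smul_eq_mul]; rfl

/-- The boundary of a thickened network has an outline of linear size. -/
theorem exists_outline_of_thickening (hG : Network W E)
    (hL : IsThickening (netSupport W E) L r) (hr : 0 < r) :
    ∃ (C : Finset Curve) (Z : Finset Plane), Outline (frontier L) C Z r 4 ∧
      C.card ≤ 3 * W.card ∧ Z.card ≤ 1400000000 * W.card := by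
  classical
  have hE := hG.card_le
  obtain ⟨T, hT, hTc⟩ := exists_finset_of_card_le {x | x ∈ frontier L ∧ ∃ p ∈ netSupport W E,
    ∃ q ∈ netSupport W E, p ≠ q ∧ dist x p = r ∧ dist x q = r}
    (4 * W.card + 12 * (20 * (2403 * 2403 * W.card))) fun T hT => by
      -- the points near to a vertex are separated from those near to edges only
      let T₁ := T.filter fun x => ∃ p ∈ W, ∃ q ∈ netSupport W E, p ≠ q ∧ dist x p = r ∧ dist x q = r
      have h1 : T₁.card ≤ _ := card_vertex_events_le hG hL hr T₁ fun x hx =>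
        ⟨(hT (Finset.mem_filter.1 hx).1).1, (Finset.mem_filter.1 hx).2⟩
      have h2 : (T \ T₁).card ≤ 4 * E.card := by
        refine card_edge_edge_le hG hL hr _ fun x hx => ?_
        obtain ⟨hxT, hx1⟩ := Finset.mem_sdiff.1 hx
        have hno : ¬ ∃ p ∈ W, ∃ q ∈ netSupport W E, p ≠ q ∧ dist x p = r ∧ dist x q = r :=
          fun h => hx1 (Finset.mem_filter.2 ⟨hxT, h⟩)
        obtain ⟨hxL, p, hp, q, hq, hpq, hxp, hxq⟩ := hT hxT
        refine ⟨hxL, p, q, hpq, hxp, hxq, ?_, ?_⟩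
        · exact hp.resolve_left fun h => hno ⟨p, h, q, hq, hpq, hxp, hxq⟩
        · exact hq.resolve_left fun h => hno ⟨q, h, p, hp, hpq.symm, hxq, hxp⟩
      have h3 := Finset.card_le_card_sdiff_add_card (s := T) (t := T₁)
      omega
  obtain ⟨C, Z, hO, hC, hZ⟩ := exists_outline_of_events hG hL hr T
    fun x hx hxT p hp q hq h1 h2 => by
    by_contra hne
    refine hxT ?_
    rw [← Finset.mem_coe, hT]
    exact ⟨hx, p, hp, q, hq, hne, h1, h2⟩
  exact ⟨C, Z, hO, by omega, by omega⟩

end Thickening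

/-! ### Thickening a set bounded by a network -/

section Sums

variable {W : Finset Plane} {E : Finset (Plane × Plane)} {B : Set Plane} {r : ℝ}

lemma subset_interior_of_disjoint_frontier {V : Set Plane} (hV : IsPreconnected V)
    (h : ∀ x ∈ V, x ∉ frontier B) (hx : ∃ x ∈ V, x ∈ B) : V ⊆ interior B := by
  refine IsPreconnected.subset_left_of_subset_union isOpen_interior
    (isClosed_closure (s := B)).isOpen_compl
    (disjoint_left.2 fun x h1 h2 => h2 (subset_closure (interior_subset h1))) ?_ ?_ hV
  · intro x hxV
    by_cases h1 : x ∈ interior B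
    · exact Or.inl h1
    · exact Or.inr fun h2 => h x hxV ⟨h2, h1⟩
  · obtain ⟨x, hxV, hxB⟩ := hx
    refine ⟨x, hxV, ?_⟩
    by_contra h1
    exact h x hxV ⟨subset_closure hxB, h1⟩

/-- On the way from a point of `B` to a point outside, the boundary of `B` is met. -/
lemma exists_frontier_dist_le {b y : Plane} (hb : b ∈ B) (hy : y ∉ B) :
    ∃ q ∈ frontier B, dist y q ≤ dist y b := by
  by_contra! h
  have hsub : segment ℝ b y ⊆ interior B := by
    refine subset_interior_of_disjoint_frontier (convex_segment b y).isPreconnected ?_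
      ⟨b, left_mem_segment ℝ b y, hb⟩
    intro q hq hqf
    refine (h q hqf).not_ge ?_
    obtain ⟨t, ht, rfl⟩ := mem_segment_iff.1 hq
    have : y - (b + t • (y - b)) = (1 - t) • (y - b) := by module
    rw [dist_eq_norm, this, norm_smul, dist_eq_norm, Real.norm_eq_abs,
      abs_of_nonneg (by linarith [ht.2])]
    nlinarith [ht.1, norm_nonneg (y - b)]
  exact hy (interior_subset (hsub (right_mem_segment ℝ b y)))

lemma mem_add_closedBall {y : Plane} :
    y ∈ B + closedBall (0 : Plane) r ↔ ∃ b ∈ B, dist y b ≤ r := by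
  rw [Set.mem_add]
  constructor
  · rintro ⟨b, hb, v, hv, rfl⟩
    exact ⟨b, hb, by simpa [dist_eq_norm] using hv⟩
  · rintro ⟨b, hb, h⟩
    exact ⟨b, hb, y - b, by simpa [dist_eq_norm] using h, by abel⟩

/-- A boundary point of `B ⊕ D_r` is not in `B`, and on the way to it from `B` the boundary of `B`
is met; so near this point only the distance to the network matters. -/
theorem isThickening_add_closedBall (hr : 0 < r) (hB : IsCompact B) {S : Set Plane}
    (hfS : frontier B ⊆ S) (hSB : S ⊆ B) : IsThickening S (B + closedBall (0 : Plane) r) r := by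
  have hcl : IsClosed (B + closedBall (0 : Plane) r) :=
    (hB.add (isCompact_closedBall 0 r)).isClosed
  have hfar : ∀ x ∈ frontier (B + closedBall (0 : Plane) r), ∀ b ∈ B, r ≤ dist x b := by
    intro x hx b hb
    by_contra! hlt
    refine hx.2 (mem_interior_iff_mem_nhds.2 ?_)
    have hc : Continuous fun y : Plane => dist y b := by fun_prop
    filter_upwards [hc.continuousAt.eventually (gt_mem_nhds hlt)] with y hy
    exact mem_add_closedBall.2 ⟨b, hb, le_of_lt hy⟩
  refine ⟨fun x hx q hq => hfar x hx q (hSB hq), fun x hx => ?_, fun x hx => ?_⟩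
  · obtain ⟨b, hb, hd⟩ := mem_add_closedBall.1 (hcl.frontier_subset hx)
    have hxB : x ∉ B := fun h => by have := hfar x hx x h; rw [dist_self] at this; linarith
    obtain ⟨q, hq, hqd⟩ := exists_frontier_dist_le hb hxB
    exact ⟨q, hfS hq, le_antisymm (hqd.trans hd) (hfar x hx q (hSB (hfS hq)))⟩
  · have hxB : x ∉ B := fun h => by have := hfar x hx x h; rw [dist_self] at this; linarith
    filter_upwards [hB.isClosed.isOpen_compl.mem_nhds hxB] with y hy
    rw [mem_add_closedBall]
    constructor
    · rintro ⟨b, hb, hd⟩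
      obtain ⟨q, hq, hqd⟩ := exists_frontier_dist_le hb hy
      exact ⟨q, hfS hq, hqd.trans hd⟩
    · rintro ⟨q, hq, hd⟩
      exact ⟨q, hSB hq, hd⟩

/-- Near an interior point of an edge, a network consists of this edge only. -/
lemma Network.eventually_mem_segment (hG : Network W E) {x : Plane} {e : Plane × Plane}
    (he : e ∈ E) (hx : x ∈ openSegment ℝ e.1 e.2) :
    ∀ᶠ y in 𝓝 x, y ∈ netSupport W E → y ∈ segment ℝ e.1 e.2 := by
  have hxW : x ∉ W := fun h => hG.avoid e he x h hx
  have hW : ∀ᶠ y in 𝓝 x, y ∉ W := W.finite_toSet.isClosed.isOpen_compl.mem_nhds hxW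
  have hE : ∀ᶠ y in 𝓝 x, ∀ f ∈ E, f ≠ e → y ∉ segment ℝ f.1 f.2 := by
    rw [Filter.eventually_all_finset]
    intro f hf
    by_cases hfe : f = e
    · filter_upwards with y h
      exact (h hfe).elim
    have hxf : x ∉ segment ℝ f.1 f.2 := by
      rw [← insert_endpoints_openSegment]
      rintro (h | h | h)
      · exact hxW (h ▸ hG.tail_mem f hf)
      · exact hxW (h ▸ hG.head_mem f hf)
      · exact hfe (hG.disjoint f hf e he x h hx)
    have hcpt : IsCompact (segment ℝ f.1 f.2) := by
      rw [segment_eq_image']; exact isCompact_Icc.image (by fun_prop)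
    filter_upwards [hcpt.isClosed.isOpen_compl.mem_nhds hxf] with y hy _
    exact hy
  filter_upwards [hW, hE] with y h1 h2 h3
  rcases h3 with h3 | ⟨f, hf, h3⟩
  · exact (h1 h3).elim
  · have h4 := openSegment_subset_segment ℝ _ _ h3
    by_cases hfe : f = e
    · rwa [← hfe]
    · exact (h2 f hf hfe h4).elim

/-- Every edge of the network runs along the boundary of `B` near each of its interior points that
are boundary points: the half-discs on its two sides do not both belong to `B`. -/
lemma frontier_eq_edge (hG : Network W E) (hB : IsClosed B) (hfS : frontier B ⊆ netSupport W E)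
    (hSB : netSupport W E ⊆ B) {x : Plane} (hx : x ∈ frontier B) {e : Plane × Plane} (he : e ∈ E)
    (hxe : x ∈ openSegment ℝ e.1 e.2) :
    ∀ᶠ y in 𝓝 x, (y ∈ frontier B ↔ y ∈ segment ℝ e.1 e.2) := by
  have hN := norm_normal (hG.ne e he)
  have hxs := openSegment_subset_segment ℝ _ _ hxe
  have hfoot := eventually_mem_openSegment hxe
  have hperp : ∀ y ∈ segment ℝ e.1 e.2, dot (normal e.1 e.2) (y - x) = 0 := fun y hy =>
    dot_normal_of_mem_segment hxs hy
  set N := normal e.1 e.2 with hNdef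
  have hs0 : dot (rot N) (x - x) = 0 := by simp [dot]
  have hcs : Continuous fun y : Plane => dot (rot N) (y - x) :=
    (continuous_dot _).comp (by fun_prop)
  have hev : ∀ᶠ y in 𝓝 x, (y ∈ netSupport W E → y ∈ segment ℝ e.1 e.2) ∧
      x + dot (rot N) (y - x) • rot N ∈ openSegment ℝ e.1 e.2 :=
    (hG.eventually_mem_segment he hxe).and
      (hcs.continuousAt.eventually (show ∀ᶠ s in 𝓝 (dot (rot N) (x - x)), _ by
        rw [hs0]; exact hfoot))
  obtain ⟨ε, hε, hball⟩ := Metric.eventually_nhds_iff_ball.1 hev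
  -- the two half-discs
  let H (σ : ℝ) : Set Plane := ball x ε ∩ {y | 0 < dot (σ • N) (y - x)}
  have hHconv : ∀ σ, Convex ℝ (H σ) := by
    intro σ
    refine (convex_ball x ε).inter ?_
    have : {y : Plane | 0 < dot (σ • N) (y - x)} = {y | dot (σ • N) x < dot (σ • N) y} := by
      ext y
      rw [mem_ofPred_eq, mem_ofPred_eq, dot_sub, sub_pos]
    rw [this]
    exact convex_halfSpace_gt ⟨fun a b => dot_add _ a b, fun c a => dot_smul _ a c⟩ _
  have hsm : ∀ (σ : ℝ) v, dot (σ • N) v = σ * dot N v := fun σ v => by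
    rw [dot_comm, dot_smul, dot_comm]
  have hHf : ∀ σ, ∀ y ∈ H σ, y ∉ frontier B := by
    rintro σ y ⟨hy1, hy2⟩ hyf
    have h1 := hperp y ((hball y hy1).1 (hfS hyf))
    rw [mem_ofPred_eq, hsm, h1, mul_zero] at hy2
    exact lt_irrefl _ hy2
  have hout : ∃ σ : ℝ, σ ≠ 0 ∧ ∀ y ∈ H σ, y ∉ B := by
    by_contra! hcon
    have hin : ∀ σ : ℝ, σ ≠ 0 → H σ ⊆ interior B := fun σ hσ => by
      obtain ⟨y, hy, hyB⟩ := hcon σ hσ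
      exact subset_interior_of_disjoint_frontier (hHconv σ).isPreconnected (hHf σ) ⟨y, hy, hyB⟩
    refine hx.2 (mem_interior_iff_mem_nhds.2 (mem_of_superset (ball_mem_nhds x hε) fun y hy => ?_))
    rcases lt_trichotomy (dot N (y - x)) 0 with h | h | h
    · refine interior_subset (hin (-1) (by norm_num) ⟨hy, ?_⟩)
      rw [mem_ofPred_eq, hsm]; linarith
    · refine hSB ?_
      have h1 := frame_expand hN (y - x)
      rw [h, zero_smul, add_zero] at h1
      have h2 := (hball y hy).2
      rw [← h1, add_sub_cancel] at h2
      exact Or.inr ⟨e, he, h2⟩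
    · refine interior_subset (hin 1 one_ne_zero ⟨hy, ?_⟩)
      rw [mem_ofPred_eq, hsm]; linarith
  obtain ⟨σ, hσ, hout⟩ := hout
  filter_upwards [ball_mem_nhds x hε] with y hy
  refine ⟨fun h => (hball y hy).1 (hfS h), fun h => ?_⟩
  have hyS := hG.segment_subset (mem_darts.2 (Or.inl he)) h
  rw [hB.frontier_eq]
  refine ⟨hSB hyS, fun hint => ?_⟩
  have hc : ContinuousAt (fun s : ℝ => y + s • (σ • N)) 0 := by fun_prop
  have h1 : ∀ᶠ s in 𝓝 (0 : ℝ), y + s • (σ • N) ∈ interior B ∩ ball x ε :=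
    hc.eventually ((isOpen_interior.inter isOpen_ball).mem_nhds (by simpa using ⟨hint, hy⟩))
  obtain ⟨s, hs, hs0⟩ := ((h1.filter_mono nhdsWithin_le_nhds).and
    (self_mem_nhdsWithin : Ioi (0 : ℝ) ∈ 𝓝[>] 0)).exists
  refine hout _ ⟨hs.2, ?_⟩ (interior_subset hs.1)
  have h2 : y + s • (σ • N) - x = (y - x) + s • (σ • N) := by abel
  rw [mem_ofPred_eq, h2, dot_add, hsm, hperp y h, dot_smul, dot_self, norm_smul, hN, mul_zero,
    zero_add, mul_one, Real.norm_eq_abs, sq_abs]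
  have : (0 : ℝ) < s := hs0
  positivity

/-- The outline of a set bounded by a network consists of edges. At most one piece leaves a point,
as a vertex is the tail of at most one edge. -/
theorem exists_outline_of_frontier_subset (hG : Network W E) (hB : IsClosed B)
    (hfS : frontier B ⊆ netSupport W E) (hSB : netSupport W E ⊆ B) (r : ℝ) :
    ∃ C : Finset Curve, Outline (frontier B) C W r 4 ∧ C.card ≤ W.card := by
  classical
  let s : Plane × Plane → Curve := fun e => seg e.1 e.2
  have hmem : ∀ {c}, c ∈ E.image s ↔ ∃ e ∈ E, s e = c := by simp
  have hopen : ∀ {x}, x ∉ W → ∀ e ∈ E, x ∈ segment ℝ e.1 e.2 → x ∈ openSegment ℝ e.1 e.2 := by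
    intro x hx e he h
    rw [← insert_endpoints_openSegment] at h
    rcases h with h | h | h
    · exact (hx (h ▸ hG.tail_mem e he)).elim
    · exact (hx (h ▸ hG.head_mem e he)).elim
    · exact h
  refine ⟨E.image s, ⟨?_, ?_, ?_, ?_, ?_, ?_, ?_⟩, Finset.card_image_le.trans hG.card_le⟩
  · intro c hc
    obtain ⟨e, he, rfl⟩ := hmem.1 hc
    exact hG.ne e he
  · intro v r' hc
    obtain ⟨e, he, h⟩ := hmem.1 hc
    cases h
  · intro v hc
    obtain ⟨e, he, h⟩ := hmem.1 hc
    cases h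
  · intro c hc
    obtain ⟨e, he, rfl⟩ := hmem.1 hc
    simp only [s, path, AffineMap.lineMap_apply_zero, AffineMap.lineMap_apply_one]
    exact ⟨fun _ => hG.tail_mem e he, fun _ => hG.head_mem e he⟩
  · intro x hx hxW
    obtain ⟨e, he, hxe⟩ := (hfS hx).resolve_left hxW
    exact ⟨s e, hmem.2 ⟨e, he, rfl⟩, openSegment_subset_segment _ _ _ hxe,
      frontier_eq_edge hG hB hfS hSB hx he hxe⟩
  · intro x _ hxW c hc c' hc' hxc hxc'
    obtain ⟨e, he, rfl⟩ := hmem.1 hc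
    obtain ⟨f, hf, rfl⟩ := hmem.1 hc'
    rw [hG.disjoint e he f hf x (hopen hxW e he hxc) (hopen hxW f hf hxc')]
  · intro z J hJ hg
    refine le_trans ?_ (show 1 ≤ 4 by norm_num)
    refine Finset.card_le_one.2 fun c hc c' hc' => ?_
    have key : ∀ c ∈ J, ∃ e ∈ E, s e = c ∧ (z = e.1 ∨ z ∈ openSegment ℝ e.1 e.2) := by
      intro c hc
      obtain ⟨e, he, rfl⟩ := hmem.1 (hJ hc)
      obtain ⟨t, ht, hz, -⟩ := hg _ hc
      simp only [s, path, AffineMap.lineMap_apply_module'] at hz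
      refine ⟨e, he, rfl, ?_⟩
      rcases eq_or_lt_of_le ht.1 with h | h
      · left; rw [← hz, ← h]; module
      · right; exact mem_openSegment_iff.2 ⟨t, ⟨h, ht.2⟩, by rw [← hz]; module⟩
    obtain ⟨e, he, rfl, h⟩ := key c hc
    obtain ⟨f, hf, rfl, h'⟩ := key c' hc'
    rcases h with rfl | h <;> rcases h' with h' | h'
    · rw [hG.tail_inj e he f hf h']
    · exact (hG.avoid f hf _ (hG.tail_mem e he) h').elim
    · exact (hG.avoid e he _ (hG.tail_mem f hf) (h' ▸ h)).elim
    · rw [hG.disjoint e he f hf z h h']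

/-- A compact set bounded by a network, thickened by any radius, has an outline of linear size. -/
theorem exists_outline (hG : Network W E) (hB : IsCompact B) (hfS : frontier B ⊆ netSupport W E)
    (hSB : netSupport W E ⊆ B) (hr : 0 ≤ r) :
    ∃ (C : Finset Curve) (Z : Finset Plane),
      Outline (frontier (B + closedBall (0 : Plane) r)) C Z r 4 ∧
      C.card ≤ 3 * W.card ∧ Z.card ≤ 1400000000 * W.card := by
  rcases eq_or_lt_of_le hr with rfl | hr
  · rw [closedBall_zero, singleton_zero, add_zero]
    obtain ⟨C, hC, hc⟩ := exists_outline_of_frontier_subset hG hB.isClosed hfS hSB 0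
    exact ⟨C, W, hC, by omega, by omega⟩
  · exact exists_outline_of_thickening hG (isThickening_add_closedBall hr hB hfS hSB) hr

end Sums

/-! ### The boundary of a convex polygon -/

lemma mem_segment_of_dot_eq {ν x y z : Plane} (hν : ν ≠ 0) (hxy : dot ν x = dot ν y)
    (hyz : dot ν y = dot ν z) (h1 : dot (rot ν) x < dot (rot ν) y)
    (h2 : dot (rot ν) y < dot (rot ν) z) : y ∈ segment ℝ x z := by
  obtain ⟨w, hw, hwy⟩ := exists_mem_segment_of_dot h1.le h2.le (h1.trans h2)
  have : w = y := eq_of_frame hν hwy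
    (dot_eq_of_mem_segment hw hxy hyz.symm)
  rwa [← this]

/-- No three points of a convexly independent family are on a line. -/
lemma not_on_line_of_convexIndependent {n : ℕ} {p : Fin n → Plane} (hp : ConvexIndependent ℝ p)
    {ν : Plane} (hν : ν ≠ 0) {i j k : Fin n} (hij : i ≠ j) (hik : i ≠ k) (hjk : j ≠ k)
    (h1 : dot ν (p i) = dot ν (p j)) (h2 : dot ν (p j) = dot ν (p k)) : False := by
  have key : ∀ a b c : Fin n, b ≠ a → b ≠ c → dot ν (p a) = dot ν (p b) →
      dot ν (p b) = dot ν (p c) → dot (rot ν) (p a) < dot (rot ν) (p b) →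
      dot (rot ν) (p b) < dot (rot ν) (p c) → False := by
    intro a b c hba hbc e1 e2 l1 l2
    have h3 := mem_segment_of_dot_eq hν e1 e2 l1 l2
    have h4 := hp {a, c} b (by rw [image_pair, convexHull_pair]; exact h3)
    rcases h4 with h | h
    · exact hba h
    · exact hbc h
  have hne : ∀ a b : Fin n, a ≠ b → dot ν (p a) = dot ν (p b) →
      dot (rot ν) (p a) ≠ dot (rot ν) (p b) := fun a b hab e h =>
    hab (hp.injective (eq_of_frame hν h e))
  rcases lt_or_gt_of_ne (hne i j hij h1) with a | a <;>
    rcases lt_or_gt_of_ne (hne j k hjk h2) with b | b <;>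
    rcases lt_or_gt_of_ne (hne i k hik (h1.trans h2)) with c | c
  · exact key i j k hij.symm hjk h1 h2 a b
  · linarith
  · exact key i k j hik.symm hjk.symm (h1.trans h2) h2.symm c b
  · exact key k i j hik hij (h1.trans h2).symm h1 c a
  · exact key j i k hij hik h1.symm (h1.trans h2) a c
  · exact key j k i hjk.symm hik.symm h2 (h1.trans h2).symm b c
  · linarith
  · exact key k j i hjk hij.symm h2.symm h1.symm b a

lemma dot_normal_eq (a b v : Plane) : dot (normal a b) v = -(‖b - a‖⁻¹ * dot (rot (b - a)) v) := by
  simp only [normal, dot, PiLp.smul_apply, PiLp.neg_apply, smul_eq_mul]; ring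

/-- The edges of the convex hull of a family of points, counterclockwise: no point is on the right
of an edge. -/
noncomputable def hullEdges {n : ℕ} (p : Fin n → Plane) : Finset (Plane × Plane) :=
  open Classical in ((Finset.univ : Finset (Fin n × Fin n)).filter fun ij => ij.1 ≠ ij.2 ∧
    ∀ k, dot (normal (p ij.1) (p ij.2)) (p k) ≤ dot (normal (p ij.1) (p ij.2)) (p ij.1)).image
      fun ij => (p ij.1, p ij.2)

lemma mem_hullEdges {n : ℕ} {p : Fin n → Plane} {e : Plane × Plane} :
    e ∈ hullEdges p ↔ ∃ i j, i ≠ j ∧ (∀ k, dot (normal (p i) (p j)) (p k) ≤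
      dot (normal (p i) (p j)) (p i)) ∧ e = (p i, p j) := by
  classical
  simp only [hullEdges, Finset.mem_image, Finset.mem_filter, Finset.mem_univ, true_and, Prod.exists]
  constructor
  · rintro ⟨i, j, ⟨h1, h2⟩, rfl⟩; exact ⟨i, j, h1, h2, rfl⟩
  · rintro ⟨i, j, h1, h2, rfl⟩; exact ⟨i, j, ⟨h1, h2⟩, rfl⟩

lemma dot_normal_head (a b : Plane) : dot (normal a b) b = dot (normal a b) a := by
  have := dot_normal a b
  rw [dot_sub] at this; linarith

/-- Two edges whose relative interiors meet lie on one line, which contains only two of the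
points. -/
theorem network_hull {n : ℕ} (hn : 3 ≤ n) {p : Fin n → Plane} (hp : ConvexIndependent ℝ p) :
    Network (Finset.univ.image p) (hullEdges p) := by
  classical
  have hinj := hp.injective
  have hthird : ∀ i j : Fin n, ∃ k, k ≠ i ∧ k ≠ j := by
    intro i j
    have : ({i, j} : Finset (Fin n)).card < (Finset.univ : Finset (Fin n)).card := by
      rw [Finset.card_univ, Fintype.card_fin]
      exact lt_of_le_of_lt Finset.card_le_two (by omega)
    obtain ⟨k, -, hk⟩ := Finset.exists_mem_notMem_of_card_lt_card this
    simp only [Finset.mem_insert, Finset.mem_singleton, not_or] at hk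
    exact ⟨k, hk.1, hk.2⟩
  -- two edges at a vertex, both with all points on the left, are on one line
  have hcoll : ∀ {a b v : Plane} {d : Plane}, a ≠ b → 0 ≤ dot (rot v) d → d = b - a →
      dot (normal a b) v ≤ 0 → dot (normal a b) v = 0 := by
    rintro a b v d hab h1 rfl h2
    rw [dot_normal_eq] at h2 ⊢
    have h3 : dot (rot v) (b - a) = -dot (rot (b - a)) v := by
      simp only [dot, rot_zero, rot_one]; ring
    have hpos : 0 < ‖b - a‖⁻¹ := inv_pos.2 (norm_pos_iff.2 (sub_ne_zero.2 hab.symm))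
    have h4 : 0 ≤ dot (rot (b - a)) v := by
      by_contra! h
      have := mul_neg_of_pos_of_neg hpos h
      linarith
    have h5 : dot (rot (b - a)) v = 0 := by linarith
    rw [h5]; ring
  refine ⟨?_, ?_, ?_, ?_, ?_, ?_, ?_⟩
  · intro e he
    obtain ⟨i, j, -, -, rfl⟩ := mem_hullEdges.1 he
    exact Finset.mem_image_of_mem _ (Finset.mem_univ _)
  · intro e he
    obtain ⟨i, j, -, -, rfl⟩ := mem_hullEdges.1 he
    exact Finset.mem_image_of_mem _ (Finset.mem_univ _)
  · intro e he
    obtain ⟨i, j, hij, -, rfl⟩ := mem_hullEdges.1 he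
    exact fun h => hij (hinj h)
  · intro e he w hw h
    obtain ⟨i, j, hij, -, rfl⟩ := mem_hullEdges.1 he
    obtain ⟨k, -, rfl⟩ := Finset.mem_image.1 hw
    have h4 := hp {i, j} k (by
      rw [image_pair, convexHull_pair]; exact openSegment_subset_segment _ _ _ h)
    rcases h4 with rfl | h4
    · exact hij (hinj (left_mem_openSegment_iff.1 h))
    · rw [mem_singleton_iff.1 h4] at h
      exact hij (hinj (right_mem_openSegment_iff.1 h))
  · intro e he f hf x hx hx'
    obtain ⟨i, j, hij, hS, rfl⟩ := mem_hullEdges.1 he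
    obtain ⟨i', j', hij', hS', rfl⟩ := mem_hullEdges.1 hf
    have hN0 := normal_ne_zero (fun h => hij (hinj h) : p i ≠ p j)
    have hxN : dot (normal (p i) (p j)) x = dot (normal (p i) (p j)) (p i) :=
      dot_eq_of_mem_segment (openSegment_subset_segment _ _ _ hx) rfl (dot_normal_head _ _)
    -- the second edge is on the line of the first one
    have hi' : dot (normal (p i) (p j)) (p i') = dot (normal (p i) (p j)) (p i) ∧
        dot (normal (p i) (p j)) (p j') = dot (normal (p i) (p j)) (p i) := by
      obtain ⟨t, ht, rfl⟩ := mem_openSegment_iff.1 hx'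
      rw [dot_add, dot_smul, dot_sub] at hxN
      have h1 := hS i'
      have h2 := hS j'
      constructor <;> nlinarith [ht.1, ht.2]
    have hmem : ∀ k, dot (normal (p i) (p j)) (p k) = dot (normal (p i) (p j)) (p i) →
        k = i ∨ k = j := by
      intro k hk
      by_contra! h
      exact not_on_line_of_convexIndependent hp hN0 hij h.1.symm h.2.symm (dot_normal_head _ _).symm
        ((dot_normal_head _ _).trans hk.symm)
    rcases hmem i' hi'.1 with rfl | rfl <;> rcases hmem j' hi'.2 with rfl | rfl
    · exact (hij' rfl).elim
    · rfl
    · exfalso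
      obtain ⟨k, hk1, hk2⟩ := hthird i' j'
      have h1 := hS k
      have h2 := hS' k
      have h0 := dot_normal_head (p j') (p i')
      rw [normal_swap, dot_comm, dot_comm _ (p i')] at h2
      simp only [dot, PiLp.neg_apply] at h1 h2 h0
      rcases hmem k (by simp only [dot]; linarith) with h | h
      · exact hk2 h
      · exact hk1 h
    · exact (hij' rfl).elim
  · intro e he f hf hef
    obtain ⟨i, j, hij, hS, rfl⟩ := mem_hullEdges.1 he
    obtain ⟨i', j', hij', hS', rfl⟩ := mem_hullEdges.1 hf
    obtain rfl : i = i' := hinj hef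
    by_contra hne
    have hjj : j ≠ j' := fun h => hne (by rw [h])
    have h1 : dot (normal (p i) (p j)) (p j' - p i) ≤ 0 := by
      rw [dot_sub]; linarith [hS j']
    have h2 : 0 ≤ dot (rot (p j' - p i)) (p j - p i) := by
      have h3 : dot (normal (p i) (p j')) (p j - p i) ≤ 0 := by rw [dot_sub]; linarith [hS' j]
      rw [dot_normal_eq] at h3
      exact nonneg_of_mul_nonneg_right (by linarith)
        (inv_pos.2 (norm_pos_iff.2 (sub_ne_zero.2 fun h => hij' (hinj h).symm)))
    have h3 := hcoll (fun h => hij (hinj h)) h2 rfl h1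
    rw [dot_sub] at h3
    exact not_on_line_of_convexIndependent hp
      (normal_ne_zero (fun h => hij (hinj h) : p i ≠ p j)) hij
      hij' hjj (dot_normal_head _ _).symm (by rw [dot_normal_head]; linarith)
  · intro e he f hf hef
    obtain ⟨i, j, hij, hS, rfl⟩ := mem_hullEdges.1 he
    obtain ⟨i', j', hij', hS', rfl⟩ := mem_hullEdges.1 hf
    obtain rfl : j = j' := hinj hef
    by_contra hne
    have hii : i ≠ i' := fun h => hne (by rw [h])
    have h1 : dot (normal (p i) (p j)) (p i' - p j) ≤ 0 := by
      rw [dot_sub, dot_normal_head]; linarith [hS i']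
    have h2 : 0 ≤ dot (rot (p i' - p j)) (p j - p i) := by
      have h3 : dot (normal (p i') (p j)) (p i - p j) ≤ 0 := by
        rw [dot_sub, dot_normal_head]; linarith [hS' i]
      rw [dot_normal_eq] at h3
      have h4 : 0 ≤ dot (rot (p j - p i')) (p i - p j) := nonneg_of_mul_nonneg_right (by linarith)
        (inv_pos.2 (norm_pos_iff.2 (sub_ne_zero.2 fun h => hij' (hinj h).symm)))
      have h5 : dot (rot (p i' - p j)) (p j - p i) = dot (rot (p j - p i')) (p i - p j) := by
        simp only [dot, rot_zero, rot_one, PiLp.sub_apply]; ring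
      rwa [h5]
    have h3 := hcoll (fun h => hij (hinj h)) h2 rfl h1
    rw [dot_sub, dot_normal_head] at h3
    exact not_on_line_of_convexIndependent hp (normal_ne_zero (fun h => hij (hinj h) : p i ≠ p j))
      hii hij hij' (by linarith) (by rw [dot_normal_head]; linarith)

lemma interior_hull_nonempty {n : ℕ} (hn : 3 ≤ n) {p : Fin n → Plane}
    (hp : ConvexIndependent ℝ p) : (interior (convexHull ℝ (range p))).Nonempty := by
  rw [interior_convexHull_nonempty_iff_affineSpan_eq_top]
  let i0 : Fin n := ⟨0, by omega⟩
  let i1 : Fin n := ⟨1, by omega⟩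
  let i2 : Fin n := ⟨2, by omega⟩
  have h01 : i0 ≠ i1 := by simp [i0, i1]
  have h02 : i0 ≠ i2 := by simp [i0, i2]
  have h12 : i1 ≠ i2 := by simp [i1, i2]
  have hai : AffineIndependent ℝ ![p i0, p i1, p i2] := by
    rw [affineIndependent_iff_not_collinear_set]
    intro hc
    obtain ⟨v, hv⟩ := (collinear_iff_of_mem (p₀ := p i0) (by simp)).1 hc
    obtain ⟨s, hs⟩ := hv (p i1) (by simp)
    obtain ⟨t, ht⟩ := hv (p i2) (by simp)
    rw [vadd_eq_add] at hs ht
    have hv0 : v ≠ 0 := by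
      rintro rfl
      rw [smul_zero, zero_add] at hs
      exact h01 (hp.injective hs).symm
    have hw : rot v ≠ 0 := fun h => hv0 (norm_eq_zero.1 (by rw [← norm_rot, h, norm_zero]))
    have hvv : dot (rot v) v = 0 := by rw [dot_comm]; exact dot_rot_self v
    refine not_on_line_of_convexIndependent hp hw h01 h02 h12 ?_ ?_
    · rw [hs, dot_add, dot_smul, hvv]; ring
    · rw [hs, ht, dot_add, dot_smul, hvv, dot_add, dot_smul, hvv]; ring
  have htop := hai.affineSpan_eq_top_iff_card_eq_finrank_add_one.2 (by simp)
  rw [eq_top_iff, ← htop]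
  refine affineSpan_mono ℝ ?_
  rintro x ⟨k, rfl⟩
  fin_cases k
  · exact mem_range_self i0
  · exact mem_range_self i1
  · exact mem_range_self i2

/-- A boundary point of the hull maximizes a linear form, hence lies on an edge. -/
lemma frontier_hull_subset {n : ℕ} (hn : 3 ≤ n) {p : Fin n → Plane} (hp : ConvexIndependent ℝ p) :
    frontier (convexHull ℝ (range p)) ⊆ netSupport (Finset.univ.image p) (hullEdges p) := by
  classical
  intro x hx
  have hcl : IsClosed (convexHull ℝ (range p)) :=
    ((finite_range p).isCompact_convexHull ℝ).isClosed
  obtain ⟨ν, hν, hmax⟩ := exists_support (convex_convexHull ℝ _) (interior_hull_nonempty hn hp) hx.2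
  have hxm := hcl.frontier_subset hx
  obtain ⟨w, hw0, hw1, hwx⟩ : ∃ w : Fin n → ℝ, (∀ i, 0 ≤ w i) ∧ ∑ i, w i = 1 ∧
      ∑ i, w i • p i = x := by
    have h2 : range p = ↑(Finset.univ.image p) := by simp
    rw [h2, Finset.mem_convexHull'] at hxm
    obtain ⟨w, hw0, hw1, hwx⟩ := hxm
    refine ⟨fun i => w (p i), fun i => hw0 _ (Finset.mem_image_of_mem _ (Finset.mem_univ _)),
      ?_, ?_⟩
    · rw [← hw1, Finset.sum_image fun i _ j _ h => hp.injective h]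
    · rw [← hwx, Finset.sum_image fun i _ j _ h => hp.injective h]
  have hle : ∀ k, dot ν (p k) ≤ dot ν x := fun k =>
    hmax _ (subset_convexHull ℝ _ (mem_range_self k))
  have hdots : ∑ k, w k * dot ν (p k) = dot ν x := by
    have hsum : ∀ s : Finset (Fin n), dot ν (∑ i ∈ s, w i • p i) = ∑ i ∈ s, w i * dot ν (p i) := by
      intro s
      induction s using Finset.induction_on with
      | empty => simp [dot]
      | insert a s ha ih => rw [Finset.sum_insert ha, Finset.sum_insert ha, dot_add, dot_smul, ih]
    rw [← hwx, hsum]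
  -- only maximizing vertices have weight
  have hzero : ∀ k, w k = 0 ∨ dot ν (p k) = dot ν x := by
    have h1 : ∑ k, w k * (dot ν x - dot ν (p k)) = 0 := by
      simp only [mul_sub]
      rw [Finset.sum_sub_distrib, ← Finset.sum_mul, hw1, hdots]; ring
    rw [Finset.sum_eq_zero_iff_of_nonneg fun k _ =>
      mul_nonneg (hw0 k) (sub_nonneg.2 (hle k))] at h1
    intro k
    rcases mul_eq_zero.1 (h1 k (Finset.mem_univ k)) with h | h
    · exact Or.inl h
    · right; linarith
  obtain ⟨i, hi⟩ : ∃ i, w i ≠ 0 := by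
    by_contra! h
    simp [h] at hw1
  have hiν := (hzero i).resolve_left hi
  by_cases hj : ∃ j, j ≠ i ∧ w j ≠ 0
  · obtain ⟨j, hji, hj⟩ := hj
    have hjν := (hzero j).resolve_left hj
    have hout : ∀ k, k ≠ i ∧ k ≠ j → w k = 0 := fun k hk => (hzero k).resolve_right fun h =>
      not_on_line_of_convexIndependent hp hν hji.symm hk.1.symm hk.2.symm (hiν.trans hjν.symm)
        (hjν.trans h.symm)
    have hs1 : w i + w j = 1 := by
      rw [← hw1, Fintype.sum_eq_add i j hji.symm hout]
    have hsx : w i • p i + w j • p j = x := by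
      rw [← hwx, Fintype.sum_eq_add i j hji.symm fun k hk => by rw [hout k hk, zero_smul]]
    have hxo : x ∈ openSegment ℝ (p i) (p j) :=
      ⟨w i, w j, lt_of_le_of_ne (hw0 i) hi.symm, lt_of_le_of_ne (hw0 j) hj.symm, hs1, hsx⟩
    have hne : p i ≠ p j := fun h => hji (hp.injective h).symm
    -- the linear form is a multiple of the normal
    have hνN := eq_smul_normal (v := ν) hne (by rw [dot_comm, dot_sub]; linarith)
    set c := dot (normal (p i) (p j)) ν with hc
    have hcd : ∀ v, dot ν v = c * dot (normal (p i) (p j)) v := fun v => by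
      conv_lhs => rw [hνN]
      rw [dot_comm, dot_smul, dot_comm]
    have hc0 : c ≠ 0 := by
      intro h
      rw [h, zero_smul] at hνN
      exact hν hνN
    rcases lt_or_gt_of_ne hc0 with hc0 | hc0
    · refine Or.inr ⟨(p j, p i), mem_hullEdges.2 ⟨j, i, hji, fun k => ?_, rfl⟩, ?_⟩
      · have h1 := hle k
        rw [← hjν, hcd, hcd] at h1
        have h2 : ∀ v, dot (normal (p j) (p i)) v = -dot (normal (p i) (p j)) v := fun v => by
          rw [normal_swap]; simp only [dot, PiLp.neg_apply]; ring
        rw [h2, h2]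
        nlinarith
      · rw [openSegment_symm]; exact hxo
    · refine Or.inr ⟨(p i, p j), mem_hullEdges.2 ⟨i, j, hji.symm, fun k => ?_, rfl⟩, hxo⟩
      have h1 := hle k
      rw [← hiν, hcd, hcd] at h1
      exact le_of_mul_le_mul_left h1 hc0
  · push Not at hj
    left
    have h1 : w i = 1 := by
      rw [← hw1, Fintype.sum_eq_single i hj]
    have h2 : x = p i := by
      rw [← hwx, Fintype.sum_eq_single i fun k hk => by rw [hj k hk, zero_smul], h1, one_smul]
    rw [h2]
    exact Finset.mem_image_of_mem _ (Finset.mem_univ _)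

lemma netSupport_hull_subset {n : ℕ} (p : Fin n → Plane) :
    netSupport (Finset.univ.image p) (hullEdges p) ⊆ convexHull ℝ (range p) := by
  classical
  have hv : ∀ i, p i ∈ convexHull ℝ (range p) := fun i =>
    subset_convexHull ℝ _ (mem_range_self i)
  rintro x (hx | ⟨e, he, hx⟩)
  · obtain ⟨i, -, rfl⟩ := Finset.mem_image.1 hx
    exact hv i
  · obtain ⟨i, j, -, -, rfl⟩ := mem_hullEdges.1 he
    exact (convex_convexHull ℝ _).segment_subset (hv i) (hv j) (openSegment_subset_segment _ _ _ hx)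

/-- The boundary of a convex polygon is a network of linear size. -/
theorem exists_network_of_isConvexPolygon {n : ℕ} {A : Set Plane} (hA : IsConvexPolygon n A) :
    ∃ (W : Finset Plane) (E : Finset (Plane × Plane)), Network W E ∧ W.card ≤ n ∧
      frontier A ⊆ netSupport W E ∧ netSupport W E ⊆ A ∧ IsCompact A ∧ Convex ℝ A ∧
      (interior A).Nonempty := by
  classical
  obtain ⟨hn, p, hp, rfl⟩ := hA
  refine ⟨_, _, network_hull hn hp, ?_, frontier_hull_subset hn hp, netSupport_hull_subset p,
    (finite_range p).isCompact_convexHull ℝ, convex_convexHull ℝ _, interior_hull_nonempty hn hp⟩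
  exact Finset.card_image_le.trans (by simp)

/-! ### The boundary of a simple polygon -/

section Chain

variable {m : ℕ} {P : Polygon Plane m}

lemma edgeSet_eq (P : Polygon Plane m) (i : Fin m) :
    P.edgeSet ℝ i = segment ℝ (P i) (P (finRotate m i)) := affineSegment_eq_segment ℝ _ _

lemma IsSimpleChain.injective [NeZero m] (h : IsSimpleChain P) : Function.Injective P.vertices := by
  intro i j hij
  by_contra hne
  have hnd := h.nondegenerate.hasNondegenerateEdges
  by_cases h1 : j = finRotate m i
  · exact hnd i (by rw [← h1]; exact hij)
  by_cases h2 : i = finRotate m j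
  · exact hnd j (by rw [← h2]; exact hij.symm)
  have := h.nonadjacent i j hne h1 h2
  rw [edgeSet_eq, edgeSet_eq] at this
  refine disjoint_left.1 this (left_mem_segment ℝ _ _) ?_
  rw [hij]
  exact left_mem_segment ℝ _ _

/-- The vertices and edges of a simple closed chain form a network. -/
theorem network_chain [NeZero m] (h : IsSimpleChain P) : Network (Finset.univ.image P.vertices)
    (Finset.univ.image fun i => (P i, P (finRotate m i))) := by
  classical
  have hinj := h.injective
  have hnd := h.nondegenerate.hasNondegenerateEdges
  have hmem : ∀ {e : Plane × Plane}, e ∈ (Finset.univ.image fun i => (P i, P (finRotate m i))) →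
      ∃ i, e = (P i, P (finRotate m i)) := by
    intro e he
    obtain ⟨i, -, rfl⟩ := Finset.mem_image.1 he
    exact ⟨i, rfl⟩
  have hP : ∀ i, P i ∈ Finset.univ.image P.vertices := fun i =>
    Finset.mem_image_of_mem _ (Finset.mem_univ i)
  refine ⟨?_, ?_, ?_, ?_, ?_, ?_, ?_⟩
  · intro e he
    obtain ⟨i, rfl⟩ := hmem he
    exact hP i
  · intro e he
    obtain ⟨i, rfl⟩ := hmem he
    exact hP _
  · intro e he
    obtain ⟨i, rfl⟩ := hmem he
    exact hnd i
  · intro e he w hw hx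
    obtain ⟨i, rfl⟩ := hmem he
    obtain ⟨k, -, rfl⟩ := Finset.mem_image.1 hw
    by_cases h1 : k = i
    · subst h1
      exact hnd k (left_mem_openSegment_iff.1 hx)
    by_cases h2 : k = finRotate m i
    · rw [h2] at hx
      exact hnd i (right_mem_openSegment_iff.1 hx)
    have hx' : P.vertices k ∈ P.edgeSet ℝ i := by
      rw [edgeSet_eq]; exact openSegment_subset_segment _ _ _ hx
    have hk : P.vertices k ∈ P.edgeSet ℝ k := by
      rw [edgeSet_eq]; exact left_mem_segment ℝ _ _
    by_cases h3 : i = finRotate m k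
    · have := h.adjacent k
      rw [← h3] at this
      have h4 : P.vertices k ∈ P.edgeSet ℝ k ∩ P.edgeSet ℝ i := ⟨hk, hx'⟩
      rw [this] at h4
      exact h1 (hinj h4)
    · exact disjoint_left.1 (h.nonadjacent k i h1 h3 h2) hk hx'
  · intro e he f hf x hx hx'
    obtain ⟨i, rfl⟩ := hmem he
    obtain ⟨j, rfl⟩ := hmem hf
    by_contra hne
    have hij : i ≠ j := fun h => hne (by rw [h])
    have m1 : x ∈ P.edgeSet ℝ i := by rw [edgeSet_eq]; exact openSegment_subset_segment _ _ _ hx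
    have m2 : x ∈ P.edgeSet ℝ j := by rw [edgeSet_eq]; exact openSegment_subset_segment _ _ _ hx'
    by_cases h1 : j = finRotate m i
    · have h4 : x ∈ P.edgeSet ℝ i ∩ P.edgeSet ℝ j := ⟨m1, m2⟩
      rw [h1, h.adjacent i, mem_singleton_iff] at h4
      rw [h4] at hx
      exact hnd i (right_mem_openSegment_iff.1 hx)
    by_cases h2 : i = finRotate m j
    · have h4 : x ∈ P.edgeSet ℝ j ∩ P.edgeSet ℝ i := ⟨m2, m1⟩
      rw [h2, h.adjacent j, mem_singleton_iff] at h4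
      rw [h4] at hx'
      exact hnd j (right_mem_openSegment_iff.1 hx')
    exact disjoint_left.1 (h.nonadjacent i j hij h1 h2) m1 m2
  · intro e he f hf hef
    obtain ⟨i, rfl⟩ := hmem he
    obtain ⟨j, rfl⟩ := hmem hf
    rw [hinj hef]
  · intro e he f hf hef
    obtain ⟨i, rfl⟩ := hmem he
    obtain ⟨j, rfl⟩ := hmem hf
    rw [(finRotate m).injective (hinj hef)]

lemma boundary_eq [NeZero m] (h : IsSimpleChain P) :
    P.boundary ℝ = netSupport (Finset.univ.image P.vertices)
    (Finset.univ.image fun i => (P i, P (finRotate m i))) := by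
  classical
  ext x
  simp only [Polygon.boundary, mem_iUnion, edgeSet_eq]
  constructor
  · rintro ⟨i, hi⟩
    exact (network_chain h).segment_subset (e := (P i, P (finRotate m i)))
      (mem_darts.2 (Or.inl (Finset.mem_image.2 ⟨i, Finset.mem_univ i, rfl⟩))) hi
  · rintro (hx | ⟨e, he, hx⟩)
    · obtain ⟨i, -, rfl⟩ := Finset.mem_image.1 hx
      exact ⟨i, left_mem_segment ℝ _ _⟩
    · obtain ⟨i, -, rfl⟩ := Finset.mem_image.1 he
      exact ⟨i, openSegment_subset_segment _ _ _ hx⟩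

lemma isCompact_boundary (P : Polygon Plane m) : IsCompact (P.boundary ℝ) := by
  rw [Polygon.boundary]
  refine isCompact_iUnion fun i => ?_
  rw [edgeSet_eq, segment_eq_image']
  exact isCompact_Icc.image (by fun_prop)

lemma component_subset_enclosedRegion (P : Polygon Plane m) {x y : Plane}
    (hx : x ∉ P.boundary ℝ) (hy : y ∈ connectedComponentIn (P.boundary ℝ)ᶜ x) :
    y ∈ enclosedRegion P ↔ x ∈ enclosedRegion P := by
  have h1 := connectedComponentIn_eq hy
  have h2 : y ∉ P.boundary ℝ := connectedComponentIn_subset _ _ hy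
  simp only [enclosedRegion, mem_union, hx, h2, false_or, mem_ofPred_eq, not_false_eq_true,
    true_and, h1]

lemma component_mem_nhds (P : Polygon Plane m) {x : Plane} (hx : x ∉ P.boundary ℝ) :
    connectedComponentIn (P.boundary ℝ)ᶜ x ∈ 𝓝 x :=
  connectedComponentIn_mem_nhds ((isCompact_boundary P).isClosed.isOpen_compl.mem_nhds hx)

lemma isClosed_enclosedRegion (P : Polygon Plane m) : IsClosed (enclosedRegion P) := by
  rw [← isOpen_compl_iff, isOpen_iff_mem_nhds]
  intro x hx
  have hxP : x ∉ P.boundary ℝ := fun h => hx (Or.inl h)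
  filter_upwards [component_mem_nhds P hxP] with y hy hyB
  exact hx ((component_subset_enclosedRegion P hxP hy).1 hyB)

lemma frontier_enclosedRegion_subset (P : Polygon Plane m) :
    frontier (enclosedRegion P) ⊆ P.boundary ℝ := by
  intro x hx
  by_contra hxP
  refine hx.2 (mem_interior_iff_mem_nhds.2 ?_)
  filter_upwards [component_mem_nhds P hxP] with y hy
  exact (component_subset_enclosedRegion P hxP hy).2
    ((isClosed_enclosedRegion P).frontier_subset hx)

/-- A point that can escape to infinity along a ray that avoids the chain is not enclosed. -/
lemma not_mem_enclosedRegion_of_ray (P : Polygon Plane m) {x v : Plane} (hv : v ≠ 0)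
    (h : ∀ t : ℝ, 0 ≤ t → x + t • v ∉ P.boundary ℝ) : x ∉ enclosedRegion P := by
  have hx : x ∉ P.boundary ℝ := by simpa using h 0 le_rfl
  rintro (hxP | ⟨-, hb⟩)
  · exact hx hxP
  have hray : (fun t : ℝ => x + t • v) '' Ici 0 ⊆ connectedComponentIn (P.boundary ℝ)ᶜ x := by
    refine IsPreconnected.subset_connectedComponentIn ?_ ⟨0, self_mem_Ici, by simp⟩ ?_
    · exact isPreconnected_Ici.image _ (by fun_prop)
    · rintro _ ⟨t, ht, rfl⟩
      exact h t ht
  obtain ⟨R, hR⟩ := (hb.subset hray).subset_closedBall x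
  have hvn : 0 < ‖v‖ := norm_pos_iff.2 hv
  have h1 := hR ⟨(|R| + 1) / ‖v‖, by rw [mem_Ici]; positivity, rfl⟩
  rw [mem_closedBall, dist_eq_norm, add_sub_cancel_left, norm_smul, Real.norm_eq_abs,
    abs_of_nonneg (by positivity), div_mul_cancel₀ _ hvn.ne'] at h1
  linarith [le_abs_self R]

lemma isCompact_enclosedRegion (P : Polygon Plane m) : IsCompact (enclosedRegion P) := by
  refine isCompact_of_isClosed_isBounded (isClosed_enclosedRegion P) ?_
  obtain ⟨R, hR⟩ := (isCompact_boundary P).isBounded.subset_closedBall (0 : Plane)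
  refine (isBounded_closedBall (x := (0 : Plane)) (r := |R|)).subset fun x hx => ?_
  by_contra hxR
  rw [mem_closedBall_zero_iff, not_le] at hxR
  have hx0 : x ≠ 0 := by
    rintro rfl
    rw [norm_zero] at hxR
    linarith [abs_nonneg R]
  refine not_mem_enclosedRegion_of_ray P hx0 (fun t ht hP => ?_) hx
  have h1 := hR hP
  rw [mem_closedBall_zero_iff] at h1
  have h2 : x + t • x = (1 + t) • x := by module
  rw [h2, norm_smul, Real.norm_eq_abs, abs_of_nonneg (by linarith)] at h1
  nlinarith [le_abs_self R, abs_nonneg R]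

end Chain

/-- The boundary of a simple polygon lies on a network of linear size, which belongs to the
polygon. -/
theorem exists_network_of_isSimplePolygon {m : ℕ} {B : Set Plane} (hB : IsSimplePolygon m B) :
    ∃ (W : Finset Plane) (E : Finset (Plane × Plane)), Network W E ∧ W.card ≤ m ∧
      frontier B ⊆ netSupport W E ∧ netSupport W E ⊆ B ∧ IsCompact B := by
  classical
  obtain ⟨_, P, hP, rfl⟩ := hB
  refine ⟨_, _, network_chain hP, Finset.card_image_le.trans (by simp), ?_, ?_,
    isCompact_enclosedRegion P⟩
  · rw [← boundary_eq hP]; exact frontier_enclosedRegion_subset P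
  · rw [← boundary_eq hP]; exact subset_union_left

/-! ### The upper bound -/

/-- Both sets whose intersection is the middle set are thickenings of sets bounded by networks,
and the first one is convex. -/
theorem exists_consistsOf_middleSet {n m : ℕ} {A B : Set Plane} (hA : IsConvexPolygon n A)
    (hB : IsSimplePolygon m B) {α : ℝ} (hα : α ∈ Icc (0 : ℝ) 1) :
    ∃ (V : Finset Plane) (L R : Finset (Set Plane)), ConsistsOf (frontier (middleSet α A B)) V L R ∧
      V.card + L.card + R.card ≤ 30000000000 * (n + m) := by
  obtain ⟨WA, EA, hGA, hWA, hfA, hSA, hcA, hconv, hint⟩ := exists_network_of_isConvexPolygon hA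
  obtain ⟨WB, EB, hGB, hWB, hfB, hSB, hcB⟩ := exists_network_of_isSimplePolygon hB
  obtain ⟨CA, ZA, hOA, hCA, hZA⟩ := exists_outline hGA hcA hfA hSA hα.1
  obtain ⟨CB, ZB, hOB, hCB, hZB⟩ := exists_outline hGB hcB hfB hSB (sub_nonneg.2 hα.2)
  have hAK : A ⊆ A + closedBall (0 : Plane) α := fun a ha =>
    mem_add_closedBall.2 ⟨a, ha, by rw [dist_self]; exact hα.1⟩
  obtain ⟨V, L, R, hc, hcard⟩ := exists_consistsOf_inter (hconv.add (convex_closedBall 0 α))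
    (hcA.add (isCompact_closedBall 0 α)).isClosed (hint.mono (interior_mono hAK))
    (hcB.add (isCompact_closedBall 0 (1 - α))).isClosed hOA hOB
  exact ⟨V, L, R, hc, by omega⟩

/-! ### Counting the segments of a set from below -/

/-- If a set meets each of several nonparallel lines in infinitely many points, then each line
needs a segment of its own. -/
lemma card_le_card_segments {X : Set Plane} {V : Finset Plane} {L R : Finset (Set Plane)}
    (h : ConsistsOf X V L R) {N : ℕ} (σ c : Fin N → ℝ) (hσ : Function.Injective σ)
    (hinf : ∀ k, {x | x ∈ X ∧ x 1 = σ k * x 0 - c k}.Infinite) : N ≤ L.card := by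
  classical
  have hline : ∀ k, ∃ e ∈ L, ∃ x ∈ e, ∃ y ∈ e, x ≠ y ∧ x 1 = σ k * x 0 - c k ∧
      y 1 = σ k * y 0 - c k := by
    intro k
    by_contra! hno
    refine hinf k ?_
    have hsub : {x | x ∈ X ∧ x 1 = σ k * x 0 - c k} ⊆ (V : Set Plane) ∪
        (⋃ e ∈ (L : Set (Set Plane)), {x | x ∈ e ∧ x 1 = σ k * x 0 - c k}) ∪
        (⋃ e ∈ (R : Set (Set Plane)), {x | x ∈ e ∧ x 1 = σ k * x 0 - c k}) := by
      rintro x ⟨hx, hxk⟩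
      rw [h.cover] at hx
      rcases hx with (hx | ⟨e, he, hxe⟩) | ⟨e, he, hxe⟩
      · exact Or.inl (Or.inl hx)
      · exact Or.inl (Or.inr (mem_biUnion he ⟨hxe, hxk⟩))
      · exact Or.inr (mem_biUnion he ⟨hxe, hxk⟩)
    refine Set.Finite.subset ((V.finite_toSet.union (L.finite_toSet.biUnion fun e he => ?_)).union
      (R.finite_toSet.biUnion fun e he => ?_)) hsub
    · refine Set.Subsingleton.finite fun x hx y hy => ?_
      by_contra hxy
      exact hno e he x hx.1 y hy.1 hxy hx.2 hy.2
    · obtain ⟨v, r, s, t, -, -, -, -, -, rfl⟩ := h.arcs e he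
      obtain ⟨T, hT, -⟩ := exists_finset_of_card_le
        {x | x ∈ circlePoint v r '' Ioo s t ∧ x 1 = σ k * x 0 - c k} 2 fun U hU => by
          refine card_le_two_of_line_of_circle U v !₂[σ k, -1] |r| (c k) ?_ ?_ ?_
          · intro h0
            have := congrArg (fun z : Plane => z 1) h0
            simp at this
          · intro x hx
            obtain ⟨⟨θ, -, rfl⟩, -⟩ := hU hx
            rw [dist_eq_iff (abs_nonneg r), circlePoint_zero, circlePoint_one, sq_abs]
            linear_combination r ^ 2 * Real.cos_sq_add_sin_sq θ
          · intro x hx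
            have := (hU hx).2
            simp only [dot, Matrix.cons_val_zero, Matrix.cons_val_one]
            linarith
      rw [← hT]
      exact T.finite_toSet
  choose e he x hx y hy hxy hxk hyk using hline
  have hinj : Function.Injective e := by
    intro k l hkl
    obtain ⟨a, -, b, -, hab, hes⟩ := h.segments (e k) (he k)
    -- both lines contain two points of the segment, hence its direction
    have hdir : ∀ {s d : ℝ} {u v : Plane}, u ∈ openSegment ℝ a b → v ∈ openSegment ℝ a b → u ≠ v →
        u 1 = s * u 0 - d → v 1 = s * v 0 - d → (b - a) 1 = s * (b - a) 0 := by
      intro s d u v hu hv huv h1 h2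
      obtain ⟨p, -, rfl⟩ := mem_openSegment_iff.1 hu
      obtain ⟨q, -, rfl⟩ := mem_openSegment_iff.1 hv
      have hpq : p - q ≠ 0 := fun h => huv (by rw [sub_eq_zero.1 h])
      simp only [PiLp.add_apply, PiLp.smul_apply, smul_eq_mul] at h1 h2
      have h3 : (p - q) * ((b - a) 1 - s * (b - a) 0) = 0 := by linear_combination h1 - h2
      linarith [(mul_eq_zero.1 h3).resolve_left hpq]
    have hk := hdir (hes ▸ hx k) (hes ▸ hy k) (hxy k) (hxk k) (hyk k)
    have hl := hdir (hes ▸ hkl ▸ hx l) (hes ▸ hkl ▸ hy l) (hxy l) (hxk l) (hyk l)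
    have h0 : (b - a) 0 ≠ 0 := by
      intro h0
      rw [h0, mul_zero] at hk
      exact hab (sub_eq_zero.1 (plane_ext h0 hk)).symm
    exact hσ (mul_right_cancel₀ h0 (hk.symm.trans hl))
  calc N = (Finset.univ : Finset (Fin N)).card := by simp
    _ ≤ L.card := Finset.card_le_card_of_injOn e (fun k _ => he k) hinj.injOn

lemma infinite_segment {a b : Plane} (hab : a ≠ b) : (segment ℝ a b).Infinite := by
  rw [segment_eq_image']
  refine Set.Infinite.image ?_ (Icc_infinite zero_lt_one)
  intro s _ t _ hst
  exact smul_left_injective ℝ (sub_ne_zero.2 hab.symm) (add_left_cancel hst)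

/-! ### Polygons inscribed in a parabola -/

/-- The point of the standard parabola with abscissa `t`. -/
noncomputable def parab (t : ℝ) : Plane := !₂[t, t ^ 2]

@[simp] lemma parab_zero (t : ℝ) : parab t 0 = t := rfl
@[simp] lemma parab_one (t : ℝ) : parab t 1 = t ^ 2 := rfl

lemma dot_pair (a b : ℝ) (x : Plane) : dot !₂[a, b] x = a * x 0 + b * x 1 := rfl

lemma pair_ne_zero {a b : ℝ} (hb : b ≠ 0) : (!₂[a, b] : Plane) ≠ 0 := fun h => by
  have := congrArg (fun z : Plane => z 1) h
  exact hb (by simpa using this)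

/-- A chord of the parabola whose line has a closed set on its upper side contributes infinitely
many boundary points. -/
lemma infinite_frontier_of_chord {S : Set Plane} (hS : IsClosed S) {s t : ℝ} (hst : s ≠ t)
    (hsub : segment ℝ (parab s) (parab t) ⊆ S)
    (hsup : ∀ x ∈ S, dot !₂[s + t, -1] x ≤ s * t) :
    {x | x ∈ frontier S ∧ x 1 = (s + t) * x 0 - s * t}.Infinite := by
  refine (infinite_segment (a := parab s) (b := parab t) fun h => hst ?_).mono fun x hx => ?_
  · exact congrArg (fun z : Plane => z 0) h
  · have h1 : dot !₂[s + t, -1] x = s * t := dot_eq_of_mem_segment hx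
      (by rw [dot_pair]; simp only [parab_zero, parab_one]; ring)
      (by rw [dot_pair]; simp only [parab_zero, parab_one]; ring)
    refine ⟨?_, by rw [dot_pair] at h1; linarith⟩
    rw [hS.frontier_eq]
    refine ⟨hsub hx, not_mem_interior_of_support
      (pair_ne_zero (a := s + t) (b := -1) (by norm_num)) fun y hy => ?_⟩
    rw [h1]; exact hsup y hy

/-- The vertices of a convex polygon: a point on the left, and points on the parabola. -/
noncomputable def arrowVertex (n : ℕ) (i : Fin n) : Plane :=
  if (i : ℕ) = 0 then !₂[-1, 0] else parab ((i : ℝ) / (2 * n))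

lemma convexIndependent_arrowVertex (n : ℕ) : ConvexIndependent ℝ (arrowVertex n) := by
  rw [convexIndependent_iff_notMem_convexHull_sdiff]
  intro i s hi
  have hn : (0 : ℝ) < 2 * n := by
    have : 0 < n := i.pos
    positivity
  -- a linear form with its only maximum in the vertex
  obtain ⟨ν, hν⟩ : ∃ ν : Plane, ∀ j, j ≠ i →
      dot ν (arrowVertex n j) < dot ν (arrowVertex n i) := by
    by_cases h0 : (i : ℕ) = 0
    · refine ⟨!₂[-1, 0], fun j hj => ?_⟩
      have hj0 : (j : ℕ) ≠ 0 := fun h => hj (Fin.ext (h.trans h0.symm))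
      rw [arrowVertex, arrowVertex, if_pos h0, if_neg hj0, dot_pair, dot_pair]
      have : (0 : ℝ) ≤ (j : ℝ) / (2 * n) := by positivity
      simp only [parab_zero, parab_one, Matrix.cons_val_zero, Matrix.cons_val_one]
      linarith
    · refine ⟨!₂[2 * ((i : ℝ) / (2 * n)), -1], fun j hj => ?_⟩
      have hpos : (0 : ℝ) < (i : ℝ) / (2 * n) := by
        have : 0 < (i : ℕ) := Nat.pos_of_ne_zero h0
        positivity
      rw [arrowVertex, arrowVertex, if_neg h0, dot_pair, dot_pair]
      split_ifs with hj0
      · simp only [parab_zero, parab_one, Matrix.cons_val_zero, Matrix.cons_val_one]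
        nlinarith
      · simp only [parab_zero, parab_one]
        have hne : (i : ℝ) / (2 * n) - (j : ℝ) / (2 * n) ≠ 0 := by
          rw [← sub_div]
          refine div_ne_zero (sub_ne_zero.2 fun h => hj ?_) hn.ne'
          exact Fin.ext (by exact_mod_cast h.symm)
        have := pow_pos (abs_pos.2 hne) 2
        rw [sq_abs] at this
        nlinarith
  have hconv : Convex ℝ {x : Plane | dot ν x < dot ν (arrowVertex n i)} :=
    convex_halfSpace_lt ⟨fun a b => dot_add _ a b, fun c a => dot_smul _ a c⟩ _
  have : convexHull ℝ (arrowVertex n '' (s \ {i})) ⊆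
      {x : Plane | dot ν x < dot ν (arrowVertex n i)} := by
    refine convexHull_min ?_ hconv
    rintro _ ⟨j, hj, rfl⟩
    exact hν j hj.2
  exact lt_irrefl (dot ν (arrowVertex n i)) (this hi)

/-- A closed chain is simple if every edge is the set of maximal points of a linear form. -/
lemma isSimpleChain_of_support {M : ℕ} (P : Polygon Plane (M + 3)) (ν : Fin (M + 3) → Plane)
    (c : Fin (M + 3) → ℝ) (hle : ∀ i j, dot (ν i) (P j) ≤ c i)
    (heq : ∀ i j, dot (ν i) (P j) = c i ↔ j = i ∨ j = finRotate _ i) : IsSimpleChain P := by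
  have h10 : (1 : Fin (M + 3)) ≠ 0 := one_ne_zero
  have h20 : (2 : Fin (M + 3)) ≠ 0 := by
    intro h
    have := congrArg Fin.val h
    rw [Fin.val_two, Fin.val_zero] at this
    omega
  have hrr : ∀ i : Fin (M + 3), i + 1 + 1 = i + 2 := fun i => by
    rw [add_assoc]; rfl
  have hedge : ∀ i j x, x ∈ P.edgeSet ℝ j → ∃ s ∈ Icc (0 : ℝ) 1,
      P j + s • (P (finRotate _ j) - P j) = x ∧
      dot (ν i) x = (1 - s) * dot (ν i) (P j) + s * dot (ν i) (P (finRotate _ j)) := by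
    intro i j x hx
    rw [edgeSet_eq] at hx
    obtain ⟨s, hs, rfl⟩ := mem_segment_iff.1 hx
    exact ⟨s, hs, rfl, by rw [dot_add, dot_smul, dot_sub]; ring⟩
  have hself : ∀ i x, x ∈ P.edgeSet ℝ i → dot (ν i) x = c i := by
    intro i x hx
    obtain ⟨s, -, -, h⟩ := hedge i i x hx
    rw [h, (heq i i).2 (Or.inl rfl), (heq i _).2 (Or.inr rfl)]; ring
  refine ⟨fun i => ?_, fun i => ?_, fun i j hij h1 h2 => ?_⟩
  · rw [affineIndependent_iff_not_collinear_set]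
    intro hc
    have hi : dot (ν i) (P i) = c i := (heq i i).2 (Or.inl rfl)
    have hi1 : dot (ν i) (P (i + 1)) = c i := (heq i _).2 (Or.inr (finRotate_apply i).symm)
    have hne : P i ≠ P (i + 1) := by
      intro h
      have h3 : dot (ν (i + 1)) (P i) = c (i + 1) := by rw [h]; exact (heq _ _).2 (Or.inl rfl)
      rcases (heq _ _).1 h3 with h4 | h4
      · exact h10 (left_eq_add.1 h4)
      · rw [finRotate_apply, hrr] at h4
        exact h20 (left_eq_add.1 h4)
    -- on the line of the edge, the form is constant, so that `P (i + 2)` would be maximal, too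
    obtain ⟨v, hv⟩ := (collinear_iff_of_mem (p₀ := P i) (by simp)).1 hc
    obtain ⟨s, hs⟩ := hv (P (i + 1)) (by simp)
    obtain ⟨t, ht⟩ := hv (P (i + 2)) (by simp)
    rw [vadd_eq_add] at hs ht
    have hs0 : s ≠ 0 := by
      rintro rfl
      rw [zero_smul, zero_add] at hs
      exact hne hs.symm
    have hv0 : dot (ν i) v = 0 := by
      rw [hs, dot_add, dot_smul, hi] at hi1
      have : s * dot (ν i) v = 0 := by linarith
      exact (mul_eq_zero.1 this).resolve_left hs0
    have h2 : dot (ν i) (P (i + 2)) = c i := by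
      rw [ht, dot_add, dot_smul, hv0, hi]; ring
    rcases (heq _ _).1 h2 with h4 | h4
    · exact h20 (add_eq_left.1 h4)
    · rw [finRotate_apply, ← hrr] at h4
      exact h10 (add_eq_left.1 h4)
  · apply Subset.antisymm
    · rintro x ⟨hx, hx'⟩
      obtain ⟨s, hs, rfl, h⟩ := hedge i _ x hx'
      rw [hself i _ hx, (heq i (finRotate _ i)).2 (Or.inr rfl)] at h
      have hlt : dot (ν i) (P (finRotate _ (finRotate _ i))) < c i := by
        refine lt_of_le_of_ne (hle _ _) fun h4 => ?_
        rw [heq, finRotate_apply, finRotate_apply, hrr] at h4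
        rcases h4 with h4 | h4
        · exact h20 (add_eq_left.1 h4)
        · rw [← hrr] at h4
          exact h10 (add_eq_left.1 h4)
      have hs0 : s = 0 := by
        have : s * (c i - dot (ν i) (P (finRotate _ (finRotate _ i)))) = 0 := by linarith
        rcases mul_eq_zero.1 this with h5 | h5
        · exact h5
        · linarith
      rw [hs0, zero_smul, add_zero, mem_singleton_iff]
    · rintro x rfl
      rw [edgeSet_eq, edgeSet_eq]
      exact ⟨right_mem_segment ℝ _ _, left_mem_segment ℝ _ _⟩
  · refine disjoint_left.2 fun x hx hx' => ?_
    obtain ⟨s, hs, rfl, h⟩ := hedge i j x hx'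
    rw [hself i _ hx] at h
    have hlt1 : dot (ν i) (P j) < c i := lt_of_le_of_ne (hle _ _) fun h4 => by
      rcases (heq _ _).1 h4 with h4 | h4
      · exact hij h4.symm
      · exact h1 h4
    have hlt2 : dot (ν i) (P (finRotate _ j)) < c i := lt_of_le_of_ne (hle _ _) fun h4 => by
      rcases (heq _ _).1 h4 with h4 | h4
      · exact h2 h4.symm
      · exact hij ((finRotate _).injective h4).symm
    rcases eq_or_lt_of_le hs.1 with h0 | h0
    · rw [← h0] at h; linarith
    · nlinarith [hs.2]

/-- The closed polygonal chain through points of the parabola. -/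
noncomputable def parabChain (M : ℕ) : Polygon Plane (M + 3) :=
  ⟨fun k => parab ((k : ℝ) / (2 * (M + 3)))⟩

lemma parabChain_apply (M : ℕ) (k : Fin (M + 3)) :
    parabChain M k = parab ((k : ℝ) / (2 * (M + 3))) := rfl

lemma finRotate_val_of_ne_last {M : ℕ} {i : Fin (M + 3)} (h : i ≠ Fin.last (M + 2)) :
    ((finRotate (M + 3) i : Fin (M + 3)) : ℕ) = i + 1 := coe_finRotate_of_ne_last h

lemma isSimpleChain_parabChain (M : ℕ) : IsSimpleChain (parabChain M) := by
  classical
  set D : ℝ := 2 * (M + 3) with hD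
  have hD0 : 0 < D := by positivity
  -- the value at the vertex `j` of the linear form belonging to the edge from `a` to `b`
  have hval : ∀ a b j : ℝ, dot !₂[a / D + b / D, -1] (parab (j / D)) - a / D * (b / D) =
      -((j - a) * (j - b)) / D ^ 2 := by
    intro a b j
    rw [dot_pair]
    simp only [parab_zero, parab_one]
    field_simp
    ring
  have hval' : ∀ b j : ℝ, dot !₂[-(b / D), 1] (parab (j / D)) - 0 = -(j * (b - j)) / D ^ 2 := by
    intro b j
    rw [dot_pair]
    simp only [parab_zero, parab_one]
    field_simp
    ring
  -- the last edge closes the chain from above, the others have the parabola above them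
  refine isSimpleChain_of_support _
    (fun i => if i = Fin.last (M + 2) then !₂[-(((M + 2 : ℕ) : ℝ) / D), 1]
      else !₂[(i : ℝ) / D + ((i : ℝ) + 1) / D, -1])
    (fun i => if i = Fin.last (M + 2) then 0 else (i : ℝ) / D * (((i : ℝ) + 1) / D)) ?_ ?_
  · intro i j
    rw [parabChain_apply, ← sub_nonpos]
    split_ifs with hi
    · rw [hval']
      have : (j : ℝ) ≤ ((M + 2 : ℕ) : ℝ) := by exact_mod_cast Nat.le_of_lt_succ j.2
      have h2 : 0 ≤ (j : ℝ) * (((M + 2 : ℕ) : ℝ) - j) := mul_nonneg (by positivity) (by linarith)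
      exact div_nonpos_of_nonpos_of_nonneg (by linarith) (by positivity)
    · rw [hval]
      have h2 : 0 ≤ ((j : ℝ) - i) * (j - (i + 1)) := by
        rcases Nat.lt_or_ge (i : ℕ) j with h | h
        · have : (i : ℝ) + 1 ≤ j := by exact_mod_cast h
          nlinarith
        · have : (j : ℝ) ≤ i := by exact_mod_cast h
          nlinarith
      exact div_nonpos_of_nonpos_of_nonneg (by linarith) (by positivity)
  · intro i j
    rw [parabChain_apply, ← sub_eq_zero]
    split_ifs with hi
    · rw [hval', div_eq_zero_iff, or_iff_left (by positivity), neg_eq_zero, mul_eq_zero, hi]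
      have hlast : finRotate (M + 3) (Fin.last (M + 2)) = 0 := finRotate_last
      rw [hlast, or_comm, sub_eq_zero]
      refine or_congr ?_ ?_
      · rw [Fin.ext_iff, Fin.val_last, Nat.cast_inj, eq_comm]
      · rw [Fin.ext_iff, Fin.val_zero, Nat.cast_eq_zero]
    · rw [hval, div_eq_zero_iff, or_iff_left (by positivity), neg_eq_zero, mul_eq_zero, sub_eq_zero,
        sub_eq_zero]
      refine or_congr ?_ ?_
      · rw [Fin.ext_iff, Nat.cast_inj]
      · rw [Fin.ext_iff, finRotate_val_of_ne_last hi]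
        exact_mod_cast Iff.rfl

/-- The region enclosed by a chain lies in every half-plane that contains the vertices. -/
lemma enclosedRegion_subset_halfplane {m : ℕ} {P : Polygon Plane m} {ν : Plane} {c : ℝ}
    (hν : ν ≠ 0) (hP : ∀ i, dot ν (P i) ≤ c) : ∀ x ∈ enclosedRegion P, dot ν x ≤ c := by
  intro x hx
  by_contra! hlt
  have hpos : 0 < dot ν ν := by rw [dot_self]; positivity
  refine not_mem_enclosedRegion_of_ray P hν (fun t ht hmem => ?_) hx
  obtain ⟨i, hi⟩ := mem_iUnion.1 hmem
  rw [edgeSet_eq] at hi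
  have := dot_mem_segment hi (hP _) (hP _)
  rw [dot_add, dot_smul] at this
  nlinarith

/-- Among points of the parabola with equally spaced abscissae, none lies beyond the line of two
consecutive ones. -/
lemma dot_parab_chord_le {D : ℝ} (i j : ℕ) :
    dot !₂[(i : ℝ) / D + ((i : ℝ) + 1) / D, -1] (parab (j / D)) ≤
      (i : ℝ) / D * (((i : ℝ) + 1) / D) := by
  have h2 : 0 ≤ ((j : ℝ) - i) * (j - (i + 1)) := by
    rcases Nat.lt_or_ge i j with h | h
    · have : (i : ℝ) + 1 ≤ j := by exact_mod_cast h
      nlinarith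
    · have : (j : ℝ) ≤ i := by exact_mod_cast h
      nlinarith
  have h3 : 0 ≤ ((j : ℝ) - i) * (j - (i + 1)) * (D⁻¹) ^ 2 := mul_nonneg h2 (sq_nonneg _)
  rw [dot_pair]
  simp only [parab_zero, parab_one, div_eq_mul_inv]
  nlinarith

/-- The convex hull of a point on the left and of points on the parabola. -/
noncomputable def arrowPolygon (n : ℕ) : Set Plane := convexHull ℝ (range (arrowVertex n))

lemma arrowVertex_mem (n : ℕ) (i : Fin n) : arrowVertex n i ∈ arrowPolygon n :=
  subset_convexHull ℝ _ (mem_range_self i)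

lemma arrowPolygon_subset_halfplane {n : ℕ} {ν : Plane} {c : ℝ}
    (h : ∀ i, dot ν (arrowVertex n i) ≤ c) : ∀ x ∈ arrowPolygon n, dot ν x ≤ c := by
  have hconv : Convex ℝ {x : Plane | dot ν x ≤ c} :=
    convex_halfSpace_le ⟨fun a b => dot_add _ a b, fun c a => dot_smul _ a c⟩ _
  exact fun x hx => convexHull_min (by rintro _ ⟨i, rfl⟩; exact h i) hconv hx

lemma arrowPolygon_subset_closedBall (n : ℕ) : arrowPolygon n ⊆ closedBall 0 1 := by
  refine convexHull_min ?_ (convex_closedBall _ _)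
  rintro _ ⟨i, rfl⟩
  rw [mem_closedBall_zero_iff, EuclideanSpace.norm_eq, Fin.sum_univ_two, Real.sqrt_le_iff]
  refine ⟨zero_le_one, ?_⟩
  have hn : (0 : ℝ) < n := by exact_mod_cast i.pos
  have hi : (i : ℝ) ≤ n := by exact_mod_cast i.2.le
  rw [arrowVertex]
  split_ifs with h
  · simp
  · have h0 : 0 ≤ (i : ℝ) / (2 * n) := by positivity
    have h1 : (i : ℝ) / (2 * n) ≤ 1 / 2 := by rw [div_le_iff₀ (by positivity)]; linarith
    have h2 : ((i : ℝ) / (2 * n)) ^ 2 ≤ 1 / 4 := by nlinarith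
    simp only [parab_zero, parab_one, Real.norm_eq_abs, sq_abs]
    nlinarith [sq_nonneg ((i : ℝ) / (2 * n))]

lemma isClosed_arrowPolygon (n : ℕ) : IsClosed (arrowPolygon n) :=
  (finite_range _).isClosed_convexHull ℝ

/-- The boundary of the convex polygon requires many line segments. -/
lemma le_card_of_consistsOf_frontier_arrowPolygon {n : ℕ} {V : Finset Plane}
    {L R : Finset (Set Plane)} (h : ConsistsOf (frontier (arrowPolygon n)) V L R) :
    n - 2 ≤ L.card := by
  rcases Nat.lt_or_ge n 3 with hn | hn
  · omega
  have hD : (0 : ℝ) < 2 * n := by positivity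
  refine card_le_card_segments h
    (fun k : Fin (n - 2) => ((k + 1 : ℕ) : ℝ) / (2 * n) + (((k + 1 : ℕ) : ℝ) + 1) / (2 * n))
    (fun k => ((k + 1 : ℕ) : ℝ) / (2 * n) * ((((k + 1 : ℕ) : ℝ) + 1) / (2 * n))) ?_ fun k => ?_
  · intro k l hkl
    have h1 : ((k + 1 : ℕ) : ℝ) + (((k + 1 : ℕ) : ℝ) + 1) =
        ((l + 1 : ℕ) : ℝ) + (((l + 1 : ℕ) : ℝ) + 1) := by
      simp only [← add_div] at hkl
      exact (div_left_inj' hD.ne').1 hkl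
    have h2 : ((k + 1 : ℕ) : ℝ) = ((l + 1 : ℕ) : ℝ) := by linarith
    exact Fin.ext (by simpa using h2)
  · have hv : ∀ j : ℕ, 0 < j → j < n → parab ((j : ℝ) / (2 * n)) ∈ arrowPolygon n := by
      intro j h0 hj
      have := arrowVertex_mem n ⟨j, hj⟩
      rwa [arrowVertex, if_neg h0.ne'] at this
    have hk := k.2
    refine infinite_frontier_of_chord (isClosed_arrowPolygon n) ?_ ?_ ?_
    · rw [Ne, div_left_inj' hD.ne']; linarith
    · refine (convex_convexHull ℝ _).segment_subset (hv _ (by omega) (by omega)) ?_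
      exact_mod_cast hv (k + 1 + 1) (by omega) (by omega)
    · refine arrowPolygon_subset_halfplane fun j => ?_
      rw [arrowVertex]
      split_ifs with hj
      · rw [dot_pair]
        have : 0 ≤ ((k + 1 : ℕ) : ℝ) / (2 * n) := by positivity
        have : 0 ≤ (((k + 1 : ℕ) : ℝ) + 1) / (2 * n) := by positivity
        simp only [Matrix.cons_val_zero, Matrix.cons_val_one]
        nlinarith
      · exact dot_parab_chord_le _ _

lemma isSimplePolygon_parabChain (M : ℕ) :
    IsSimplePolygon (M + 3) (enclosedRegion (parabChain M)) :=
  ⟨inferInstance, _, isSimpleChain_parabChain M, rfl⟩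

/-- The boundary of the region enclosed by the chain requires many line segments. -/
lemma le_card_of_consistsOf_frontier_parabChain {M : ℕ} {V : Finset Plane}
    {L R : Finset (Set Plane)}
    (h : ConsistsOf (frontier (enclosedRegion (parabChain M))) V L R) : M + 2 ≤ L.card := by
  have hD : (0 : ℝ) < 2 * (M + 3) := by positivity
  refine card_le_card_segments h
    (fun k : Fin (M + 2) => ((k : ℕ) : ℝ) / (2 * (M + 3)) + (((k : ℕ) : ℝ) + 1) / (2 * (M + 3)))
    (fun k => ((k : ℕ) : ℝ) / (2 * (M + 3)) * ((((k : ℕ) : ℝ) + 1) / (2 * (M + 3)))) ?_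
    fun k => ?_
  · intro k l hkl
    simp only [← add_div] at hkl
    have h1 := (div_left_inj' hD.ne').1 hkl
    have h2 : ((k : ℕ) : ℝ) = ((l : ℕ) : ℝ) := by linarith
    exact Fin.ext (by exact_mod_cast h2)
  · refine infinite_frontier_of_chord (isClosed_enclosedRegion _) ?_ ?_ ?_
    · rw [Ne, div_left_inj' hD.ne']; linarith
    · intro x hx
      refine Or.inl (mem_iUnion.2 ⟨k.castSucc, ?_⟩)
      have hr : finRotate (M + 3) k.castSucc = k.succ :=
        Fin.ext (by rw [finRotate_val_of_ne_last (Fin.castSucc_lt_last k).ne]; rfl)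
      rw [edgeSet_eq, hr, parabChain_apply, parabChain_apply, Fin.val_castSucc, Fin.val_succ]
      exact_mod_cast hx
    · refine enclosedRegion_subset_halfplane (pair_ne_zero (by norm_num)) fun j => ?_
      exact dot_parab_chord_le _ _

lemma zero_mem_parabChain (M : ℕ) : (0 : Plane) ∈ enclosedRegion (parabChain M) := by
  refine Or.inl (mem_iUnion.2 ⟨0, ?_⟩)
  have h : parabChain M 0 = 0 := by
    rw [parabChain_apply]; ext i; fin_cases i <;> simp [parab]
  rw [edgeSet_eq, h]
  exact left_mem_segment ℝ _ _

lemma bounds_of_mem_parabChain {M : ℕ} {x : Plane} (hx : x ∈ enclosedRegion (parabChain M)) :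
    0 ≤ x 0 ∧ x 0 ≤ 1 / 2 ∧ 0 ≤ x 1 ∧ x 1 ≤ 1 / 4 := by
  have ht : ∀ i : Fin (M + 3), 0 ≤ (i : ℝ) / (2 * (M + 3)) ∧ (i : ℝ) / (2 * (M + 3)) ≤ 1 / 2 := by
    intro i
    have hi : (i : ℝ) ≤ M + 3 := by exact_mod_cast i.2.le
    exact ⟨by positivity, by rw [div_le_iff₀ (by positivity)]; linarith⟩
  have key : ∀ a b c : ℝ, (a ≠ 0 ∨ b ≠ 0) →
      (∀ t : ℝ, 0 ≤ t → t ≤ 1 / 2 → a * t + b * t ^ 2 ≤ c) → a * x 0 + b * x 1 ≤ c := by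
    intro a b c hab h
    have hne : (!₂[a, b] : Plane) ≠ 0 := by
      intro h0
      rcases hab with ha | hb
      · exact ha (by simpa using congrArg (fun z : Plane => z 0) h0)
      · exact hb (by simpa using congrArg (fun z : Plane => z 1) h0)
    have := enclosedRegion_subset_halfplane (P := parabChain M) (c := c) hne (fun i => by
      rw [parabChain_apply, dot_pair]
      simpa only [parab_zero, parab_one] using h _ (ht i).1 (ht i).2) x hx
    rwa [dot_pair] at this
  have h1 := key (-1) 0 0 (by norm_num) fun t h0 h1 => by linarith
  have h2 := key 1 0 (1 / 2) (by norm_num) fun t h0 h1 => by linarith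
  have h3 := key 0 (-1) 0 (by norm_num) fun t h0 h1 => by nlinarith
  have h4 := key 0 1 (1 / 4) (by norm_num) fun t h0 h1 => by nlinarith
  exact ⟨by linarith, by linarith, by linarith, by linarith⟩

/-- Both polygons lie in the neighbourhood of radius one of the other. -/
lemma exists_dist_le_one_of_mem_arrowPolygon {n M : ℕ} {x : Plane} (hx : x ∈ arrowPolygon n) :
    ∃ y ∈ enclosedRegion (parabChain M), dist x y ≤ 1 :=
  ⟨0, zero_mem_parabChain M, arrowPolygon_subset_closedBall n hx⟩

lemma exists_dist_le_one_of_mem_parabChain {n M : ℕ} (hn : 3 ≤ n) {x : Plane}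
    (hx : x ∈ enclosedRegion (parabChain M)) : ∃ y ∈ arrowPolygon n, dist x y ≤ 1 := by
  refine ⟨_, arrowVertex_mem n ⟨1, by omega⟩, ?_⟩
  obtain ⟨h0, h1, h2, h3⟩ := bounds_of_mem_parabChain hx
  rw [arrowVertex, if_neg one_ne_zero, EuclideanSpace.dist_eq, Fin.sum_univ_two,
    Real.sqrt_le_iff]
  refine ⟨zero_le_one, ?_⟩
  have hn' : (3 : ℝ) ≤ n := by exact_mod_cast hn
  set t : ℝ := ((1 : ℕ) : ℝ) / (2 * n) with ht
  have ht0 : 0 ≤ t := by positivity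
  have ht1 : t ≤ 1 / 2 := by
    rw [ht, div_le_iff₀ (by positivity), Nat.cast_one]; linarith
  have ht2 : t ^ 2 ≤ 1 / 4 := by nlinarith
  simp only [parab_zero, parab_one, Real.dist_eq, sq_abs]
  have e1 : (x 0 - t) ^ 2 ≤ 1 / 4 := by nlinarith
  have e2 : (x 1 - t ^ 2) ^ 2 ≤ 1 / 4 := by nlinarith [sq_nonneg t]
  linarith

lemma hausdorffDist_arrowPolygon_parabChain {n : ℕ} (hn : 3 ≤ n) (M : ℕ) :
    hausdorffDist (arrowPolygon n) (enclosedRegion (parabChain M)) = 1 := by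
  have hv : (!₂[-1, 0] : Plane) ∈ arrowPolygon n := by
    have := arrowVertex_mem n ⟨0, by omega⟩
    rwa [arrowVertex, if_pos rfl] at this
  apply le_antisymm
  · exact hausdorffDist_le_of_mem_dist zero_le_one
      (fun x hx => exists_dist_le_one_of_mem_arrowPolygon hx)
      (fun x hx => exists_dist_le_one_of_mem_parabChain hn hx)
  · refine le_trans ?_ (infDist_le_hausdorffDist_of_mem hv
      (hausdorffEDist_ne_top_of_nonempty_of_bounded ⟨_, hv⟩ ⟨_, zero_mem_parabChain M⟩
        (isBounded_closedBall.subset (arrowPolygon_subset_closedBall n))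
        (isCompact_enclosedRegion _).isBounded))
    rw [le_infDist ⟨_, zero_mem_parabChain M⟩]
    intro y hy
    rw [EuclideanSpace.dist_eq, Fin.sum_univ_two]
    refine Real.le_sqrt_of_sq_le ?_
    have := (bounds_of_mem_parabChain hy).1
    simp only [Real.dist_eq, sq_abs, Matrix.cons_val_zero, Matrix.cons_val_one]
    nlinarith [sq_nonneg (0 - y 1)]

lemma middleSet_zero {A B : Set Plane} (h : ∀ x ∈ A, ∃ y ∈ B, dist x y ≤ 1) :
    middleSet 0 A B = A := by
  rw [middleSet, closedBall_zero, singleton_zero, add_zero, sub_zero, inter_eq_left]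
  exact fun x hx => mem_add_closedBall.2 (h x hx)

lemma middleSet_one {A B : Set Plane} (h : ∀ x ∈ B, ∃ y ∈ A, dist x y ≤ 1) :
    middleSet 1 A B = B := by
  rw [middleSet, sub_self, closedBall_zero, singleton_zero, add_zero, inter_eq_right]
  exact fun x hx => mem_add_closedBall.2 (h x hx)

/-- At the ends of the parameter interval the middle set is one of the two polygons, so that the
larger one of the two vertex numbers bounds the number of pieces from below. -/
lemma exists_polygons_forall_le_card {n m : ℕ} (hn : 3 ≤ n) (hm : 3 ≤ m) :
    ∃ A B : Set Plane, IsConvexPolygon n A ∧ IsSimplePolygon m B ∧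
      hausdorffDist A B = 1 ∧ ∃ α ∈ Icc (0 : ℝ) 1,
        ∀ (V : Finset Plane) (L R : Finset (Set Plane)),
          ConsistsOf (frontier (middleSet α A B)) V L R → n + m ≤ 6 * L.card := by
  obtain ⟨M, rfl⟩ : ∃ M, m = M + 3 := ⟨m - 3, by omega⟩
  refine ⟨arrowPolygon n, enclosedRegion (parabChain M),
    ⟨hn, _, convexIndependent_arrowVertex n, rfl⟩, isSimplePolygon_parabChain M,
    hausdorffDist_arrowPolygon_parabChain hn M, ?_⟩
  rcases le_total (M + 3) n with h | h
  · refine ⟨0, ⟨le_rfl, zero_le_one⟩, fun V L R hc => ?_⟩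
    rw [middleSet_zero fun x hx => exists_dist_le_one_of_mem_arrowPolygon hx] at hc
    have := le_card_of_consistsOf_frontier_arrowPolygon hc
    omega
  · refine ⟨1, ⟨zero_le_one, le_rfl⟩, fun V L R hc => ?_⟩
    rw [middleSet_one fun x hx => exists_dist_le_one_of_mem_parabChain hn hx] at hc
    have := le_card_of_consistsOf_frontier_parabChain hc
    omega

end HausdorffMiddle


theorem mainTheorem9 :
    (∃ C : ℝ, 0 < C ∧ ∀ (n m : ℕ) (A B : Set Plane), IsConvexPolygon n A → IsSimplePolygon m B →
      ∀ α ∈ Set.Icc (0 : ℝ) 1, ∃ (V : Finset Plane) (L R : Finset (Set Plane)),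
        ConsistsOf (frontier (middleSet α A B)) V L R ∧
          ((V.card + L.card + R.card : ℕ) : ℝ) ≤ C * ((n : ℝ) + (m : ℝ))) ∧
    (∃ c : ℝ, 0 < c ∧ ∀ n m : ℕ, 3 ≤ n → 3 ≤ m →
      ∃ A B : Set Plane, IsConvexPolygon n A ∧ IsSimplePolygon m B ∧
        Metric.hausdorffDist A B = 1 ∧ ∃ α ∈ Set.Icc (0 : ℝ) 1,
          ∀ (V : Finset Plane) (L R : Finset (Set Plane)),
            ConsistsOf (frontier (middleSet α A B)) V L R →
              c * ((n : ℝ) + (m : ℝ)) ≤ ((V.card + L.card + R.card : ℕ) : ℝ)) := by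
  refine ⟨⟨30000000000, by norm_num, fun n m A B hA hB α hα => ?_⟩,
    ⟨1 / 6, by norm_num, fun n m hn hm => ?_⟩⟩
  · obtain ⟨V, L, R, h, hle⟩ := exists_consistsOf_middleSet hA hB hα
    exact ⟨V, L, R, h, by exact_mod_cast hle⟩
  · obtain ⟨A, B, hA, hB, hd, α, hα, h⟩ := exists_polygons_forall_le_card hn hm
    refine ⟨A, B, hA, hB, hd, α, hα, fun V L R hc => ?_⟩
    have h1 : ((n + m : ℕ) : ℝ) ≤ ((6 * L.card : ℕ) : ℝ) := by exact_mod_cast h V L R hc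
    push_cast at h1 ⊢
    have : (0 : ℝ) ≤ V.card := by positivity
    have : (0 : ℝ) ≤ R.card := by positivity
    linarith
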